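/- Let $K=\mathbb{Q}(i)$, $\mathcal{O}=\mathbb{Z}[i]$, $J=\begin{pmatrix}0&-1_2\\1_2&0\end{pmatrix}$, and let $p$ be a rational prime that remains prime in $\mathcal{O}$. Let $S_p^2$ be the group of matrices $g\in M_4(\mathcal{O}[1/p])$ with $\bar g^{t}Jg=p^{\delta}J$ for some $\delta\in\mathbb{Z}$, let $\Gamma_2=\{g\in M_4(\mathcal{O}) : \bar g^{t}Jg=J\}$, let $S_p^{1,1}\subset S_p^2$ be the subgroup of matrices with last row $(0,0,0,*)$, and put $\Gamma_{1,1}=\Gamma_2\cap S_p^{1,1}$. For a Hecke pair $(\Gamma,S)$, let $H(\Gamma,S)$ be the rational Hecke ring: the finite formal sums $\sum_i a_i(\Gamma g_i)$ with $a_i\in\mathbb{Q}$, $g_i\in S$, that are invariant under right multiplication by $\Gamma$, with product $\sum_i a_i(\Gamma g_i)\cdot\sum_j b_j(\Gamma h_j)=\sum_{i,j}a_ib_j(\Gamma g_ih_j)$; a double coset $\Gamma g\Gamma$ is identified with the sum of the cosets $\Gamma x$ it contains. Put $H_p^2=H(\Gamma_2,S_p^2)$ and $H_p^{1,1}=H(\Gamma_{1,1},S_p^{1,1})$,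 and let $\epsilon:H_p^2\to H_p^{1,1}$ be the embedding $\sum_i a_i(\Gamma_2g_i)\mapsto\sum_i a_i(\Gamma_{1,1}g_i)$, where the representatives $g_i$ are chosen in $S_p^{1,1}$. Let $\Phi:H_p^2\to\mathbb{Q}[x_0^{\pm1},x_1^{\pm1},x_2^{\pm1}]$ be the Satake map, i.e. the $\mathbb{Q}$-linear map which sends a coset $\Gamma_2MN$, with $M=\begin{pmatrix}p^{m_0}(\bar D^{t})^{-1}&0\\0&D\end{pmatrix}$, $D=\mathrm{diag}(p^{m_1},p^{m_2})$, and $N=\begin{pmatrix}A'&B'\\0&D'\end{pmatrix}\in S_p^2$ unipotent with $D'$ upper triangular, to $x_0^{m_0}(x_1p^{-2})^{m_1}(x_2p^{-4})^{m_2}$ (every coset in $\Gamma_2\backslash S_p^2$ has this form, with unique exponents). Let $z_p^{(2)}(t)=\prod_{i=1}^{2}(1-p^2x_it)(1-p^4x_i^{-1}t)$. Then there is exactly one polynomial $Z_p^{(2)}(t)\in H_p^2[t]$ with $\Phi(Z_p^{(2)})=z_p^{(2)}$ (applying $\Phi$ to the coefficients). Put $D_p^{(2)}(X)=Z_p^{(2)}(p^{-3}X)$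 and regard it as a polynomial over $H_p^{1,1}$ through $\epsilon$. In $H_p^{1,1}$ let $$T^J=\Gamma_{1,1}\mathrm{diag}(1,p,p^2,p)\Gamma_{1,1},\quad \Lambda_-(p)=\Gamma_{1,1}\mathrm{diag}(p,p^2,p,1)\Gamma_{1,1},\quad \Lambda_+(p)=\Gamma_{1,1}\mathrm{diag}(p,1,p,p^2)\Gamma_{1,1},$$ $$T_-=\Gamma_{1,1}\mathrm{diag}(1,p,p,1)\Gamma_{1,1},\quad T_+=\Gamma_{1,1}\mathrm{diag}(1,1,p,p)\Gamma_{1,1},\quad \Delta_p=\Gamma_{1,1}\mathrm{diag}(p,p,p,p)\Gamma_{1,1},$$ $$\nabla_p=\sum_{a\in\mathbb{Z}/p\mathbb{Z}}\Gamma_{1,1}\begin{pmatrix}p&0&0&0\\0&p&0&a\\0&0&p&0\\0&0&0&p\end{pmatrix},$$ and write $T^{J,r}=\Delta_p^{-1}T^J$ and $\nabla_p^r=\Delta_p^{-1}\nabla_p$ (the element $\Delta_p$ is invertible). Then, in $H_p^{1,1}[X]$ (with $X$ central), $$D_p^{(2)}(X)=\bigl(1-p^{-3}\Delta_p^{-1}\Lambda_-(p)X\bigr)\,S^{(2)}(X)\,\bigl(1-p^{-3}\Delta_p^{-1}\Lambda_+(p)X\bigr),$$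 where $S^{(2)}(X)=1-S_1X+S_2X^2-S_3X^3$ with $$S_1=p^{-3}\bigl(T^{J,r}+\nabla_p^r-p(p^2-p+1)\bigr),$$ $$S_2=p^{-4}\Delta_p^{-1}T_+T_--p^{-3}T^{J,r}-2p^{-3}\nabla_p^r-p^{-2}(p-2),$$ $$S_3=p^{-3}(\nabla_p^r-p).$$ -/

import Mathlib

open Polynomial
open scoped Matrix

noncomputable section

/-! ### Abstract Hecke rings

For a group `G` and a subgroup `Γ`, the rational Hecke ring `H(Γ, G)` is realised, as usual, as the
space of finite formal sums `∑ aᵢ (Γ gᵢ)` of cosets in `Γ \ G` that are invariant under right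
multiplication by `Γ`, with product
`(∑ aᵢ (Γ gᵢ)) * (∑ bⱼ (Γ hⱼ)) = ∑ aᵢ bⱼ (Γ gᵢ hⱼ)`. -/

section Abstract

variable {G : Type*} [Group G]

/-- The set `Γ \ G` of cosets `Γ g`. -/
abbrev Cosets (Γ : Subgroup G) : Type _ := Quotient (QuotientGroup.rightRel Γ)

/-- The coset `Γ g`. -/
def coset (Γ : Subgroup G) (g : G) : Cosets Γ := Quotient.mk (QuotientGroup.rightRel Γ) g

theorem coset_eq_iff {Γ : Subgroup G} {g h : G} : coset Γ g = coset Γ h ↔ h * g⁻¹ ∈ Γ := by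
  unfold coset
  rw [Quotient.eq, QuotientGroup.rightRel_apply]

/-- Right multiplication `Γ h ↦ Γ h g`. -/
def Cosets.translate {Γ : Subgroup G} (g : G) : Cosets Γ → Cosets Γ :=
  Quotient.lift (fun h => coset Γ (h * g)) (by
    intro a b hab
    have h1 : b * a⁻¹ ∈ Γ := QuotientGroup.rightRel_apply.1 hab
    refine coset_eq_iff.2 ?_
    have h2 : b * g * (a * g)⁻¹ = b * a⁻¹ := by group
    rwa [h2])

theorem Cosets.translate_coset {Γ : Subgroup G} (g h : G) :
    Cosets.translate g (coset Γ h) = coset Γ (h * g) := rfl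

theorem Cosets.translate_translate {Γ : Subgroup G} (g h : G) (c : Cosets Γ) :
    Cosets.translate h (Cosets.translate g c) = Cosets.translate (g * h) c := by
  induction c using Quotient.inductionOn with
  | h a => exact congrArg (coset Γ) (mul_assoc a g h)

/-- Right multiplication by `g`, extended linearly to formal sums of cosets. -/
def rightMul {Γ : Subgroup G} (g : G) : (Cosets Γ →₀ ℚ) →ₗ[ℚ] (Cosets Γ →₀ ℚ) :=
  Finsupp.lmapDomain ℚ ℚ (Cosets.translate g)

theorem rightMul_single {Γ : Subgroup G} (g h : G) (a : ℚ) :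
    rightMul g (Finsupp.single (coset Γ h) a) = Finsupp.single (coset Γ (h * g)) a := by
  simp [rightMul, Cosets.translate_coset]

theorem rightMul_rightMul {Γ : Subgroup G} (g h : G) (v : Cosets Γ →₀ ℚ) :
    rightMul h (rightMul g v) = rightMul (g * h) v := by
  simp only [rightMul, Finsupp.lmapDomain_apply]
  rw [← Finsupp.mapDomain_comp]
  congr 1
  funext c
  exact Cosets.translate_translate g h c

/-- The `Γ`-invariant formal sums of cosets. -/
def heckeSubmodule (Γ : Subgroup G) : Submodule ℚ (Cosets Γ →₀ ℚ) where
  carrier := {v | ∀ γ ∈ Γ, rightMul γ v = v}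
  add_mem' := by
    intro v w hv hw γ hγ
    rw [map_add, hv γ hγ, hw γ hγ]
  zero_mem' := by
    intro γ _
    rw [map_zero]
  smul_mem' := by
    intro a v hv γ hγ
    rw [map_smul, hv γ hγ]

/-- The rational Hecke ring `H(Γ, G)`. -/
def HeckeAlgebra (Γ : Subgroup G) : Type _ := heckeSubmodule Γ

namespace HeckeAlgebra

variable {Γ : Subgroup G}

instance : AddCommGroup (HeckeAlgebra Γ) := inferInstanceAs (AddCommGroup (heckeSubmodule Γ))
instance : Module ℚ (HeckeAlgebra Γ) := inferInstanceAs (Module ℚ (heckeSubmodule Γ))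

/-- The underlying formal sum of cosets. -/
def toSum : HeckeAlgebra Γ →ₗ[ℚ] (Cosets Γ →₀ ℚ) := (heckeSubmodule Γ).subtype

theorem toSum_injective : Function.Injective (toSum (Γ := Γ)) := Subtype.val_injective

theorem rightMul_toSum (v : HeckeAlgebra Γ) {γ : G} (hγ : γ ∈ Γ) :
    rightMul γ (toSum v) = toSum v := v.2 γ hγ

/-- The formal sum `∑ aᵢ (Γ gᵢ h)` attached to `v = ∑ aᵢ (Γ gᵢ)` and a coset `Γ h`. -/
def mulCoset (v : HeckeAlgebra Γ) : Cosets Γ → (Cosets Γ →₀ ℚ) :=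
  Quotient.lift (fun h => rightMul h (toSum v)) (by
    intro a b hab
    have h1 : b * a⁻¹ ∈ Γ := QuotientGroup.rightRel_apply.1 hab
    have h2 : rightMul b (toSum v) = rightMul a (rightMul (b * a⁻¹) (toSum v)) := by
      rw [rightMul_rightMul]
      congr 2
      group
    change rightMul a (toSum v) = rightMul b (toSum v)
    rw [h2, rightMul_toSum v h1])

/-- The linear map `∑ bⱼ (Γ hⱼ) ↦ ∑ aᵢ bⱼ (Γ gᵢ hⱼ)` attached to `v = ∑ aᵢ (Γ gᵢ)`. -/
def mulLeft (v : HeckeAlgebra Γ) : (Cosets Γ →₀ ℚ) →ₗ[ℚ] (Cosets Γ →₀ ℚ) :=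
  Finsupp.linearCombination ℚ (mulCoset v)

theorem mulLeft_single (v : HeckeAlgebra Γ) (h : G) (b : ℚ) :
    mulLeft v (Finsupp.single (coset Γ h) b) = b • rightMul h (toSum v) := by
  simp only [mulLeft, Finsupp.linearCombination_single]
  rfl

theorem hom_ext {f g : (Cosets Γ →₀ ℚ) →ₗ[ℚ] (Cosets Γ →₀ ℚ)}
    (h : ∀ a, f (Finsupp.single (coset Γ a) 1) = g (Finsupp.single (coset Γ a) 1)) : f = g := by
  refine Finsupp.lhom_ext' fun c => LinearMap.ext_ring ?_
  induction c using Quotient.inductionOn with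
  | h a => exact h a

theorem mulLeft_rightMul (v : HeckeAlgebra Γ) (g : G) (x : Cosets Γ →₀ ℚ) :
    mulLeft v (rightMul g x) = rightMul g (mulLeft v x) := by
  have : (mulLeft v).comp (rightMul g) = (rightMul g).comp (mulLeft v) := by
    refine hom_ext fun a => ?_
    simp only [LinearMap.comp_apply, rightMul_single, mulLeft_single, one_smul, rightMul_rightMul]
  exact LinearMap.congr_fun this x

instance : Mul (HeckeAlgebra Γ) where
  mul v w := ⟨mulLeft v (toSum w), fun γ hγ => by
    rw [← mulLeft_rightMul, rightMul_toSum w hγ]⟩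

instance : One (HeckeAlgebra Γ) where
  one := ⟨Finsupp.single (coset Γ 1) 1, fun γ hγ => by
    rw [rightMul_single]
    congr 1
    exact coset_eq_iff.2 (by simpa using hγ)⟩

theorem toSum_mul (v w : HeckeAlgebra Γ) : toSum (v * w) = mulLeft v (toSum w) := rfl

theorem toSum_one : toSum (1 : HeckeAlgebra Γ) = Finsupp.single (coset Γ 1) 1 := rfl

theorem mulLeft_coset_one (v : HeckeAlgebra Γ) :
    mulLeft v (Finsupp.single (coset Γ 1) 1) = toSum v := by
  rw [mulLeft_single, one_smul, rightMul_toSum v Γ.one_mem]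

theorem mulLeft_mul (v w : HeckeAlgebra Γ) : mulLeft (v * w) = (mulLeft v).comp (mulLeft w) := by
  refine hom_ext fun a => ?_
  simp only [LinearMap.comp_apply, mulLeft_single, one_smul, toSum_mul, mulLeft_rightMul]

theorem mulLeft_one : mulLeft (1 : HeckeAlgebra Γ) = LinearMap.id := by
  refine hom_ext fun a => ?_
  simp only [mulLeft_single, one_smul, toSum_one, rightMul_single, one_mul, LinearMap.id_apply]

theorem mulLeft_add (v w : HeckeAlgebra Γ) : mulLeft (v + w) = mulLeft v + mulLeft w := by
  refine hom_ext fun a => ?_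
  simp only [mulLeft_single, one_smul, map_add, LinearMap.add_apply]

theorem mulLeft_smul (a : ℚ) (v : HeckeAlgebra Γ) : mulLeft (a • v) = a • mulLeft v := by
  refine hom_ext fun g => ?_
  simp only [mulLeft_single, one_smul, map_smul, LinearMap.smul_apply]

instance : Ring (HeckeAlgebra Γ) :=
  { (inferInstance : AddCommGroup (HeckeAlgebra Γ)) with
    mul := (· * ·)
    one := 1
    mul_assoc := fun u v w => toSum_injective (by
      simp only [toSum_mul, mulLeft_mul, LinearMap.comp_apply])
    one_mul := fun v => toSum_injective (by
      rw [toSum_mul, mulLeft_one, LinearMap.id_apply])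
    mul_one := fun v => toSum_injective (by
      rw [toSum_mul, toSum_one, mulLeft_coset_one])
    left_distrib := fun u v w => toSum_injective (by
      rw [toSum_mul, map_add, map_add, map_add, toSum_mul, toSum_mul])
    right_distrib := fun u v w => toSum_injective (by
      rw [toSum_mul, mulLeft_add, LinearMap.add_apply, map_add, toSum_mul, toSum_mul])
    zero_mul := fun v => toSum_injective (by
      have h : mulLeft (0 : HeckeAlgebra Γ) = 0 := by
        have := mulLeft_smul (0 : ℚ) (0 : HeckeAlgebra Γ)
        simpa using this
      rw [toSum_mul, h, LinearMap.zero_apply, map_zero])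
    mul_zero := fun v => toSum_injective (by
      rw [toSum_mul, map_zero, map_zero]) }

instance : Algebra ℚ (HeckeAlgebra Γ) :=
  Algebra.ofModule
    (fun a v w => toSum_injective (by
      rw [toSum_mul, mulLeft_smul, LinearMap.smul_apply, map_smul, toSum_mul]))
    (fun a v w => toSum_injective (by
      rw [toSum_mul, map_smul, map_smul, map_smul, toSum_mul]))

end HeckeAlgebra

/-- The cosets `Γ x` contained in the double coset `Γ g Γ`. -/
def cosetsIn (Γ : Subgroup G) (g : G) : Set (Cosets Γ) := {c | ∃ γ ∈ Γ, coset Γ (g * γ) = c}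

/-- `(Γ, G)` is a Hecke pair: each double coset `Γ g Γ` is a finite union of cosets `Γ x`. -/
class IsHeckePair (Γ : Subgroup G) : Prop where
  finite (g : G) : (cosetsIn Γ g).Finite

theorem translate_mem_cosetsIn {Γ : Subgroup G} {g γ : G} (hγ : γ ∈ Γ) {c : Cosets Γ}
    (hc : c ∈ cosetsIn Γ g) : Cosets.translate γ c ∈ cosetsIn Γ g := by
  obtain ⟨δ, hδ, rfl⟩ := hc
  exact ⟨δ * γ, Γ.mul_mem hδ hγ, by rw [Cosets.translate_coset, mul_assoc]⟩

theorem translate_one {Γ : Subgroup G} (c : Cosets Γ) : Cosets.translate 1 c = c := by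
  induction c using Quotient.inductionOn with
  | h a => exact congrArg (coset Γ) (mul_one a)

/-- The double coset `Γ g Γ` as an element of the Hecke ring: the sum of the cosets `Γ x` that it
contains. -/
def doubleCoset (Γ : Subgroup G) [IsHeckePair Γ] (g : G) : HeckeAlgebra Γ :=
  ⟨∑ c ∈ (IsHeckePair.finite (Γ := Γ) g).toFinset, Finsupp.single c 1, fun γ hγ => by
    rw [map_sum]
    refine Finset.sum_nbij' (Cosets.translate γ) (Cosets.translate γ⁻¹) ?_ ?_ ?_ ?_ ?_
    · intro c hc
      rw [Set.Finite.mem_toFinset] at hc ⊢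
      exact translate_mem_cosetsIn hγ hc
    · intro c hc
      rw [Set.Finite.mem_toFinset] at hc ⊢
      exact translate_mem_cosetsIn (Γ.inv_mem hγ) hc
    · intro c _
      rw [Cosets.translate_translate, mul_inv_cancel, translate_one]
    · intro c _
      rw [Cosets.translate_translate, inv_mul_cancel, translate_one]
    · intro c _
      simp [rightMul]⟩

/-- For `S₀ ≤ G`, the map `Γ₀ \ S₀ → Γ \ G`, `Γ₀ g ↦ Γ g`, where `Γ₀ = Γ ∩ S₀`. -/
def cosetInclusion (Γ S₀ : Subgroup G) : Cosets (Γ.subgroupOf S₀) → Cosets Γ :=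
  Quotient.lift (fun g => coset Γ (g : G)) (by
    intro a b hab
    have h1 : b * a⁻¹ ∈ Γ.subgroupOf S₀ := QuotientGroup.rightRel_apply.1 hab
    exact coset_eq_iff.2 (by simpa [Subgroup.mem_subgroupOf] using h1))

theorem cosetInclusion_coset (Γ S₀ : Subgroup G) (g : S₀) :
    cosetInclusion Γ S₀ (coset (Γ.subgroupOf S₀) g) = coset Γ (g : G) := rfl

theorem cosetInclusion_injective (Γ S₀ : Subgroup G) :
    Function.Injective (cosetInclusion Γ S₀) := by
  intro c d
  induction c using Quotient.inductionOn with
  | h a =>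
    induction d using Quotient.inductionOn with
    | h b =>
      intro h
      have h1 : coset Γ (a : G) = coset Γ (b : G) := h
      rw [coset_eq_iff] at h1
      exact coset_eq_iff.2 (by simpa [Subgroup.mem_subgroupOf] using h1)

theorem cosetInclusion_translate (Γ S₀ : Subgroup G) (γ : S₀) (c : Cosets (Γ.subgroupOf S₀)) :
    cosetInclusion Γ S₀ (Cosets.translate γ c) =
      Cosets.translate (γ : G) (cosetInclusion Γ S₀ c) := by
  induction c using Quotient.inductionOn with
  | h a => rfl

instance (Γ S₀ : Subgroup G) [IsHeckePair Γ] : IsHeckePair (Γ.subgroupOf S₀) where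
  finite g := by
    refine Set.Finite.of_finite_image (f := cosetInclusion Γ S₀) ?_
      (cosetInclusion_injective Γ S₀).injOn
    refine (IsHeckePair.finite (Γ := Γ) (g : G)).subset ?_
    rintro _ ⟨_, ⟨γ, hγ, rfl⟩, rfl⟩
    exact ⟨(γ : G), hγ, rfl⟩

/-- The function underlying `heckeEmbedding`:
`∑ aᵢ (Γ gᵢ) ↦ ∑ aᵢ (Γ₀ gᵢ)` with representatives `gᵢ ∈ S₀`: the coefficient of `Γ₀ g` in `ε X`
is the coefficient of `Γ g` in `X`. -/
def heckeEmbeddingFun (Γ S₀ : Subgroup G) (v : HeckeAlgebra Γ) :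
    HeckeAlgebra (Γ.subgroupOf S₀) :=
  ⟨Finsupp.comapDomain (cosetInclusion Γ S₀) (HeckeAlgebra.toSum v)
      (cosetInclusion_injective Γ S₀).injOn, fun γ hγ => by
    have inv : ∀ d, (HeckeAlgebra.toSum v) (Cosets.translate (γ : G) d) =
        (HeckeAlgebra.toSum v) d := by
      intro d
      have h := HeckeAlgebra.rightMul_toSum v (γ := (γ : G)) hγ
      have hinj : Function.Injective (Cosets.translate (Γ := Γ) (γ : G)) := by
        intro a b hab
        have h3 := congrArg (Cosets.translate (γ : G)⁻¹) hab
        simpa [Cosets.translate_translate, translate_one] using h3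
      conv_lhs => rw [← h]
      exact Finsupp.mapDomain_apply hinj _ _
    have hinj : Function.Injective (Cosets.translate (Γ := Γ.subgroupOf S₀) γ) := by
      intro a b hab
      have h3 := congrArg (Cosets.translate γ⁻¹) hab
      simpa [Cosets.translate_translate, translate_one] using h3
    ext c
    obtain ⟨d, rfl⟩ : ∃ d, Cosets.translate γ d = c :=
      ⟨Cosets.translate γ⁻¹ c, by
        rw [Cosets.translate_translate, inv_mul_cancel, translate_one]⟩
    have h4 : rightMul γ (Finsupp.comapDomain (cosetInclusion Γ S₀) (HeckeAlgebra.toSum v)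
        (cosetInclusion_injective Γ S₀).injOn) (Cosets.translate γ d) =
        Finsupp.comapDomain (cosetInclusion Γ S₀) (HeckeAlgebra.toSum v)
        (cosetInclusion_injective Γ S₀).injOn d := Finsupp.mapDomain_apply hinj _ _
    rw [h4, Finsupp.comapDomain_apply, Finsupp.comapDomain_apply, cosetInclusion_translate, inv]⟩

/-- For `S₀ ≤ G` and `Γ₀ = Γ ∩ S₀`, the map `ε : H(Γ, G) → H(Γ₀, S₀)`,
`∑ aᵢ (Γ gᵢ) ↦ ∑ aᵢ (Γ₀ gᵢ)` with representatives `gᵢ ∈ S₀`. -/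
def heckeEmbedding (Γ S₀ : Subgroup G) :
    HeckeAlgebra Γ →ₗ[ℚ] HeckeAlgebra (Γ.subgroupOf S₀) where
  toFun := heckeEmbeddingFun Γ S₀
  map_add' _ _ := HeckeAlgebra.toSum_injective (Finsupp.ext fun _ => rfl)
  map_smul' _ _ := HeckeAlgebra.toSum_injective (Finsupp.ext fun _ => rfl)

/-- If `z` is central, the double coset of `z` is the single coset `Γ z`. -/
theorem doubleCoset_central (Γ : Subgroup G) [IsHeckePair Γ] {z : G} (hz : ∀ g, z * g = g * z) :
    HeckeAlgebra.toSum (doubleCoset Γ z) = Finsupp.single (coset Γ z) 1 := by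
  have h : (IsHeckePair.finite (Γ := Γ) z).toFinset = {coset Γ z} := by
    ext c
    rw [Set.Finite.mem_toFinset, Finset.mem_singleton]
    constructor
    · rintro ⟨γ, hγ, rfl⟩
      refine (coset_eq_iff.2 ?_).symm
      rw [hz γ]
      simpa using hγ
    · rintro rfl
      exact ⟨1, Γ.one_mem, by rw [mul_one]⟩
  change ∑ c ∈ (IsHeckePair.finite (Γ := Γ) z).toFinset, Finsupp.single c (1 : ℚ) = _
  rw [h, Finset.sum_singleton]

theorem doubleCoset_central_mul (Γ : Subgroup G) [IsHeckePair Γ] {z w : G}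
    (hz : ∀ g, z * g = g * z) (hw : ∀ g, w * g = g * w) (h : z * w = 1) :
    doubleCoset Γ z * doubleCoset Γ w = 1 := by
  apply HeckeAlgebra.toSum_injective
  rw [HeckeAlgebra.toSum_mul, doubleCoset_central Γ hw, HeckeAlgebra.mulLeft_single, one_smul,
    doubleCoset_central Γ hz, rightMul_single, h, HeckeAlgebra.toSum_one]

end Abstract

/-- Apply a linear map to a polynomial, coefficient by coefficient. -/
def mapCoeffs {A B : Type*} [Ring A] [Ring B] [Module ℚ A] [Module ℚ B] (f : A →ₗ[ℚ] B)
    (P : A[X]) : B[X] :=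
  ∑ n ∈ P.support, monomial n (f (P.coeff n))

/-! ### The field `K = ℚ(i)` and the groups -/

/-- `K = ℚ(i)`: elements `⟨x, y⟩ = x + y i` with `i ^ 2 = -1`. The star operation is complex
conjugation. -/
abbrev GaussField : Type := QuadraticAlgebra ℚ (-1) 0

/-- The ring of integers `ℤ[i]` of `K`. -/
def gaussIntegers : Subring GaussField where
  carrier := {x | ∃ a b : ℤ, x = ⟨a, b⟩}
  mul_mem' := by
    rintro _ _ ⟨a, b, rfl⟩ ⟨c, d, rfl⟩
    exact ⟨a * c - b * d, a * d + b * c, by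
      ext <;> simp
      ring⟩
  one_mem' := ⟨1, 0, by ext <;> simp [QuadraticAlgebra.re_one, QuadraticAlgebra.im_one]⟩
  add_mem' := by
    rintro _ _ ⟨a, b, rfl⟩ ⟨c, d, rfl⟩
    exact ⟨a + c, b + d, by ext <;> simp⟩
  zero_mem' := ⟨0, 0, by ext <;> simp⟩
  neg_mem' := by
    rintro _ ⟨a, b, rfl⟩
    exact ⟨-a, -b, by ext <;> simp⟩

theorem star_mem_gaussIntegers {x : GaussField} (hx : x ∈ gaussIntegers) :
    star x ∈ gaussIntegers := by
  obtain ⟨a, b, rfl⟩ := hx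
  exact ⟨a, -b, by ext <;> simp⟩

/-- The ring `ℤ[i][1/p]`. -/
def gaussIntegersAway (p : ℕ) : Subring GaussField where
  carrier := {x | ∃ n : ℕ, (p : GaussField) ^ n * x ∈ gaussIntegers}
  mul_mem' := by
    rintro x y ⟨n, hn⟩ ⟨m, hm⟩
    refine ⟨n + m, ?_⟩
    have := gaussIntegers.mul_mem hn hm
    convert this using 1
    ring
  one_mem' := ⟨0, by simp⟩
  add_mem' := by
    rintro x y ⟨n, hn⟩ ⟨m, hm⟩
    refine ⟨n + m, ?_⟩
    have hp : ∀ k : ℕ, (p : GaussField) ^ k ∈ gaussIntegers := fun k =>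
      gaussIntegers.pow_mem (natCast_mem gaussIntegers p) k
    have := gaussIntegers.add_mem (gaussIntegers.mul_mem (hp m) hn)
      (gaussIntegers.mul_mem (hp n) hm)
    convert this using 1
    ring
  zero_mem' := ⟨0, by simp⟩
  neg_mem' := by
    rintro x ⟨n, hn⟩
    refine ⟨n, ?_⟩
    have := gaussIntegers.neg_mem hn
    convert this using 1
    ring

theorem gaussIntegers_le_away (p : ℕ) : gaussIntegers ≤ gaussIntegersAway p :=
  fun _ hx => ⟨0, by simpa using hx⟩

theorem star_mem_away {p : ℕ} {x : GaussField} (hx : x ∈ gaussIntegersAway p) :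
    star x ∈ gaussIntegersAway p := by
  obtain ⟨n, hn⟩ := hx
  refine ⟨n, ?_⟩
  have := star_mem_gaussIntegers hn
  simpa [mul_comm] using this

/-- The matrix `J₂ = (0, -1₂; 1₂, 0)`. -/
def matJ : Matrix (Fin 4) (Fin 4) GaussField :=
  !![0, 0, -1, 0; 0, 0, 0, -1; 1, 0, 0, 0; 0, 1, 0, 0]

theorem matJ_mul_matJ : matJ * matJ = -1 := by
  ext i j : 1
  fin_cases i <;> fin_cases j <;> simp [matJ, Matrix.mul_apply, Fin.sum_univ_four]

/-- A similitude with invertible factor has the explicit left inverse `-c⁻¹ J g* J`. -/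
theorem similitude_left_inv {M : Matrix (Fin 4) (Fin 4) GaussField} {c : ℚ} (hc : c ≠ 0)
    (h : Mᴴ * matJ * M = c • matJ) : (-c⁻¹) • (matJ * Mᴴ * matJ) * M = 1 := by
  have h1 : matJ * Mᴴ * matJ * M = matJ * (Mᴴ * matJ * M) := by simp only [Matrix.mul_assoc]
  rw [Matrix.smul_mul, h1, h, Matrix.mul_smul, matJ_mul_matJ, smul_smul]
  simp [hc]

theorem matJ_entry (A : Subring GaussField) (i j : Fin 4) : matJ i j ∈ A := by
  fin_cases i <;> fin_cases j <;> simp [matJ, A.zero_mem, A.one_mem, A.neg_mem]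

theorem entry_mul {A : Subring GaussField} {M N : Matrix (Fin 4) (Fin 4) GaussField}
    (hM : ∀ i j, M i j ∈ A) (hN : ∀ i j, N i j ∈ A) (i j : Fin 4) : (M * N) i j ∈ A := by
  rw [Matrix.mul_apply]
  exact A.sum_mem fun k _ => A.mul_mem (hM i k) (hN k j)

theorem inv_eq_of_similitude {g : GL (Fin 4) GaussField} {c : ℚ} (hc : c ≠ 0)
    (h : (g : Matrix (Fin 4) (Fin 4) GaussField)ᴴ * matJ * g = c • matJ) :
    ((g⁻¹ : GL (Fin 4) GaussField) : Matrix (Fin 4) (Fin 4) GaussField) =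
      (-c⁻¹) • (matJ * (g : Matrix (Fin 4) (Fin 4) GaussField)ᴴ * matJ) := by
  have h1 := similitude_left_inv hc h
  have h2 : (g : Matrix (Fin 4) (Fin 4) GaussField) *
      ((g⁻¹ : GL (Fin 4) GaussField) : Matrix (Fin 4) (Fin 4) GaussField) = 1 := by
    rw [← Units.val_mul, mul_inv_cancel, Units.val_one]
  exact (left_inv_eq_right_inv (M := Matrix (Fin 4) (Fin 4) GaussField) h1 h2).symm

theorem similitude_mul {M N : Matrix (Fin 4) (Fin 4) GaussField} {c d : ℚ}
    (hM : Mᴴ * matJ * M = c • matJ) (hN : Nᴴ * matJ * N = d • matJ) :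
    (M * N)ᴴ * matJ * (M * N) = (c * d) • matJ := by
  have : (M * N)ᴴ * matJ * (M * N) = Nᴴ * (Mᴴ * matJ * M) * N := by
    simp only [Matrix.conjTranspose_mul, Matrix.mul_assoc]
  rw [this, hM, Matrix.mul_smul, Matrix.smul_mul, hN, smul_smul]

theorem similitude_inv {g : GL (Fin 4) GaussField} {c : ℚ} (hc : c ≠ 0)
    (h : (g : Matrix (Fin 4) (Fin 4) GaussField)ᴴ * matJ * g = c • matJ) :
    ((g⁻¹ : GL (Fin 4) GaussField) : Matrix (Fin 4) (Fin 4) GaussField)ᴴ * matJ *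
      ((g⁻¹ : GL (Fin 4) GaussField) : Matrix (Fin 4) (Fin 4) GaussField) = c⁻¹ • matJ := by
  set M : Matrix (Fin 4) (Fin 4) GaussField := g.val
  set N : Matrix (Fin 4) (Fin 4) GaussField := ((g⁻¹ : GL (Fin 4) GaussField) :
    Matrix (Fin 4) (Fin 4) GaussField)
  have h2 : M * N = 1 := by
    change ((g * g⁻¹ : GL (Fin 4) GaussField) : Matrix (Fin 4) (Fin 4) GaussField) = 1
    rw [mul_inv_cancel, Units.val_one]
  have h3 : Nᴴ * Mᴴ = 1 := by rw [← Matrix.conjTranspose_mul, h2, Matrix.conjTranspose_one]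
  have h4 : Nᴴ * (Mᴴ * matJ * M) * N = matJ := by
    calc Nᴴ * (Mᴴ * matJ * M) * N = (Nᴴ * Mᴴ) * matJ * (M * N) := by
          simp only [Matrix.mul_assoc]
      _ = matJ := by rw [h2, h3, Matrix.one_mul, Matrix.mul_one]
  rw [h, Matrix.mul_smul, Matrix.smul_mul] at h4
  rw [← h4, smul_smul, inv_mul_cancel₀ hc, one_smul, h4]

section Prime

variable (p : ℕ) [Fact p.Prime]

theorem cast_p_ne_zero : (p : ℚ) ≠ 0 := Nat.cast_ne_zero.2 (Fact.out : p.Prime).ne_zero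

theorem algebraMap_zpow_mem (n : ℤ) :
    algebraMap ℚ GaussField ((p : ℚ) ^ n) ∈ gaussIntegersAway p := by
  have hp := cast_p_ne_zero p
  refine ⟨n.natAbs, ?_⟩
  have h1 : (p : GaussField) ^ n.natAbs * algebraMap ℚ GaussField ((p : ℚ) ^ n) =
      algebraMap ℚ GaussField ((p : ℚ) ^ ((n.natAbs : ℤ) + n)) := by
    rw [zpow_add₀ hp, map_mul, zpow_natCast, map_pow, map_natCast]
  obtain ⟨k, hk⟩ : ∃ k : ℕ, (n.natAbs : ℤ) + n = k := ⟨((n.natAbs : ℤ) + n).toNat, by omega⟩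
  rw [h1, hk, zpow_natCast, map_pow, map_natCast]
  exact gaussIntegers.pow_mem (natCast_mem gaussIntegers p) k

theorem smul_zpow_mem (n : ℤ) {x : GaussField} (hx : x ∈ gaussIntegersAway p) :
    ((p : ℚ) ^ n) • x ∈ gaussIntegersAway p := by
  rw [Algebra.smul_def]
  exact (gaussIntegersAway p).mul_mem (algebraMap_zpow_mem p n) hx

/-- The group `S_p^2` of `g` with entries in `ℤ[i][1/p]` such that `g* J₂ g = p ^ δ J₂` for some
integer `δ`. -/
def simGroup : Subgroup (GL (Fin 4) GaussField) where
  carrier := {g | (∀ i j, g i j ∈ gaussIntegersAway p) ∧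
    ∃ δ : ℤ, (g : Matrix (Fin 4) (Fin 4) GaussField)ᴴ * matJ * g = ((p : ℚ) ^ δ) • matJ}
  mul_mem' := by
    rintro g h ⟨hg, δ, hδ⟩ ⟨hh, η, hη⟩
    refine ⟨entry_mul hg hh, δ + η, ?_⟩
    rw [zpow_add₀ (cast_p_ne_zero p)]
    exact similitude_mul hδ hη
  one_mem' := by
    refine ⟨fun i j => ?_, 0, by simp⟩
    rw [Units.val_one, Matrix.one_apply]
    split_ifs
    · exact Subring.one_mem _
    · exact Subring.zero_mem _
  inv_mem' := by
    rintro g ⟨hg, δ, hδ⟩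
    have hc : (p : ℚ) ^ δ ≠ 0 := zpow_ne_zero _ (cast_p_ne_zero p)
    refine ⟨fun i j => ?_, -δ, ?_⟩
    · rw [inv_eq_of_similitude hc hδ, Matrix.smul_apply, neg_smul, ← zpow_neg]
      refine Subring.neg_mem _ (smul_zpow_mem p _ ?_)
      exact entry_mul (entry_mul (matJ_entry _) fun a b => star_mem_away (hg b a))
        (matJ_entry _) i j
    · rw [zpow_neg]
      exact similitude_inv hc hδ

/-- The Hermitian modular group `Γ₂ = U₂(ℤ[i])`, as a subgroup of `S_p^2`. -/
def modularGroup : Subgroup (simGroup p) where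
  carrier := {g | (∀ i j, g.1 i j ∈ gaussIntegers) ∧
    (g.1 : Matrix (Fin 4) (Fin 4) GaussField)ᴴ * matJ * g.1 = matJ}
  mul_mem' := by
    rintro g h ⟨hg, hδ⟩ ⟨hh, hη⟩
    refine ⟨entry_mul hg hh, ?_⟩
    have := similitude_mul (c := 1) (d := 1) (by rw [hδ, one_smul]) (by rw [hη, one_smul])
    simpa using this
  one_mem' := by
    refine ⟨fun i j => ?_, by simp⟩
    rw [Subgroup.coe_one, Units.val_one, Matrix.one_apply]
    split_ifs
    · exact Subring.one_mem _
    · exact Subring.zero_mem _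
  inv_mem' := by
    rintro g ⟨hg, hδ⟩
    have hδ' : (g.1 : Matrix (Fin 4) (Fin 4) GaussField)ᴴ * matJ * g.1 = (1 : ℚ) • matJ := by
      rw [hδ, one_smul]
    refine ⟨fun i j => ?_, ?_⟩
    · rw [Subgroup.coe_inv, inv_eq_of_similitude one_ne_zero hδ', Matrix.smul_apply, neg_smul,
        inv_one, one_smul]
      refine Subring.neg_mem _ ?_
      exact entry_mul (entry_mul (matJ_entry _) fun a b => star_mem_gaussIntegers (hg b a))
        (matJ_entry _) i j
    · have := similitude_inv one_ne_zero hδ'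
      simpa using this

/-- The parabolic subgroup `S_p^{1,1}` of `S_p^2`: the last row is `(0, 0, 0, *)`. -/
def parabolicGroup : Subgroup (simGroup p) where
  carrier := {g | g.1 3 0 = 0 ∧ g.1 3 1 = 0 ∧ g.1 3 2 = 0}
  mul_mem' := by
    rintro g h ⟨h0, h1, h2⟩ ⟨k0, k1, k2⟩
    simp [Matrix.mul_apply, Fin.sum_univ_four, *]
  one_mem' := by simp
  inv_mem' := by
    rintro g ⟨h0, h1, h2⟩
    have h : ∀ j, g.1 3 3 * (g⁻¹).1 3 j = (1 : Matrix (Fin 4) (Fin 4) GaussField) 3 j := by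
      intro j
      have h3 : g.1.val * (g⁻¹).1.val = 1 := by
        rw [Subgroup.coe_inv, ← Units.val_mul, mul_inv_cancel, Units.val_one]
      rw [← h3, Matrix.mul_apply, Fin.sum_univ_four, h0, h1, h2]
      ring
    have hu : (g⁻¹).1 3 3 * g.1 3 3 = 1 := by
      rw [mul_comm, h 3, Matrix.one_apply_eq]
    have hz : ∀ j, j ≠ 3 → (g⁻¹).1 3 j = 0 := by
      intro j hj
      calc (g⁻¹).1 3 j = ((g⁻¹).1 3 3 * g.1 3 3) * (g⁻¹).1 3 j := by rw [hu, one_mul]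
        _ = 0 := by rw [mul_assoc, h j, Matrix.one_apply_ne hj.symm, mul_zero]
    exact ⟨hz 0 (by decide), hz 1 (by decide), hz 2 (by decide)⟩

theorem exists_denominator (g : simGroup p) :
    ∃ n : ℕ, ∀ i j, (p : GaussField) ^ n * g.1 i j ∈ gaussIntegers := by
  choose f hf using g.2.1
  refine ⟨∑ i, ∑ j, f i j, fun i j => ?_⟩
  have h1 : f i j ≤ ∑ i, ∑ j, f i j :=
    (Finset.single_le_sum (f := fun j => f i j) (fun _ _ => Nat.zero_le _)
      (Finset.mem_univ j)).trans
      (Finset.single_le_sum (f := fun i => ∑ j, f i j) (fun _ _ => Nat.zero_le _)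
        (Finset.mem_univ i))
  obtain ⟨k, hk⟩ := Nat.exists_eq_add_of_le h1
  rw [hk, pow_add, mul_comm ((p : GaussField) ^ f i j), mul_assoc]
  exact gaussIntegers.mul_mem (gaussIntegers.pow_mem (natCast_mem gaussIntegers p) k) (hf i j)

instance : IsHeckePair (modularGroup p) where
  finite g := by
    classical
    obtain ⟨n, hn⟩ := exists_denominator p g
    obtain ⟨m, hm⟩ := exists_denominator p g⁻¹
    have : NeZero (p ^ (n + m)) := ⟨pow_ne_zero _ (Fact.out : p.Prime).ne_zero⟩
    choose a b hab using fun γ : modularGroup p => γ.2.1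
    let r : modularGroup p → Fin 4 → Fin 4 → ZMod (p ^ (n + m)) × ZMod (p ^ (n + m)) :=
      fun γ i j => ((a γ i j : ZMod (p ^ (n + m))), (b γ i j : ZMod (p ^ (n + m))))
    have key : ∀ γ γ' : modularGroup p, r γ = r γ' →
        coset (modularGroup p) (g * γ) = coset (modularGroup p) (g * γ') := by
      intro γ γ' h
      have hdvd : ∀ i j, ∃ e ∈ gaussIntegers,
          γ'.1.1 i j - γ.1.1 i j = (p : GaussField) ^ (n + m) * e := by
        intro i j
        have h1 := congrFun (congrFun h i) j
        have h2 : (a γ i j : ZMod (p ^ (n + m))) = a γ' i j := congrArg Prod.fst h1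
        have h3 : (b γ i j : ZMod (p ^ (n + m))) = b γ' i j := congrArg Prod.snd h1
        rw [ZMod.intCast_eq_intCast_iff_dvd_sub] at h2 h3
        obtain ⟨u, hu⟩ := h2
        obtain ⟨v, hv⟩ := h3
        refine ⟨⟨u, v⟩, ⟨u, v, rfl⟩, ?_⟩
        rw [hab γ i j, hab γ' i j]
        have e1 : (p : GaussField) ^ (n + m) = ((p ^ (n + m) : ℕ) : GaussField) := by push_cast; rfl
        have hu' : ((a γ' i j : ℤ) : ℚ) - a γ i j = ((p ^ (n + m) : ℕ) : ℚ) * u := by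
          exact_mod_cast hu
        have hv' : ((b γ' i j : ℤ) : ℚ) - b γ i j = ((p ^ (n + m) : ℕ) : ℚ) * v := by
          exact_mod_cast hv
        rw [e1]
        ext
        · simp only [QuadraticAlgebra.re_sub, QuadraticAlgebra.re_mul,
            QuadraticAlgebra.re_natCast, QuadraticAlgebra.im_natCast, hu']
          ring
        · simp only [QuadraticAlgebra.im_sub, QuadraticAlgebra.im_mul,
            QuadraticAlgebra.re_natCast, QuadraticAlgebra.im_natCast, hv']
          ring
      choose e he hee using hdvd
      rw [coset_eq_iff]
      have hx : g * ↑γ' * (g * ↑γ)⁻¹ = g * (γ'.1 * γ.1⁻¹) * g⁻¹ := by group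
      rw [hx]
      have hmat : (g * (γ'.1 * γ.1⁻¹) * g⁻¹).1.val = 1 + ((p : GaussField) ^ n • g.1.val) *
          Matrix.of e * (γ⁻¹).1.1.val * ((p : GaussField) ^ m • (g⁻¹).1.val) := by
        have e1 : γ'.1.1.val = γ.1.1.val + (p : GaussField) ^ (n + m) • Matrix.of e := by
          ext1 i j
          rw [Matrix.add_apply, Matrix.smul_apply, Matrix.of_apply, smul_eq_mul, ← hee i j]
          ring
        have e2 : γ.1.1.val * (γ⁻¹).1.1.val = 1 := by
          change (γ.1.1 * γ.1.1⁻¹).val = 1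
          rw [mul_inv_cancel, Units.val_one]
        have e3 : g.1.val * (g⁻¹).1.val = 1 := by
          change (g.1 * g.1⁻¹).val = 1
          rw [mul_inv_cancel, Units.val_one]
        change g.1.val * (γ'.1.1.val * (γ⁻¹).1.1.val) * (g⁻¹).1.val = _
        rw [e1, Matrix.add_mul, e2, Matrix.mul_add, Matrix.mul_one, Matrix.add_mul, e3, pow_add]
        simp only [Matrix.smul_mul, Matrix.mul_smul, Matrix.mul_assoc, smul_smul, mul_comm]
      refine ⟨fun i j => ?_, ?_⟩
      · rw [hmat, Matrix.add_apply]
        refine Subring.add_mem _ ?_ ?_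
        · rw [Matrix.one_apply]
          split_ifs
          · exact Subring.one_mem _
          · exact Subring.zero_mem _
        · exact entry_mul (entry_mul (entry_mul (fun i j => hn i j) he) (γ⁻¹).2.1)
            (fun i j => hm i j) i j
      · obtain ⟨δ, hδ⟩ := g.2.2
        have hc : (p : ℚ) ^ δ ≠ 0 := zpow_ne_zero _ (cast_p_ne_zero p)
        have i1 := similitude_inv hc hδ
        have i2 := similitude_mul (c := 1) (d := 1)
          (by rw [γ'.2.2, one_smul]) (by rw [(γ⁻¹).2.2, one_smul])
        have i3 := similitude_mul (similitude_mul hδ i2) i1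
        rw [mul_one, mul_one, mul_inv_cancel₀ hc, one_smul] at i3
        exact i3
    refine (Set.finite_range (fun v : Fin 4 → Fin 4 → ZMod (p ^ (n + m)) × ZMod (p ^ (n + m)) =>
      if h : ∃ γ, r γ = v then coset (modularGroup p) (g * (h.choose : modularGroup p))
      else coset (modularGroup p) 1)).subset ?_
    rintro _ ⟨γ, hγ, rfl⟩
    have hex : ∃ δ, r δ = r ⟨γ, hγ⟩ := ⟨_, rfl⟩
    refine ⟨r ⟨γ, hγ⟩, ?_⟩
    simp only [dif_pos hex]
    exact key _ _ hex.choose_spec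

/-- The element of `S_p^2` given by a matrix. -/
def simOfMatrix (M : Matrix (Fin 4) (Fin 4) GaussField)
    (hM : ∀ i j, M i j ∈ gaussIntegersAway p) (δ : ℤ)
    (h : Mᴴ * matJ * M = ((p : ℚ) ^ δ) • matJ) : simGroup p :=
  have hl := similitude_left_inv (zpow_ne_zero δ (cast_p_ne_zero p)) h
  ⟨⟨M, _, mul_eq_one_comm.1 hl, hl⟩, hM, δ, h⟩

theorem star_algebraMap (r : ℚ) :
    star (algebraMap ℚ GaussField r) = algebraMap ℚ GaussField r := by
  rw [← QuadraticAlgebra.C_eq_algebraMap]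
  ext <;> simp

/-- The diagonal matrix `diag(p ^ (d - e₁), p ^ (d - e₂), p ^ e₁, p ^ e₂)`, which is
`(p ^ d (D*)⁻¹, 0; 0, D)` with `D = diag(p ^ e₁, p ^ e₂)`. -/
def torus (d e₁ e₂ : ℤ) : simGroup p :=
  simOfMatrix p
    (Matrix.diagonal fun i =>
      algebraMap ℚ GaussField ((p : ℚ) ^ (![d - e₁, d - e₂, e₁, e₂] i)))
    (fun i j => by
      rw [Matrix.diagonal_apply]
      split_ifs
      · exact algebraMap_zpow_mem p _
      · exact Subring.zero_mem _)
    d (by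
      have h : ∀ a b : ℤ, a + b = d → algebraMap ℚ GaussField ((p : ℚ) ^ a) *
          algebraMap ℚ GaussField ((p : ℚ) ^ b) = algebraMap ℚ GaussField ((p : ℚ) ^ d) := by
        intro a b hab
        rw [← map_mul, ← zpow_add₀ (cast_p_ne_zero p), hab]
      ext i j : 1
      rw [Matrix.diagonal_conjTranspose, Matrix.mul_diagonal, Matrix.diagonal_mul,
        Matrix.smul_apply, Algebra.smul_def, Pi.star_apply, star_algebraMap]
      fin_cases i <;> fin_cases j <;> simp [matJ]
      all_goals first | exact h _ _ (by ring))

/-- The matrix `∇a`: `p` times the identity, with the additional entry `a` in row 2, column 4. -/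
def nablaMatrix (a : ℤ) : simGroup p :=
  simOfMatrix p !![(p : GaussField), 0, 0, 0; 0, p, 0, a; 0, 0, p, 0; 0, 0, 0, p]
    (fun i j => by
      refine gaussIntegers_le_away p ?_
      have h := natCast_mem gaussIntegers p
      fin_cases i <;> fin_cases j <;> simp [h])
    2 (by
      have hp : star (p : GaussField) = p := star_natCast p
      have ha : star (a : GaussField) = a := star_intCast a
      have h2 : ((p : ℚ) ^ 2) • (1 : GaussField) = (p : GaussField) ^ 2 := by
        rw [Algebra.smul_def, mul_one, map_pow, map_natCast]
      ext i j : 1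
      fin_cases i <;> fin_cases j <;>
        simp [matJ, Matrix.mul_apply, Fin.sum_univ_four, hp, ha]
      all_goals first | (rw [h2]; ring) | ring)

/-! ### The Satake map at an inert prime -/

/-- The `p`-part `H_p^2 = H(Γ₂, S_p^2)` of the Hecke ring. -/
abbrev Hecke2 : Type := HeckeAlgebra (modularGroup p)

/-- Laurent polynomials `ℚ[x₀^{±1}, x₁^{±1}, x₂^{±1}]`; `single m a` is
`a x₀ ^ (m 0) x₁ ^ (m 1) x₂ ^ (m 2)`. -/
abbrev LaurentRing : Type := AddMonoidAlgebra ℚ (Fin 3 → ℤ)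

/-- The unipotent elements of `S_p^2` of the form `(A, B; 0, D)` with `D` upper triangular (and
hence `A` lower triangular). -/
def IsUpperUnipotent (n : simGroup p) : Prop :=
  (∀ i, n.1 i i = 1) ∧ n.1 0 1 = 0 ∧ n.1 2 0 = 0 ∧ n.1 2 1 = 0 ∧
    n.1 3 0 = 0 ∧ n.1 3 1 = 0 ∧ n.1 3 2 = 0

/-- The coset `c` is `Γ₂ M N` with `N` unipotent as above and
`M = (p ^ m₀ (D*)⁻¹, 0; 0, D)`, `D = diag(p ^ m₁, p ^ m₂)`. -/
def HasExponents (c : Cosets (modularGroup p)) (m : Fin 3 → ℤ) : Prop :=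
  ∃ n : simGroup p, IsUpperUnipotent p n ∧
    c = coset (modularGroup p) (torus p (m 0) (m 1) (m 2) * n)

open Classical in
/-- The monomial `x₀ ^ m₀ (x₁ q⁻¹) ^ m₁ (x₂ q⁻²) ^ m₂`, with `q = p ^ 2` the order of the residue
field, attached to a coset with exponents `(m₀, m₁, m₂)`. (Each coset has exactly one triple of
exponents.) -/
def satakeCoset (c : Cosets (modularGroup p)) : LaurentRing :=
  if h : ∃ m, HasExponents p c m then
    AddMonoidAlgebra.single h.choose
      ((((p : ℚ) ^ 2) ^ (-1 : ℤ)) ^ (h.choose 1) * (((p : ℚ) ^ 2) ^ (-2 : ℤ)) ^ (h.choose 2))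
  else 0

/-- The Satake (spherical) map `Φ` on `H_p^2`. -/
def satake : Hecke2 p →ₗ[ℚ] LaurentRing :=
  Finsupp.linearCombination ℚ (satakeCoset p) ∘ₗ HeckeAlgebra.toSum

/-- The variable `xᵢ`. -/
def laurentX (i : Fin 3) : LaurentRing := AddMonoidAlgebra.single (Pi.single i 1) 1

/-- The inverse `xᵢ⁻¹` of the variable `xᵢ`. -/
def laurentXInv (i : Fin 3) : LaurentRing := AddMonoidAlgebra.single (Pi.single i (-1)) 1

/-- `z_p^{(2)}(t) = ∏_{i = 1, 2} (1 - p² xᵢ t) (1 - p⁴ xᵢ⁻¹ t)`. -/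
def satakeStandard : LaurentRing[X] :=
  (1 - C (((p : ℚ) ^ 2) • laurentX 1) * X) * (1 - C (((p : ℚ) ^ 4) • laurentXInv 1) * X) *
    ((1 - C (((p : ℚ) ^ 2) • laurentX 2) * X) * (1 - C (((p : ℚ) ^ 4) • laurentXInv 2) * X))

/-- `D` is the local standard polynomial `D_p^{(2)}(X) = Z_p^{(2)}(p⁻³ X)`, where
`Z_p^{(2)} = Φ⁻¹(z_p^{(2)})`. -/
def IsStandardPolynomial (D : (Hecke2 p)[X]) : Prop :=
  mapCoeffs (satake p) D =
    (satakeStandard p).comp (C (algebraMap ℚ LaurentRing ((p : ℚ) ^ (-3 : ℤ))) * X)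

/-! ### The parabolic Hecke ring -/

/-- `Γ_{1,1} = Γ₂ ∩ S_p^{1,1}`, as a subgroup of `S_p^{1,1}`. -/
abbrev parabolicModularGroup : Subgroup (parabolicGroup p) :=
  (modularGroup p).subgroupOf (parabolicGroup p)

/-- The parabolic Hecke ring `H_p^{1,1} = H(Γ_{1,1}, S_p^{1,1})`. -/
abbrev Hecke11 : Type := HeckeAlgebra (parabolicModularGroup p)

/-- The embedding `ε : H_p^2 → H_p^{1,1}`. -/
def parabolicEmbedding : Hecke2 p →ₗ[ℚ] Hecke11 p :=
  heckeEmbedding (modularGroup p) (parabolicGroup p)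

/-- `torus p d e₁ e₂` as an element of `S_p^{1,1}`. -/
def torus11 (d e₁ e₂ : ℤ) : parabolicGroup p :=
  ⟨torus p d e₁ e₂, by
    refine ⟨?_, ?_, ?_⟩ <;> simp [torus, simOfMatrix]⟩

/-- `∇a` as an element of `S_p^{1,1}`. -/
def nablaMatrix11 (a : ℤ) : parabolicGroup p :=
  ⟨nablaMatrix p a, by
    refine ⟨?_, ?_, ?_⟩ <;> simp [nablaMatrix, simOfMatrix]⟩

/-- `T^J(p) = Γ_{1,1} diag(1, p, p², p) Γ_{1,1}`. -/
def TJ : Hecke11 p := doubleCoset (parabolicModularGroup p) (torus11 p 2 2 1)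

/-- `Λ₋(p) = Γ_{1,1} diag(p, p², p, 1) Γ_{1,1}`. -/
def LambdaMinus : Hecke11 p := doubleCoset (parabolicModularGroup p) (torus11 p 2 1 0)

/-- `Λ₊(p) = Γ_{1,1} diag(p, 1, p, p²) Γ_{1,1}`. -/
def LambdaPlus : Hecke11 p := doubleCoset (parabolicModularGroup p) (torus11 p 2 1 2)

/-- `T₋(p) = Γ_{1,1} diag(1, p, p, 1) Γ_{1,1}`. -/
def TMinus : Hecke11 p := doubleCoset (parabolicModularGroup p) (torus11 p 1 1 0)

/-- `T₊(p) = Γ_{1,1} diag(1, 1, p, p) Γ_{1,1}`. -/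
def TPlus : Hecke11 p := doubleCoset (parabolicModularGroup p) (torus11 p 1 1 1)

/-- `∇_p = ∑_{a mod p} Γ_{1,1} ∇a`. (Since `∇a` commutes with `Γ_{1,1}`, the double coset of `∇a`
is the single coset `Γ_{1,1} ∇a`.) -/
def Nabla : Hecke11 p :=
  ∑ a ∈ Finset.range p, doubleCoset (parabolicModularGroup p) (nablaMatrix11 p a)

theorem torus11_central (k : ℤ) (g : parabolicGroup p) :
    torus11 p (2 * k) k k * g = g * torus11 p (2 * k) k k := by
  have h : (torus p (2 * k) k k).1.val =
      (algebraMap ℚ GaussField ((p : ℚ) ^ k)) • (1 : Matrix (Fin 4) (Fin 4) GaussField) := by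
    ext i j : 1
    fin_cases i <;> fin_cases j <;> simp [torus, simOfMatrix, two_mul]
  refine Subtype.ext (Subtype.ext (Units.ext ?_))
  change (torus p (2 * k) k k).1.val * g.1.1.val = g.1.1.val * (torus p (2 * k) k k).1.val
  rw [h, Matrix.smul_mul, Matrix.mul_smul, Matrix.one_mul, Matrix.mul_one]

theorem torus11_mul_inv (k : ℤ) :
    torus11 p (2 * k) k k * torus11 p (2 * (-k)) (-k) (-k) = 1 := by
  have h : ∀ k : ℤ, (torus p (2 * k) k k).1.val =
      (algebraMap ℚ GaussField ((p : ℚ) ^ k)) • (1 : Matrix (Fin 4) (Fin 4) GaussField) := by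
    intro k
    ext i j : 1
    fin_cases i <;> fin_cases j <;> simp [torus, simOfMatrix, two_mul]
  refine Subtype.ext (Subtype.ext (Units.ext ?_))
  change (torus p (2 * k) k k).1.val * (torus p (2 * (-k)) (-k) (-k)).1.val = 1
  rw [h, h, Matrix.smul_mul, Matrix.mul_smul, Matrix.one_mul, smul_smul, ← map_mul,
    ← zpow_add₀ (cast_p_ne_zero p), add_neg_cancel, zpow_zero, map_one, one_smul]

/-- `Δ_p = Γ_{1,1} diag(p, p, p, p) Γ_{1,1}`, with its inverse in `H_p^{1,1}`. -/
def Delta : (Hecke11 p)ˣ where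
  val := doubleCoset (parabolicModularGroup p) (torus11 p (2 * 1) 1 1)
  inv := doubleCoset (parabolicModularGroup p) (torus11 p (2 * (-1)) (-1) (-1))
  val_inv := doubleCoset_central_mul _ (torus11_central p 1) (torus11_central p (-1))
    (torus11_mul_inv p 1)
  inv_val := doubleCoset_central_mul _ (torus11_central p (-1)) (torus11_central p 1)
    (by simpa using torus11_mul_inv p (-1))

/-- For an operator `Y`, the reduced operator `Y^r = Δ_p⁻¹ Y`. -/
def reduced (Y : Hecke11 p) : Hecke11 p := ((Delta p)⁻¹ : (Hecke11 p)ˣ) * Y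

/-- `S₁ = p⁻³ (T^{J,r} + ∇^r - p (p² - p + 1))`. -/
def S₁ : Hecke11 p :=
  ((p : ℚ) ^ (-3 : ℤ)) •
    (reduced p (TJ p) + reduced p (Nabla p) - ((p : ℚ) * ((p : ℚ) ^ 2 - p + 1)) • 1)

/-- `S₂ = p⁻⁴ Δ⁻¹ T₊ T₋ - p⁻³ T^{J,r} - 2 p⁻³ ∇^r - p⁻² (p - 2)`. -/
def S₂ : Hecke11 p :=
  ((p : ℚ) ^ (-4 : ℤ)) • (((Delta p)⁻¹ : (Hecke11 p)ˣ) * TPlus p * TMinus p) -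
    ((p : ℚ) ^ (-3 : ℤ)) • reduced p (TJ p) - (2 * (p : ℚ) ^ (-3 : ℤ)) • reduced p (Nabla p) -
    ((p : ℚ) ^ (-2 : ℤ) * ((p : ℚ) - 2)) • 1

/-- `S₃ = p⁻³ (∇^r - p)`. -/
def S₃ : Hecke11 p := ((p : ℚ) ^ (-3 : ℤ)) • (reduced p (Nabla p) - (p : ℚ) • 1)

/-- The cubic `S^{(2)}(X) = 1 - S₁ X + S₂ X² - S₃ X³`. -/
def middleFactor : (Hecke11 p)[X] := 1 - C (S₁ p) * X + C (S₂ p) * X ^ 2 - C (S₃ p) * X ^ 3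

end Prime

end

/-! Write a = p⁻³Δ⁻¹Λ₋, b = p⁻³Δ⁻¹Λ₊, τ = T^{J,r}, ν = ∇^r and z = Δ⁻¹. The factorization is a
formal consequence of a few relations in the noncommutative ring H_p^{1,1}: ab = 1, aν = pa, νb =
pb, aT₊ = T₋, T₋b = T₊, aτb = τ, zT₋² = p·aτ + (p+1)p³·a and its mirror image zT₊² = p·τb +
(p+1)p³·b. They give aS₂ = a, S₂b = b, aS₃ = S₃b = 0 and S₃ + aS₁b = S₁. Hence the X⁵ term of the
product vanishes and the product is the palindromic quartic 1 - cX + dX² - cX³ + X⁴ with c = a + S₁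
+ b and d = p⁻⁴z(T₊+T₋)² - 2c - 2 (`factorization_of_relations`).

On the Satake side put rᵢ = p⁻¹xᵢ + p·xᵢ⁻¹. Then z_p(p⁻³X) is the product of the 1 - rᵢX + X², again
palindromic, with coefficients r₁+r₂ and r₁r₂+2. Let T be the Γ₂-double coset of diag(1,1,p,p).
Counting cosets gives Φ(Δ⁻¹T²) = p⁴(r₁+2)(r₂+2), and the double coset of diag(p⁻¹,1,p,1) plus one
has image p³(r₁+r₂) + p(p²-p+1). Solving for the coefficients yields an explicit preimage
`standardPolynomial`; it is the only one by `satake_injective`. The map ε is multiplicative because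
of the Iwasawa decomposition (`heckeEmbedding_mul`), it sends T to T₊ + T₋, and it sends the second
element to Δ⁻¹Λ₋ + Δ⁻¹Λ₊ + τ + ν. So the image of the explicit polynomial has exactly the
coefficients c and d.

The counts and relations rest on lists of cosets. Each coset has a unique representative consisting
of a unipotent matrix with parameters in [0,1) times a power-of-p torus element (`exists_reduced`,
`reduced_unique`). The cosets in T are those with integral entries and multiplier p; those in the
double coset of diag(p⁻¹,1,p,1), together with Γ₂, are singled out by p·g being integral of rank at
most one modulo p. Inertness of p enters here: p divides a²+b² only if it divides a and b. Products
are evaluated through degrees: an element supported on one double coset is determined by its degree,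
and the degree is multiplicative. The relation for T₊² follows from the one for T₋² by the
anti-involution g ↦ g⁻¹. -/

noncomputable section

/-! ### Abstract Hecke rings: convolution, degree, anti-involution, restriction to a subgroup -/

section HeckeRings

variable {G : Type*} [Group G] {Γ : Subgroup G}

theorem coset_mul_left {γ : G} (hγ : γ ∈ Γ) (g : G) : coset Γ (γ * g) = coset Γ g :=
  coset_eq_iff.2 (by simpa using Γ.inv_mem hγ)

theorem exists_coset_eq (c : Cosets Γ) : ∃ g, coset Γ g = c := ⟨c.out, Quotient.out_eq c⟩

theorem exists_out_coset (g : G) : ∃ γ ∈ Γ, (coset Γ g).out = γ * g := by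
  have h : coset Γ (coset Γ g).out = coset Γ g := Quotient.out_eq _
  exact ⟨_, coset_eq_iff.1 h.symm, by simp⟩

theorem mem_cosetsIn_iff {g h : G} :
    coset Γ g ∈ cosetsIn Γ h ↔ ∃ γ ∈ Γ, ∃ δ ∈ Γ, g = γ * h * δ := by
  constructor
  · rintro ⟨δ, hδ, e⟩
    refine ⟨g * (h * δ)⁻¹, coset_eq_iff.1 e, δ, hδ, by group⟩
  · rintro ⟨γ, hγ, δ, hδ, rfl⟩
    exact ⟨δ, hδ, by rw [mul_assoc γ, coset_mul_left hγ]⟩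

theorem cosetsIn_eq_of_mem {g h : G} (hg : coset Γ g ∈ cosetsIn Γ h) :
    cosetsIn Γ g = cosetsIn Γ h := by
  obtain ⟨γ, hγ, δ, hδ, rfl⟩ := mem_cosetsIn_iff.1 hg
  ext c
  obtain ⟨x, rfl⟩ := exists_coset_eq c
  rw [mem_cosetsIn_iff, mem_cosetsIn_iff]
  constructor
  · rintro ⟨a, ha, b, hb, rfl⟩
    exact ⟨a * γ, mul_mem ha hγ, δ * b, mul_mem hδ hb, by group⟩
  · rintro ⟨a, ha, b, hb, rfl⟩
    exact ⟨a * γ⁻¹, mul_mem ha (inv_mem hγ), δ⁻¹ * b, mul_mem (inv_mem hδ) hb, by group⟩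

theorem coset_mem_cosetsIn_self (h : G) : coset Γ h ∈ cosetsIn Γ h :=
  ⟨1, Γ.one_mem, by rw [mul_one]⟩

theorem translate_injective (g : G) : Function.Injective (Cosets.translate (Γ := Γ) g) := by
  intro a b hab
  have h := congrArg (Cosets.translate g⁻¹) hab
  simpa [Cosets.translate_translate, translate_one] using h

theorem rightMul_apply (h g : G) (x : Cosets Γ →₀ ℚ) :
    rightMul h x (coset Γ g) = x (coset Γ (g * h⁻¹)) := by
  have e : coset Γ g = Cosets.translate h (coset Γ (g * h⁻¹)) := by
    rw [Cosets.translate_coset]; simp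
  rw [e]
  exact Finsupp.mapDomain_apply (translate_injective h) _ _

namespace HeckeAlgebra

/-- The value at `g` of an element of the Hecke ring, viewed as a bi-invariant function. -/
def coeff (v : HeckeAlgebra Γ) (g : G) : ℚ := toSum v (coset Γ g)

theorem ext_coeff {v w : HeckeAlgebra Γ} (h : ∀ g, coeff v g = coeff w g) : v = w := by
  refine toSum_injective (Finsupp.ext fun c => ?_)
  obtain ⟨g, rfl⟩ := exists_coset_eq c
  exact h g

@[simp] theorem coeff_add (v w : HeckeAlgebra Γ) (g : G) :
    coeff (v + w) g = coeff v g + coeff w g := by simp [coeff]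

@[simp] theorem coeff_smul (a : ℚ) (v : HeckeAlgebra Γ) (g : G) :
    coeff (a • v) g = a * coeff v g := by simp [coeff]

theorem coeff_mul_left (v : HeckeAlgebra Γ) {γ : G} (hγ : γ ∈ Γ) (g : G) :
    coeff v (γ * g) = coeff v g := by rw [coeff, coset_mul_left hγ, coeff]

theorem coeff_mul_right (v : HeckeAlgebra Γ) {γ : G} (hγ : γ ∈ Γ) (g : G) :
    coeff v (g * γ) = coeff v g := by
  have h := rightMul_toSum v (Γ.inv_mem hγ)
  rw [coeff, coeff]
  conv_rhs => rw [← h]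
  rw [rightMul_apply, inv_inv]

theorem coeff_out (v : HeckeAlgebra Γ) (g h : G) :
    coeff v (g * (coset Γ h).out⁻¹) = coeff v (g * h⁻¹) := by
  obtain ⟨γ, hγ, e⟩ := exists_out_coset (Γ := Γ) h
  rw [e, mul_inv_rev, ← mul_assoc, coeff_mul_right v (Γ.inv_mem hγ)]

/-- Seen as bi-invariant functions, elements of the Hecke ring multiply by convolution over Γ\G.
Stating it with `finsum` over all cosets permits changes of variables along bijections of coset
spaces without following supports. -/
theorem coeff_mul (v w : HeckeAlgebra Γ) (g : G) :
    coeff (v * w) g = ∑ᶠ c : Cosets Γ, coeff v (g * c.out⁻¹) * toSum w c := by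
  rw [coeff, toSum_mul, mulLeft, Finsupp.linearCombination_apply, Finsupp.sum,
    Finsupp.finsetSum_apply, finsum_eq_sum_of_support_subset (s := (toSum w).support)]
  · refine Finset.sum_congr rfl fun c _ => ?_
    obtain ⟨h, rfl⟩ := exists_coset_eq c
    rw [Finsupp.smul_apply, smul_eq_mul, mul_comm, coeff_out]
    congr 1
    exact rightMul_apply h g (toSum v)
  · intro c hc
    rw [Finset.mem_coe, Finsupp.mem_support_iff]
    intro h
    exact hc (by simp [h])

theorem coeff_mul_ne_zero {v w : HeckeAlgebra Γ} {g : G} (h : coeff (v * w) g ≠ 0) :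
    ∃ x, coeff v (g * x⁻¹) ≠ 0 ∧ coeff w x ≠ 0 := by
  rw [coeff_mul] at h
  obtain ⟨c, hc⟩ : ∃ c : Cosets Γ, coeff v (g * c.out⁻¹) * toSum w c ≠ 0 := by
    by_contra! h0
    exact h (finsum_eq_zero_of_forall_eq_zero h0)
  refine ⟨c.out, left_ne_zero_of_mul hc, ?_⟩
  have := right_ne_zero_of_mul hc
  rwa [coeff, show coset Γ c.out = c from Quotient.out_eq c]

/-- The sum of the coefficients of a formal sum of cosets. -/
def sumCoeffs : (Cosets Γ →₀ ℚ) →ₗ[ℚ] ℚ := Finsupp.linearCombination ℚ fun _ => 1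

theorem sumCoeffs_single (c : Cosets Γ) (a : ℚ) : sumCoeffs (Finsupp.single c a) = a := by
  simp [sumCoeffs]

theorem sumCoeffs_rightMul (g : G) (x : Cosets Γ →₀ ℚ) :
    sumCoeffs (rightMul g x) = sumCoeffs x := by
  have h : (sumCoeffs (Γ := Γ)).comp (rightMul g) = sumCoeffs := by
    refine Finsupp.lhom_ext' fun c => LinearMap.ext_ring ?_
    obtain ⟨a, rfl⟩ := exists_coset_eq c
    simp [rightMul_single, sumCoeffs_single]
  exact LinearMap.congr_fun h x

/-- Right translation permutes cosets and keeps the coefficient sum. This is what makes the degree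
multiplicative, so that structure constants can be found by counting cosets. -/
theorem sumCoeffs_mulLeft (v : HeckeAlgebra Γ) (x : Cosets Γ →₀ ℚ) :
    sumCoeffs (mulLeft v x) = sumCoeffs (toSum v) * sumCoeffs x := by
  have h : (sumCoeffs (Γ := Γ)).comp (mulLeft v) = sumCoeffs (toSum v) • sumCoeffs := by
    refine Finsupp.lhom_ext' fun c => LinearMap.ext_ring ?_
    obtain ⟨a, rfl⟩ := exists_coset_eq c
    simp [mulLeft_single, sumCoeffs_rightMul, sumCoeffs_single]
  exact LinearMap.congr_fun h x

/-- The degree: the sum of the coefficients. -/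
def deg : HeckeAlgebra Γ →ₗ[ℚ] ℚ := sumCoeffs ∘ₗ toSum

theorem deg_mul (v w : HeckeAlgebra Γ) : deg (v * w) = deg v * deg w := sumCoeffs_mulLeft v _

theorem deg_one : deg (1 : HeckeAlgebra Γ) = 1 := sumCoeffs_single _ _

theorem cosetsIn_of_normal {g : G} (hg : ∀ γ ∈ Γ, g * γ * g⁻¹ ∈ Γ) :
    cosetsIn Γ g = {coset Γ g} := by
  ext c
  constructor
  · rintro ⟨γ, hγ, rfl⟩
    have : g * γ = g * γ * g⁻¹ * g := by group
    rw [this, coset_mul_left (hg γ hγ)]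
    rfl
  · rintro rfl
    exact coset_mem_cosetsIn_self g

section DoubleCosets

variable [IsHeckePair Γ]

open Classical in
theorem toSum_doubleCoset (h : G) (c : Cosets Γ) :
    toSum (doubleCoset Γ h) c = if c ∈ cosetsIn Γ h then 1 else 0 := by
  change (∑ c ∈ (IsHeckePair.finite (Γ := Γ) h).toFinset, Finsupp.single c (1 : ℚ)) c = _
  rw [Finsupp.finsetSum_apply]
  simp [Finsupp.single_apply]

open Classical in
theorem coeff_doubleCoset (h g : G) :
    coeff (doubleCoset Γ h) g = if coset Γ g ∈ cosetsIn Γ h then 1 else 0 :=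
  toSum_doubleCoset h _

theorem doubleCoset_congr {g h : G} (hg : coset Γ g ∈ cosetsIn Γ h) :
    doubleCoset Γ g = doubleCoset Γ h :=
  ext_coeff fun x => by rw [coeff_doubleCoset, coeff_doubleCoset, cosetsIn_eq_of_mem hg]

theorem deg_doubleCoset (h : G) : deg (doubleCoset Γ h) = Nat.card (cosetsIn Γ h) := by
  change sumCoeffs (∑ c ∈ (IsHeckePair.finite (Γ := Γ) h).toFinset, Finsupp.single c (1 : ℚ)) = _
  rw [map_sum]
  simp only [sumCoeffs_single, Finset.sum_const, nsmul_eq_mul, mul_one]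
  rw [Nat.card_coe_set_eq, Set.ncard_eq_toFinset_card _ (IsHeckePair.finite (Γ := Γ) h)]

theorem deg_doubleCoset_ne_zero (h : G) : deg (doubleCoset Γ h) ≠ 0 := by
  rw [deg_doubleCoset, Nat.cast_ne_zero]
  have := (IsHeckePair.finite (Γ := Γ) h).to_subtype
  have : Nonempty (cosetsIn Γ h) := ⟨⟨_, coset_mem_cosetsIn_self h⟩⟩
  exact Nat.card_ne_zero.2 ⟨inferInstance, inferInstance⟩

theorem doubleCoset_one : doubleCoset Γ (1 : G) = 1 :=
  toSum_injective (by rw [doubleCoset_central Γ (by simp), toSum_one])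

/-- An element supported on a double coset is a multiple of it, determined by the degree. -/
theorem eq_smul_doubleCoset {v : HeckeAlgebra Γ} {h : G}
    (hv : ∀ g, coeff v g ≠ 0 → coset Γ g ∈ cosetsIn Γ h) :
    v = (deg v / deg (doubleCoset Γ h)) • doubleCoset Γ h := by
  have key : v = coeff v h • doubleCoset Γ h := by
    refine ext_coeff fun g => ?_
    rw [coeff_smul, coeff_doubleCoset]
    split_ifs with hg
    · obtain ⟨γ, hγ, δ, hδ, rfl⟩ := mem_cosetsIn_iff.1 hg
      rw [coeff_mul_right _ hδ, coeff_mul_left _ hγ, mul_one]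
    · rw [mul_zero]
      by_contra h0
      exact hg (hv g h0)
  have hd : deg v / deg (doubleCoset Γ h) = coeff v h := by
    rw [div_eq_iff (deg_doubleCoset_ne_zero h)]
    conv_lhs => rw [key]
    rw [map_smul, smul_eq_mul]
  rw [hd]
  exact key

theorem coeff_doubleCoset_ne_zero {h g : G} (hg : coeff (doubleCoset Γ h) g ≠ 0) :
    ∃ γ ∈ Γ, ∃ δ ∈ Γ, g = γ * h * δ := by
  rw [coeff_doubleCoset] at hg
  by_contra h0
  exact hg (if_neg fun h1 => h0 (mem_cosetsIn_iff.1 h1))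

/-- If gΓh stays inside one double coset, the product is supported there, and comparing degrees
gives the scalar without any count of intersections. -/
theorem doubleCoset_mul {g h k : G} (H : ∀ γ ∈ Γ, coset Γ (g * γ * h) ∈ cosetsIn Γ k) :
    doubleCoset Γ g * doubleCoset Γ h =
      (deg (doubleCoset Γ g) * deg (doubleCoset Γ h) / deg (doubleCoset Γ k)) •
        doubleCoset Γ k := by
  rw [← deg_mul]
  refine eq_smul_doubleCoset fun x hx => ?_
  obtain ⟨y, h1, h2⟩ := coeff_mul_ne_zero hx
  obtain ⟨γ, hγ, δ, hδ, e1⟩ := coeff_doubleCoset_ne_zero h1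
  obtain ⟨γ', hγ', δ', hδ', rfl⟩ := coeff_doubleCoset_ne_zero h2
  obtain ⟨a, ha, b, hb, e⟩ := mem_cosetsIn_iff.1 (H (δ * γ') (mul_mem hδ hγ'))
  refine mem_cosetsIn_iff.2 ⟨γ * a, mul_mem hγ ha, b * δ', mul_mem hb hδ', ?_⟩
  have : x = γ * (g * (δ * γ') * h) * δ' := by
    have := congrArg (· * (γ' * h * δ')) e1
    simp only [inv_mul_cancel_right] at this
    rw [this]; group
  rw [this, e]; group

theorem doubleCoset_mul_of_normal_left {g : G} (hg : ∀ γ ∈ Γ, g * γ * g⁻¹ ∈ Γ) (h : G) :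
    doubleCoset Γ g * doubleCoset Γ h =
      (deg (doubleCoset Γ g) * deg (doubleCoset Γ h) / deg (doubleCoset Γ (g * h))) •
        doubleCoset Γ (g * h) :=
  doubleCoset_mul fun γ hγ => by
    have : g * γ * h = g * γ * g⁻¹ * (g * h) * 1 := by group
    exact mem_cosetsIn_iff.2 ⟨_, hg γ hγ, 1, Γ.one_mem, this⟩

theorem doubleCoset_mul_of_normal_right {h : G} (hh : ∀ γ ∈ Γ, h⁻¹ * γ * h ∈ Γ) (g : G) :
    doubleCoset Γ g * doubleCoset Γ h =
      (deg (doubleCoset Γ g) * deg (doubleCoset Γ h) / deg (doubleCoset Γ (g * h))) •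
        doubleCoset Γ (g * h) :=
  doubleCoset_mul fun γ hγ => by
    have : g * γ * h = 1 * (g * h) * (h⁻¹ * γ * h) := by group
    exact mem_cosetsIn_iff.2 ⟨1, Γ.one_mem, _, hh γ hγ, this⟩

theorem deg_doubleCoset_of_normal {g : G} (hg : ∀ γ ∈ Γ, g * γ * g⁻¹ ∈ Γ) :
    deg (doubleCoset Γ g) = 1 := by
  rw [deg_doubleCoset, cosetsIn_of_normal hg]
  simp

/-- The anti-involution of the Hecke ring induced by `g ↦ g⁻¹`. -/
def adj (v : HeckeAlgebra Γ) : HeckeAlgebra Γ :=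
  ⟨Finsupp.ofSupportFinite (fun c => coeff v c.out⁻¹) (by
    -- Finite support: if Γg⁻¹ lies in the support of v, then Γg lies in the double coset of the
    -- inverse of a representative of Γg⁻¹, and each such double coset is a finite union of cosets.
    refine ((toSum v).support.finite_toSet.biUnion
      fun d _ => IsHeckePair.finite (Γ := Γ) d.out⁻¹).subset ?_
    intro c hc
    rw [Set.mem_iUnion₂]
    refine ⟨coset Γ c.out⁻¹, Finsupp.mem_support_iff.2 hc, ?_⟩
    obtain ⟨γ, hγ, e⟩ := exists_out_coset (Γ := Γ) c.out⁻¹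
    rw [e]
    exact ⟨γ, hγ, by
      rw [mul_inv_rev, inv_inv, inv_mul_cancel_right]
      exact Quotient.out_eq c⟩), fun γ hγ => by
    ext c
    obtain ⟨g, rfl⟩ := exists_coset_eq c
    rw [rightMul_apply, Finsupp.ofSupportFinite_coe]
    have e (h : G) := coeff_out v 1 h
    simp only [one_mul] at e
    rw [e, e, mul_inv_rev, inv_inv, coeff_mul_left v hγ]⟩

theorem coeff_adj (v : HeckeAlgebra Γ) (g : G) : coeff (adj v) g = coeff v g⁻¹ := by
  have e := coeff_out v 1 g
  rw [one_mul, one_mul] at e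
  exact e

/-- The substitution x ↦ xg, a bijection of Γ\G, turns one convolution sum into the other with the
factors reversed. -/
theorem adj_mul (v w : HeckeAlgebra Γ) : adj (v * w) = adj w * adj v := by
  refine ext_coeff fun g => ?_
  rw [coeff_adj, coeff_mul, coeff_mul]
  have hb : Function.Bijective (Cosets.translate (Γ := Γ) g) :=
    ⟨translate_injective g, fun c => ⟨Cosets.translate g⁻¹ c, by
      rw [Cosets.translate_translate, inv_mul_cancel, translate_one]⟩⟩
  refine finsum_eq_of_bijective _ hb fun c => ?_
  obtain ⟨h, rfl⟩ := exists_coset_eq c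
  rw [coeff_out, Cosets.translate_coset, coeff_out, coeff_adj]
  change _ * coeff w h = _ * coeff (adj v) _
  rw [coeff_adj, mul_comm]
  simp

theorem adj_add (v w : HeckeAlgebra Γ) : adj (v + w) = adj v + adj w :=
  ext_coeff fun g => by simp [coeff_adj]

theorem adj_smul (a : ℚ) (v : HeckeAlgebra Γ) : adj (a • v) = a • adj v :=
  ext_coeff fun g => by simp [coeff_adj]

open Classical in
theorem adj_doubleCoset (h : G) : adj (doubleCoset Γ h) = doubleCoset Γ h⁻¹ := by
  refine ext_coeff fun g => ?_
  rw [coeff_adj, coeff_doubleCoset, coeff_doubleCoset]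
  refine if_congr ?_ rfl rfl
  rw [mem_cosetsIn_iff, mem_cosetsIn_iff]
  constructor
  · rintro ⟨γ, hγ, δ, hδ, e⟩
    exact ⟨δ⁻¹, inv_mem hδ, γ⁻¹, inv_mem hγ, by rw [← inv_inj, e]; group⟩
  · rintro ⟨γ, hγ, δ, hδ, e⟩
    exact ⟨δ⁻¹, inv_mem hδ, γ⁻¹, inv_mem hγ, by rw [← inv_inj, e]; group⟩

theorem doubleCoset_central_mul_doubleCoset {z : G} (hz : ∀ g, z * g = g * z) (g : G) :
    doubleCoset Γ z * doubleCoset Γ g = doubleCoset Γ (z * g) := by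
  refine ext_coeff fun x => ?_
  have hn : ∀ γ ∈ Γ, z * γ * z⁻¹ ∈ Γ := fun γ hγ => by rw [hz]; simpa using hγ
  rw [doubleCoset_mul_of_normal_left hn, deg_doubleCoset_of_normal hn, one_mul]
  have : deg (doubleCoset Γ g) = deg (doubleCoset Γ (z * g)) := by
    rw [deg_doubleCoset, deg_doubleCoset]
    congr 1
    refine Nat.card_eq_of_bijective (fun c => ⟨Cosets.translate z c.1, ?_⟩) ⟨?_, ?_⟩
    · obtain ⟨_, γ, hγ, rfl⟩ := c
      exact ⟨γ, hγ, by rw [Cosets.translate_coset, mul_assoc, hz]⟩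
    · intro a b hab
      exact Subtype.ext (translate_injective z (congrArg Subtype.val hab))
    · rintro ⟨_, γ, hγ, rfl⟩
      exact ⟨⟨_, γ, hγ, rfl⟩, Subtype.ext (by
        change coset Γ (g * γ * z) = coset Γ (z * g * γ)
        rw [mul_assoc z, hz])⟩
  rw [this, div_self (deg_doubleCoset_ne_zero _), one_smul]

theorem doubleCoset_central_comm {z : G} (hz : ∀ g, z * g = g * z) (v : HeckeAlgebra Γ) :
    doubleCoset Γ z * v = v * doubleCoset Γ z := by
  apply toSum_injective
  rw [toSum_mul, toSum_mul, doubleCoset_central Γ hz, mulLeft_single, one_smul]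
  have h : mulLeft (doubleCoset Γ z) = rightMul z := hom_ext fun a => by
    rw [mulLeft_single, one_smul, doubleCoset_central Γ hz, rightMul_single, rightMul_single, hz]
  rw [h]

end DoubleCosets

section Embedding

variable {S₀ : Subgroup G}

theorem coeff_heckeEmbedding (v : HeckeAlgebra Γ) (g : S₀) :
    coeff (heckeEmbedding Γ S₀ v) g = coeff v (g : G) := rfl

theorem heckeEmbedding_one : heckeEmbedding Γ S₀ 1 = 1 := by
  refine ext_coeff fun g => ?_
  rw [coeff_heckeEmbedding]
  classical
  change (Finsupp.single (coset Γ 1) (1 : ℚ)) _ = (Finsupp.single (coset _ 1) (1 : ℚ)) _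
  rw [Finsupp.single_apply, Finsupp.single_apply]
  refine if_congr ?_ rfl rfl
  rw [coset_eq_iff, coset_eq_iff]
  simp [Subgroup.mem_subgroupOf]

/-- Under `hS` the map Γ₀\S₀ → Γ\G is a bijection, so both convolutions are sums over the same set
with the same terms. -/
theorem heckeEmbedding_mul (hS : ∀ g : G, ∃ γ ∈ Γ, γ * g ∈ S₀) (v w : HeckeAlgebra Γ) :
    heckeEmbedding Γ S₀ (v * w) = heckeEmbedding Γ S₀ v * heckeEmbedding Γ S₀ w := by
  refine ext_coeff fun g => ?_
  rw [coeff_heckeEmbedding, coeff_mul, coeff_mul]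
  have hb : Function.Bijective (cosetInclusion Γ S₀) :=
    ⟨cosetInclusion_injective Γ S₀, fun c => by
      obtain ⟨x, rfl⟩ := exists_coset_eq c
      obtain ⟨γ, hγ, h⟩ := hS x
      exact ⟨coset _ ⟨γ * x, h⟩, coset_mul_left hγ x⟩⟩
  refine (finsum_eq_of_bijective _ hb fun c => ?_).symm
  obtain ⟨h, rfl⟩ := exists_coset_eq c
  rw [coeff_out, cosetInclusion_coset, coeff_out, coeff_heckeEmbedding]
  rfl

end Embedding

end HeckeAlgebra

end HeckeRings

/-! ### The factorization as a formal identity in a noncommutative ring -/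

section RingIdentity

variable {A : Type*} [Ring A]

theorem linear_mul_cubic_mul_linear (a s₁ s₂ s₃ b : A) :
    (1 - C a * X) * (1 - C s₁ * X + C s₂ * X ^ 2 - C s₃ * X ^ 3) * (1 - C b * X) =
      1 - C (a + s₁ + b) * X + C (s₂ + a * s₁ + s₁ * b + a * b) * X ^ 2 -
        C (s₃ + a * s₂ + s₂ * b + a * s₁ * b) * X ^ 3 +
        C (a * s₃ + s₃ * b + a * s₂ * b) * X ^ 4 - C (a * s₃ * b) * X ^ 5 := by
  simp only [C_mul_X_pow_eq_monomial, C_mul_X_eq_monomial, mul_add, mul_sub, add_mul, sub_mul,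
    monomial_mul_monomial, one_mul, mul_one, map_add]
  abel

variable [Algebra ℚ A]

/-- The relations between the operators `a`, `b`, `τ`, `ν`, `t₊`, `t₋` that imply the factorization
of the standard polynomial. -/
theorem factorization_of_relations {q : ℚ} (hq : q ≠ 0) {a b τ ν z tp tm s₁ s₂ s₃ : A}
    (hz : ∀ x, z * x = x * z) (hab : a * b = 1) (haν : a * ν = q • a) (hνb : ν * b = q • b)
    (hatp : a * tp = tm) (htmb : tm * b = tp)
    (htm : z * tm * tm = q • (a * τ) + ((q + 1) * q ^ 3) • a)
    (htp : z * tp * tp = q • (τ * b) + ((q + 1) * q ^ 3) • b)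
    (hτ : a * τ * b = τ)
    (h₁ : s₁ = (q ^ (-3 : ℤ)) • (τ + ν - (q * (q ^ 2 - q + 1)) • 1))
    (h₂ : s₂ = (q ^ (-4 : ℤ)) • (z * tp * tm) - (q ^ (-3 : ℤ)) • τ - (2 * q ^ (-3 : ℤ)) • ν -
      (q ^ (-2 : ℤ) * (q - 2)) • 1)
    (h₃ : s₃ = (q ^ (-3 : ℤ)) • (ν - q • 1)) :
    (1 - C a * X) * (1 - C s₁ * X + C s₂ * X ^ 2 - C s₃ * X ^ 3) * (1 - C b * X) =
      1 - C (a + s₁ + b) * X +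
        C ((q ^ (-4 : ℤ)) • (z * ((tp + tm) * (tp + tm))) - (2 : ℚ) • (a + s₁ + b) -
          (2 : ℚ) • 1) * X ^ 2 -
        C (a + s₁ + b) * X ^ 3 + X ^ 4 := by
  have e3 : q ^ (-3 : ℤ) = (q ^ 3)⁻¹ := by rw [zpow_neg]; rfl
  have e4 : q ^ (-4 : ℤ) = (q ^ 4)⁻¹ := by rw [zpow_neg]; rfl
  have e2 : q ^ (-2 : ℤ) = (q ^ 2)⁻¹ := by rw [zpow_neg]; rfl
  rw [e3] at h₁ h₂ h₃
  rw [e2, e4] at h₂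
  rw [e4]
  -- Multiplying by a turns z·t₊·t₋ into z·t₋², and the constants in s₂ are such that the aτ terms
  -- cancel and exactly a remains.
  have has : a * s₂ = a := by
    have : a * (z * tp * tm) = z * tm * tm := by
      rw [← mul_assoc, ← mul_assoc, ← hz a, mul_assoc z a tp, hatp]
    rw [h₂]
    simp only [mul_sub, mul_smul_comm, this, htm, haν, mul_one]
    match_scalars <;> field_simp <;> ring
  have hsb : s₂ * b = b := by
    have : z * tp * tm * b = z * tp * tp := by rw [mul_assoc, htmb]
    rw [h₂]
    simp only [sub_mul, smul_mul_assoc, this, htp, hνb, one_mul]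
    match_scalars <;> field_simp <;> ring
  have ha₃ : a * s₃ = 0 := by
    rw [h₃, mul_smul_comm, mul_sub, haν, mul_smul_comm, mul_one, sub_self, smul_zero]
  have hb₃ : s₃ * b = 0 := by
    rw [h₃, smul_mul_assoc, sub_mul, hνb, smul_mul_assoc, one_mul, sub_self, smul_zero]
  have hνν : a * ν * b = q • 1 := by rw [haν, smul_mul_assoc, hab]
  have h₁₃ : s₃ + a * s₁ * b = s₁ := by
    rw [h₁, h₃]
    simp only [mul_sub, mul_add, mul_smul_comm, mul_one, sub_mul, add_mul, smul_mul_assoc, hτ,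
      hνν, hab]
    match_scalars <;> field_simp
    ring
  -- The product t₋t₊, in the order not occurring in s₂, is reached from t₋² by multiplying with b
  -- on the right; only ab = 1 is needed, not ba = 1.
  have hmp : z * tm * tp = q • τ + ((q + 1) * q ^ 3) • 1 := by
    calc z * tm * tp = z * tm * tm * b := by rw [← htmb, ← mul_assoc]
      _ = _ := by rw [htm, add_mul, smul_mul_assoc, smul_mul_assoc, hτ, hab]
  have hX2 : s₂ + a * s₁ + s₁ * b + a * b = (q ^ 4)⁻¹ • (z * ((tp + tm) * (tp + tm))) -
      (2 : ℚ) • (a + s₁ + b) - (2 : ℚ) • 1 := by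
    have : z * ((tp + tm) * (tp + tm)) = z * tp * tp + z * tm * tm + z * tp * tm + z * tm * tp := by
      noncomm_ring
    rw [this, htp, htm, hmp, hab, h₂, h₁]
    simp only [mul_sub, mul_add, mul_smul_comm, mul_one, sub_mul, add_mul, smul_mul_assoc, haν,
      hνb, one_mul]
    match_scalars <;> field_simp <;> ring
  have hX3 : s₃ + a * s₂ + s₂ * b + a * s₁ * b = a + s₁ + b := by
    rw [has, hsb]
    calc s₃ + a + b + a * s₁ * b = a + (s₃ + a * s₁ * b) + b := by abel
      _ = _ := by rw [h₁₃]
  rw [linear_mul_cubic_mul_linear, hX2, hX3, ha₃, hb₃, zero_mul, has, hab]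
  simp

end RingIdentity

/-! ### Arithmetic of ℤ[i] at an inert prime -/

section GaussianNumbers

instance : Fact (∀ r : ℚ, r ^ 2 ≠ -1 + 0 * r) := ⟨fun r h => by nlinarith [sq_nonneg r]⟩

/-- The inclusion of `ℤ[i]` into `ℚ(i)`. -/
def gaussEmb : GaussianInt →+* GaussField where
  toFun x := ⟨x.re, x.im⟩
  map_one' := by ext <;> simp [QuadraticAlgebra.re_one, QuadraticAlgebra.im_one]
  map_mul' x y := by ext <;> simp
  map_zero' := by ext <;> simp
  map_add' x y := by ext <;> simp

theorem gaussEmb_re (x : GaussianInt) : (gaussEmb x).re = x.re := rfl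
theorem gaussEmb_im (x : GaussianInt) : (gaussEmb x).im = x.im := rfl

theorem gaussEmb_injective : Function.Injective gaussEmb := by
  intro x y h
  ext
  · have := congrArg QuadraticAlgebra.re h
    rw [gaussEmb_re, gaussEmb_re] at this
    exact_mod_cast this
  · have := congrArg QuadraticAlgebra.im h
    rw [gaussEmb_im, gaussEmb_im] at this
    exact_mod_cast this

theorem gaussEmb_mem (x : GaussianInt) : gaussEmb x ∈ gaussIntegers := ⟨x.re, x.im, rfl⟩

theorem exists_gaussEmb {x : GaussField} (hx : x ∈ gaussIntegers) : ∃ y, gaussEmb y = x := by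
  obtain ⟨a, b, rfl⟩ := hx
  exact ⟨⟨a, b⟩, rfl⟩

theorem star_gaussEmb (x : GaussianInt) : star (gaussEmb x) = gaussEmb (star x) := by
  ext <;> simp [gaussEmb_re, gaussEmb_im]

theorem mem_gaussIntegers_iff {x : GaussField} :
    x ∈ gaussIntegers ↔ (∃ a : ℤ, x.re = a) ∧ ∃ b : ℤ, x.im = b := by
  constructor
  · rintro ⟨a, b, rfl⟩
    exact ⟨⟨a, rfl⟩, b, rfl⟩
  · rintro ⟨⟨a, ha⟩, b, hb⟩
    exact ⟨a, b, by ext <;> assumption⟩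

theorem algebraMap_mem_gaussIntegers_iff {r : ℚ} :
    algebraMap ℚ GaussField r ∈ gaussIntegers ↔ ∃ a : ℤ, r = a := by
  rw [mem_gaussIntegers_iff]
  exact ⟨fun h => h.1, fun h => ⟨h, 0, by simp⟩⟩

theorem star_mem_gaussIntegers_iff {x : GaussField} :
    star x ∈ gaussIntegers ↔ x ∈ gaussIntegers :=
  ⟨fun h => by simpa using star_mem_gaussIntegers h, star_mem_gaussIntegers⟩

/-- Bézout in the Euclidean ring ℤ[i]: divide (a, b) by its gcd and complete the primitive vector to
a matrix of determinant one. -/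
theorem exists_sl2_mul_eq_zero {a b : GaussField} (ha : a ∈ gaussIntegers)
    (hb : b ∈ gaussIntegers) :
    ∃ α ∈ gaussIntegers, ∃ β ∈ gaussIntegers, ∃ γ ∈ gaussIntegers, ∃ δ ∈ gaussIntegers,
      α * δ - β * γ = 1 ∧ a * α + b * γ = 0 := by
  obtain ⟨a, rfl⟩ := exists_gaussEmb ha
  obtain ⟨b, rfl⟩ := exists_gaussEmb hb
  by_cases h0 : EuclideanDomain.gcd a b = 0
  · rw [EuclideanDomain.gcd_eq_zero_iff] at h0
    refine ⟨1, one_mem _, 0, zero_mem _, 0, zero_mem _, 1, one_mem _, by simp, ?_⟩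
    rw [h0.1]; simp
  · obtain ⟨a', ha'⟩ := EuclideanDomain.gcd_dvd_left a b
    obtain ⟨b', hb'⟩ := EuclideanDomain.gcd_dvd_right a b
    have hg := EuclideanDomain.gcd_eq_gcd_ab a b
    set g := EuclideanDomain.gcd a b
    set x := EuclideanDomain.gcdA a b
    set y := EuclideanDomain.gcdB a b
    have h1 : a' * x + b' * y = 1 := by
      apply mul_left_cancel₀ h0
      rw [mul_one]
      calc g * (a' * x + b' * y) = (g * a') * x + (g * b') * y := by ring
        _ = g := by rw [← ha', ← hb', ← hg]
    refine ⟨_, gaussEmb_mem b', _, gaussEmb_mem x, _, gaussEmb_mem (-a'), _, gaussEmb_mem y,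
      ?_, ?_⟩
    · rw [← map_mul, ← map_mul, ← map_sub, ← map_one gaussEmb]
      congr 1
      rw [← h1]; ring
    · rw [← map_mul, ← map_mul, ← map_add, ← map_zero gaussEmb]
      congr 1
      calc a * b' + b * (-a') = (g * a') * b' + (g * b') * (-a') := by rw [← ha', ← hb']
        _ = 0 := by ring

/-- If `b ā` is real then some matrix of `SL₂(ℤ)` maps the row `(a, b)` to a row `(0, *)`. -/
theorem exists_sl2_int_mul_eq_zero {a b : GaussField} (ha : a ∈ gaussIntegers)
    (hb : b ∈ gaussIntegers) (h : b * star a = star b * a) :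
    ∃ α β γ δ : ℤ, α * δ - β * γ = 1 ∧ a * α + b * γ = 0 := by
  obtain ⟨a₁, a₂, rfl⟩ := ha
  obtain ⟨b₁, b₂, rfl⟩ := hb
  have h' : a₁ * b₂ = b₁ * a₂ := by
    have := congrArg QuadraticAlgebra.im h
    simp at this
    have h2 : (a₁ : ℚ) * b₂ = b₁ * a₂ := by linarith
    exact_mod_cast h2
  -- The last clause records that (x, y) is zero or a nonzero multiple of (-γ, α). As the real and
  -- imaginary parts of the row are proportional, the matrix found for a nonzero real part also
  -- kills the imaginary part.
  have key : ∀ x y : ℤ, ∃ α β γ δ : ℤ, α * δ - β * γ = 1 ∧ x * α + y * γ = 0 ∧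
      ((x = 0 ∧ y = 0) ∨ ∃ g, g ≠ 0 ∧ x = g * -γ ∧ y = g * α) := by
    intro x y
    by_cases h0 : Int.gcd x y = 0
    · rw [Int.gcd_eq_zero_iff] at h0
      exact ⟨1, 0, 0, 1, by simp, by simp [h0], Or.inl h0⟩
    · obtain ⟨x', hx'⟩ := Int.gcd_dvd_left (a := x) (b := y)
      obtain ⟨y', hy'⟩ := Int.gcd_dvd_right (a := x) (b := y)
      have hg := Int.gcd_eq_gcd_ab x y
      set g : ℤ := (Int.gcd x y : ℤ)
      have h0' : g ≠ 0 := Int.natCast_ne_zero.2 h0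
      refine ⟨y', Int.gcdA x y, -x', Int.gcdB x y, ?_, ?_, Or.inr ⟨g, h0', by simpa using hx', hy'⟩⟩
      · apply mul_left_cancel₀ h0'
        calc g * (y' * Int.gcdB x y - Int.gcdA x y * -x')
            = (g * x') * Int.gcdA x y + (g * y') * Int.gcdB x y := by ring
          _ = g * 1 := by rw [← hx', ← hy', ← hg, mul_one]
      · calc x * y' + y * -x' = (g * x') * y' + (g * y') * (-x') := by rw [← hx', ← hy']
          _ = 0 := by ring
  have fin : ∀ α γ : ℤ, a₁ * α + b₁ * γ = 0 → a₂ * α + b₂ * γ = 0 →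
      (⟨a₁, a₂⟩ : GaussField) * α + ⟨b₁, b₂⟩ * γ = 0 := by
    intro α γ h1 h2
    ext
    · simp
      exact_mod_cast h1
    · simp
      exact_mod_cast h2
  obtain ⟨α, β, γ, δ, h1, h2, h3 | ⟨g, hg, hx, hy⟩⟩ := key a₁ b₁
  · obtain ⟨α, β, γ, δ, h1, h2, -⟩ := key a₂ b₂
    exact ⟨α, β, γ, δ, h1, fin _ _ (by simp [h3]) h2⟩
  · refine ⟨α, β, γ, δ, h1, fin _ _ h2 ?_⟩
    apply mul_left_cancel₀ hg
    rw [hx, hy] at h'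
    linear_combination -h'

/-- Factor a² + b² = (a + bi)(a - bi) and use that p is prime in ℤ[i]. -/
theorem inert_dvd {p : ℕ} (hp : Prime (p : GaussianInt)) {a b : ℤ} (h : (p : ℤ) ∣ a ^ 2 + b ^ 2) :
    (p : ℤ) ∣ a ∧ (p : ℤ) ∣ b := by
  have h1 : (p : GaussianInt) ∣ ⟨a, b⟩ * ⟨a, -b⟩ := by
    obtain ⟨k, hk⟩ := h
    refine ⟨k, ?_⟩
    ext
    · simp; linear_combination hk
    · simp; ring
  have key : ∀ c d : ℤ, (p : GaussianInt) ∣ ⟨c, d⟩ → (p : ℤ) ∣ c ∧ (p : ℤ) ∣ d := by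
    rintro c d ⟨k, hk⟩
    refine ⟨⟨k.re, ?_⟩, k.im, ?_⟩
    · simpa using congrArg Zsqrtd.re hk
    · simpa using congrArg Zsqrtd.im hk
  rcases hp.dvd_or_dvd h1 with h2 | h2
  · exact key _ _ h2
  · have := key _ _ h2
    simpa using this

variable {p : ℕ}

/-- The element `p ^ e` of `ℚ(i)`. -/
def pzpow (p : ℕ) (e : ℤ) : GaussField := algebraMap ℚ GaussField ((p : ℚ) ^ e)

theorem pzpow_zero : pzpow p 0 = 1 := by simp [pzpow]

theorem pzpow_one : pzpow p 1 = p := by simp [pzpow]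

theorem pzpow_natCast (n : ℕ) : pzpow p n = (p : GaussField) ^ n := by
  simp [pzpow]

theorem star_pzpow (e : ℤ) : star (pzpow p e) = pzpow p e := star_algebraMap _

theorem smul_eq_pzpow_mul (e : ℤ) (x : GaussField) : ((p : ℚ) ^ e) • x = pzpow p e * x :=
  Algebra.smul_def _ _

variable [Fact p.Prime]

theorem pzpow_add (a b : ℤ) : pzpow p (a + b) = pzpow p a * pzpow p b := by
  rw [pzpow, zpow_add₀ (cast_p_ne_zero p), map_mul]; rfl

theorem pzpow_ne_zero (e : ℤ) : pzpow p e ≠ 0 := by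
  rw [pzpow, Ne, map_eq_zero]
  exact zpow_ne_zero _ (cast_p_ne_zero p)

theorem pzpow_mem_away (e : ℤ) : pzpow p e ∈ gaussIntegersAway p := algebraMap_zpow_mem p e

theorem pzpow_mem_gaussIntegers_iff {e : ℤ} : pzpow p e ∈ gaussIntegers ↔ 0 ≤ e := by
  rw [pzpow, algebraMap_mem_gaussIntegers_iff]
  have hp1 : 1 < p := (Fact.out : p.Prime).one_lt
  constructor
  · rintro ⟨a, ha⟩
    by_contra! he
    have h1 : (p : ℚ) ^ e < 1 := zpow_lt_one_of_neg₀ (by exact_mod_cast hp1) he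
    have h2 : 0 < (p : ℚ) ^ e := zpow_pos (by exact_mod_cast hp1.le) _
    rw [ha] at h1 h2
    have h3 : a < 1 := by exact_mod_cast h1
    have h4 : 0 < a := by exact_mod_cast h2
    omega
  · intro he
    obtain ⟨n, rfl⟩ := Int.eq_ofNat_of_zero_le he
    exact ⟨(p : ℤ) ^ n, by simp⟩

theorem pzpow_injective {a b : ℤ} (h : pzpow p a = pzpow p b) : a = b := by
  have hp1 : 1 < p := (Fact.out : p.Prime).one_lt
  have h2 := (algebraMap ℚ GaussField).injective h
  exact zpow_right_injective₀ (by exact_mod_cast hp1.le) (by exact_mod_cast hp1.ne') h2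

/-- After clearing denominators x divides a power of p, and since p stays prime its divisors are
powers of p up to one of the units of ℤ[i], which have norm one. -/
theorem isUnit_away (hp : Prime (p : GaussianInt)) {x y : GaussField}
    (hx : x ∈ gaussIntegersAway p) (hy : y ∈ gaussIntegersAway p) (hxy : x * y = 1) :
    ∃ e : ℤ, ∃ ε ∈ gaussIntegers, star ε * ε = 1 ∧ x = pzpow p e * ε := by
  obtain ⟨n, hn⟩ := hx
  obtain ⟨m, hm⟩ := hy
  obtain ⟨x₀, hx₀⟩ := exists_gaussEmb hn
  obtain ⟨y₀, hy₀⟩ := exists_gaussEmb hm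
  have h1 : x₀ * y₀ = (p : GaussianInt) ^ (n + m) := by
    apply gaussEmb_injective
    rw [map_mul, hx₀, hy₀, map_pow, map_natCast, pow_add]
    linear_combination (p : GaussField) ^ n * (p : GaussField) ^ m * hxy
  obtain ⟨i, -, u, hu⟩ := (dvd_prime_pow hp (n + m)).1 ⟨y₀, h1.symm⟩
  have hnorm : star (u⁻¹ : GaussianIntˣ).1 * (u⁻¹ : GaussianIntˣ).1 = 1 := by
    have h2 : (Zsqrtd.norm (u⁻¹ : GaussianIntˣ).1).natAbs = 1 :=
      Zsqrtd.norm_eq_one_iff.2 (u⁻¹).isUnit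
    have h3 : 0 ≤ Zsqrtd.norm (u⁻¹ : GaussianIntˣ).1 := GaussianInt.norm_nonneg _
    have h4 : Zsqrtd.norm (u⁻¹ : GaussianIntˣ).1 = 1 := by omega
    rw [mul_comm, ← Zsqrtd.norm_eq_mul_conj, h4, Int.cast_one]
  refine ⟨i - n, gaussEmb (u⁻¹ : GaussianIntˣ), gaussEmb_mem _, ?_, ?_⟩
  · rw [star_gaussEmb, ← map_mul, hnorm, map_one]
  · have h5 : x₀ = (p : GaussianInt) ^ i * (u⁻¹ : GaussianIntˣ) := by
      rw [← hu, mul_assoc, Units.mul_inv, mul_one]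
    rw [h5, map_mul, map_pow, map_natCast, ← pzpow_natCast, ← pzpow_natCast] at hx₀
    apply mul_left_cancel₀ (pzpow_ne_zero (p := p) n)
    rw [← mul_assoc, ← pzpow_add, ← hx₀, add_sub_cancel]

end GaussianNumbers

/-! ### Similitude relations, explicit elements of Γ₂, Iwasawa decomposition -/

section SimilitudeMatrices

variable {p : ℕ}

theorem similitude_of_pzpow {M : Matrix (Fin 4) (Fin 4) GaussField} {d : ℤ}
    (h : Mᴴ * matJ * M = pzpow p d • matJ) : Mᴴ * matJ * M = ((p : ℚ) ^ d) • matJ := by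
  rw [h]
  ext i j : 1
  rw [Matrix.smul_apply, Matrix.smul_apply, smul_eq_pzpow_mul, smul_eq_mul]

variable [Fact p.Prime]

theorem conj_matJ_apply (M : Matrix (Fin 4) (Fin 4) GaussField) (i j : Fin 4) :
    (Mᴴ * matJ * M) i j = star (M 2 i) * M 0 j + star (M 3 i) * M 1 j -
      star (M 0 i) * M 2 j - star (M 1 i) * M 3 j := by
  simp [Matrix.mul_apply, Fin.sum_univ_four, matJ]
  ring

theorem matJ_conj_apply (M : Matrix (Fin 4) (Fin 4) GaussField) (i j : Fin 4) :
    (M * matJ * Mᴴ) i j = M i 2 * star (M j 0) + M i 3 * star (M j 1) -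
      M i 0 * star (M j 2) - M i 1 * star (M j 3) := by
  simp [Matrix.mul_apply, Fin.sum_univ_four, matJ]
  ring

theorem matJ_mul_conj_mul_matJ (M : Matrix (Fin 4) (Fin 4) GaussField) :
    matJ * Mᴴ * matJ =
      !![-star (M 2 2), -star (M 3 2), star (M 0 2), star (M 1 2);
        -star (M 2 3), -star (M 3 3), star (M 0 3), star (M 1 3);
        star (M 2 0), star (M 3 0), -star (M 0 0), -star (M 1 0);
        star (M 2 1), star (M 3 1), -star (M 0 1), -star (M 1 1)] := by
  ext i j : 1
  rw [Matrix.mul_apply, Fin.sum_univ_four]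
  simp only [Matrix.mul_apply, Fin.sum_univ_four, Matrix.conjTranspose_apply]
  fin_cases i <;> fin_cases j <;> simp [matJ]

theorem simGroup_val_mul (g h : simGroup p) : (g * h).1.val = g.1.val * h.1.val := rfl

theorem simGroup_val_one : (1 : simGroup p).1.val = 1 := rfl

theorem simGroup_ext {g h : simGroup p} (H : ∀ i j, g.1.val i j = h.1.val i j) : g = h :=
  Subtype.ext (Units.ext (Matrix.ext H))

theorem exists_similitude (g : simGroup p) :
    ∃ d : ℤ, g.1.valᴴ * matJ * g.1.val = pzpow p d • matJ := by
  obtain ⟨d, hd⟩ := g.2.2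
  refine ⟨d, ?_⟩
  rw [hd]
  ext i j : 1
  rw [Matrix.smul_apply, Matrix.smul_apply, smul_eq_pzpow_mul, smul_eq_mul]

theorem similitude_unique {M : Matrix (Fin 4) (Fin 4) GaussField} {d e : ℤ}
    (hd : Mᴴ * matJ * M = pzpow p d • matJ) (he : Mᴴ * matJ * M = pzpow p e • matJ) : d = e := by
  rw [hd] at he
  have := congrFun (congrFun he 2) 0
  simp [matJ] at this
  exact pzpow_injective this

theorem inv_val (g : simGroup p) {d : ℤ} (h : g.1.valᴴ * matJ * g.1.val = pzpow p d • matJ) :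
    (g⁻¹).1.val = (-pzpow p (-d)) • (matJ * g.1.valᴴ * matJ) := by
  have hc : (p : ℚ) ^ d ≠ 0 := zpow_ne_zero _ (cast_p_ne_zero p)
  have := inv_eq_of_similitude hc (similitude_of_pzpow h)
  change (g.1⁻¹).val = _
  rw [this, ← zpow_neg]
  ext i j : 1
  rw [Matrix.smul_apply, Matrix.smul_apply, neg_smul, smul_eq_pzpow_mul, smul_eq_mul, neg_mul]

/-- The explicit inverse -p⁻ᵈ·J·g*·J is also a right inverse, which turns the relation between
columns into one between rows. The row form drives all the eliminations below. -/
theorem similitude_conj (g : simGroup p) {d : ℤ}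
    (h : g.1.valᴴ * matJ * g.1.val = pzpow p d • matJ) :
    g.1.val * matJ * g.1.valᴴ = pzpow p d • matJ := by
  have h1 : g.1.val * (g⁻¹).1.val = 1 := by
    rw [← simGroup_val_mul, mul_inv_cancel, simGroup_val_one]
  rw [inv_val g h, Matrix.mul_smul, neg_smul, ← smul_neg] at h1
  have h2 : -(g.1.val * (matJ * g.1.valᴴ * matJ)) = pzpow p d • 1 := by
    rw [← h1, smul_smul, ← pzpow_add, add_neg_cancel, pzpow_zero, one_smul]
  calc g.1.val * matJ * g.1.valᴴ = -(g.1.val * (matJ * g.1.valᴴ * matJ)) * matJ := by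
        rw [Matrix.neg_mul]
        simp only [Matrix.mul_assoc, matJ_mul_matJ]
        simp
    _ = _ := by rw [h2, Matrix.smul_mul, Matrix.one_mul]

theorem row_relation (g : simGroup p) {d : ℤ}
    (h : g.1.valᴴ * matJ * g.1.val = pzpow p d • matJ) (i j : Fin 4) :
    g.1 i 2 * star (g.1 j 0) + g.1 i 3 * star (g.1 j 1) -
      g.1 i 0 * star (g.1 j 2) - g.1 i 1 * star (g.1 j 3) = pzpow p d * matJ i j := by
  rw [← matJ_conj_apply, similitude_conj g h]
  rfl

/-- The element of the modular group given by a matrix. -/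
theorem exists_modular {M : Matrix (Fin 4) (Fin 4) GaussField} (hM : ∀ i j, M i j ∈ gaussIntegers)
    (h : Mᴴ * matJ * M = matJ) : ∃ γ ∈ modularGroup p, γ.1.val = M :=
  ⟨simOfMatrix p M (fun i j => gaussIntegers_le_away p (hM i j)) 0 (by rw [h]; simp),
    ⟨hM, h⟩, rfl⟩

theorem forall_fin_four_mem {R : Subring GaussField} {M : Matrix (Fin 4) (Fin 4) GaussField}
    (h0 : M 0 0 ∈ R ∧ M 0 1 ∈ R ∧ M 0 2 ∈ R ∧ M 0 3 ∈ R)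
    (h1 : M 1 0 ∈ R ∧ M 1 1 ∈ R ∧ M 1 2 ∈ R ∧ M 1 3 ∈ R)
    (h2 : M 2 0 ∈ R ∧ M 2 1 ∈ R ∧ M 2 2 ∈ R ∧ M 2 3 ∈ R)
    (h3 : M 3 0 ∈ R ∧ M 3 1 ∈ R ∧ M 3 2 ∈ R ∧ M 3 3 ∈ R) (i j : Fin 4) : M i j ∈ R := by
  fin_cases i <;> fin_cases j <;> simp_all

theorem exists_levi {α β γ δ : GaussField} (hα : α ∈ gaussIntegers) (hβ : β ∈ gaussIntegers)
    (hγ : γ ∈ gaussIntegers) (hδ : δ ∈ gaussIntegers) (h : α * δ - β * γ = 1) :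
    ∃ g ∈ modularGroup p, g.1.val = !![star δ, -star γ, 0, 0; -star β, star α, 0, 0;
      0, 0, α, β; 0, 0, γ, δ] := by
  refine exists_modular (forall_fin_four_mem ?_ ?_ ?_ ?_) ?_
  · simp [star_mem_gaussIntegers_iff, hδ, hγ, zero_mem]
  · simp [star_mem_gaussIntegers_iff, hα, hβ, zero_mem]
  · simp [hα, hβ, zero_mem]
  · simp [hγ, hδ, zero_mem]
  · have h' : star α * star δ - star β * star γ = 1 := by
      have := congrArg star h
      simpa [mul_comm] using this
    ext i j : 1
    rw [conj_matJ_apply]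
    fin_cases i <;> fin_cases j <;> simp [matJ] <;>
      first | ring1 | linear_combination h | linear_combination h' | linear_combination -h

theorem exists_sl2_one_three {a b c d : ℤ} (h : a * d - b * c = 1) :
    ∃ g ∈ modularGroup p, g.1.val = !![1, 0, 0, 0; 0, (a : GaussField), 0, b; 0, 0, 1, 0;
      0, (c : GaussField), 0, d] := by
  refine exists_modular (forall_fin_four_mem ?_ ?_ ?_ ?_) ?_
  · simp [zero_mem, one_mem]
  · simp [zero_mem, intCast_mem]
  · simp [zero_mem, one_mem]
  · simp [zero_mem, intCast_mem]
  · have h' : (a : GaussField) * d - b * c = 1 := by exact_mod_cast h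
    ext i j : 1
    rw [conj_matJ_apply]
    fin_cases i <;> fin_cases j <;> simp [matJ] <;>
      first | ring1 | linear_combination h' | linear_combination -h'

theorem exists_sl2_zero_two {a b c d : ℤ} (h : a * d - b * c = 1) :
    ∃ g ∈ modularGroup p, g.1.val = !![(a : GaussField), 0, b, 0; 0, 1, 0, 0;
      (c : GaussField), 0, d, 0; 0, 0, 0, 1] := by
  refine exists_modular (forall_fin_four_mem ?_ ?_ ?_ ?_) ?_
  · simp [zero_mem, intCast_mem]
  · simp [zero_mem, one_mem]
  · simp [zero_mem, intCast_mem]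
  · simp [zero_mem, one_mem]
  · have h' : (a : GaussField) * d - b * c = 1 := by exact_mod_cast h
    ext i j : 1
    rw [conj_matJ_apply]
    fin_cases i <;> fin_cases j <;> simp [matJ] <;>
      first | ring1 | linear_combination h' | linear_combination -h'

/-- Block triangular elements with `A` lower triangular and `D` upper triangular. -/
def IsBorel (g : simGroup p) : Prop :=
  g.1 0 1 = 0 ∧ g.1 2 0 = 0 ∧ g.1 2 1 = 0 ∧ g.1 3 0 = 0 ∧ g.1 3 1 = 0 ∧ g.1 3 2 = 0

theorem IsBorel.mul {g h : simGroup p} (hg : IsBorel g) (hh : IsBorel h) : IsBorel (g * h) := by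
  obtain ⟨a1, a2, a3, a4, a5, a6⟩ := hg
  obtain ⟨b1, b2, b3, b4, b5, b6⟩ := hh
  refine ⟨?_, ?_, ?_, ?_, ?_, ?_⟩ <;> rw [simGroup_val_mul] <;>
    simp [Matrix.mul_apply, Fin.sum_univ_four, *]

theorem IsBorel.inv {g : simGroup p} (hg : IsBorel g) : IsBorel g⁻¹ := by
  obtain ⟨a1, a2, a3, a4, a5, a6⟩ := hg
  obtain ⟨d, hd⟩ := exists_similitude g
  refine ⟨?_, ?_, ?_, ?_, ?_, ?_⟩ <;> rw [inv_val g hd, matJ_mul_conj_mul_matJ] <;>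
    simp [*]

/-- Every element of `S_p^2` can be moved into the parabolic subgroup, from the right. -/
theorem exists_mul_last_row (g : simGroup p) :
    ∃ γ ∈ modularGroup p, (g * γ).1 3 0 = 0 ∧ (g * γ).1 3 1 = 0 ∧ (g * γ).1 3 2 = 0 := by
  obtain ⟨n, hn⟩ := exists_denominator p g
  obtain ⟨d, hd⟩ := exists_similitude g
  have hp0 : (p : GaussField) ^ n ≠ 0 := by rw [← pzpow_natCast]; exact pzpow_ne_zero _
  have int (γ : simGroup p) (hγ : γ ∈ modularGroup p) (j : Fin 4) :
      (p : GaussField) ^ n * (g * γ).1 3 j ∈ gaussIntegers := by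
    rw [simGroup_val_mul, Matrix.mul_apply, Finset.mul_sum]
    refine sum_mem fun k _ => ?_
    rw [← mul_assoc]
    exact mul_mem (hn 3 k) (hγ.1 k j)
  have hsim (γ : simGroup p) (hγ : γ ∈ modularGroup p) :
      (g * γ).1.valᴴ * matJ * (g * γ).1.val = pzpow p d • matJ := by
    rw [simGroup_val_mul, Matrix.conjTranspose_mul]
    calc _ = γ.1.valᴴ * (g.1.valᴴ * matJ * g.1.val) * γ.1.val := by
          simp only [Matrix.mul_assoc]
      _ = _ := by rw [hd, Matrix.mul_smul, Matrix.smul_mul, hγ.2]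
  -- first step: make the third entry vanish
  obtain ⟨α, hα, β, hβ, γ, hγ, δ, hδ, h1, h2⟩ := exists_sl2_mul_eq_zero
    (by simpa using hn 3 2) (by simpa using hn 3 3)
  obtain ⟨g₁, hg₁, e₁⟩ := exists_levi (p := p) hα hβ hγ hδ h1
  have z₁ : (g * g₁).1 3 2 = 0 := by
    rw [simGroup_val_mul, Matrix.mul_apply, Fin.sum_univ_four, e₁]
    simp
    apply mul_left_cancel₀ hp0
    linear_combination h2
  -- second step: make the second entry vanish
  have r₁ := row_relation (g * g₁) (hsim g₁ hg₁) 3 3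
  rw [z₁] at r₁
  -- The row is isotropic; with its entry 2 equal to zero this says that entry 3 times the conjugate
  -- of entry 1 is real, so a matrix in SL₂(ℤ) suffices.
  obtain ⟨a, b, c, d', h3, h4⟩ := exists_sl2_int_mul_eq_zero (int g₁ hg₁ 1) (int g₁ hg₁ 3) (by
    simp [matJ] at r₁ ⊢
    linear_combination ((p : GaussField) ^ n * (p : GaussField) ^ n) * r₁)
  obtain ⟨g₂, hg₂, e₂⟩ := exists_sl2_one_three (p := p) h3
  have hg₁₂ := mul_mem hg₁ hg₂
  have z₂ : (g * (g₁ * g₂)).1 3 2 = 0 := by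
    rw [← mul_assoc, simGroup_val_mul, Matrix.mul_apply, Fin.sum_univ_four, e₂, z₁]
    simp
  have w₂ : (g * (g₁ * g₂)).1 3 1 = 0 := by
    rw [← mul_assoc, simGroup_val_mul (g * g₁), Matrix.mul_apply, Fin.sum_univ_four, e₂]
    simp
    apply mul_left_cancel₀ hp0
    linear_combination h4
  -- third step: exchange the first and third entries
  obtain ⟨g₃, hg₃, e₃⟩ := exists_sl2_zero_two (p := p) (a := 0) (b := 1) (c := -1) (d := 0)
    (by norm_num)
  have hg₁₃ := mul_mem hg₁₂ hg₃
  have z₃ : (g * (g₁ * g₂ * g₃)).1 3 0 = 0 := by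
    rw [← mul_assoc, simGroup_val_mul _ g₃, Matrix.mul_apply, Fin.sum_univ_four, e₃, z₂]
    simp
  have w₃ : (g * (g₁ * g₂ * g₃)).1 3 1 = 0 := by
    rw [← mul_assoc, simGroup_val_mul _ g₃, Matrix.mul_apply, Fin.sum_univ_four, e₃, w₂]
    simp
  -- last step: make the third entry vanish
  obtain ⟨α, hα, β, hβ, γ, hγ, δ, hδ, h5, h6⟩ := exists_sl2_mul_eq_zero
    (int _ hg₁₃ 2) (int _ hg₁₃ 3)
  obtain ⟨g₄, hg₄, e₄⟩ := exists_levi (p := p) hα hβ hγ hδ h5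
  refine ⟨g₁ * g₂ * g₃ * g₄, mul_mem hg₁₃ hg₄, ?_, ?_, ?_⟩
  · rw [← mul_assoc, simGroup_val_mul _ g₄, Matrix.mul_apply, Fin.sum_univ_four, e₄, z₃, w₃]
    simp
  · rw [← mul_assoc, simGroup_val_mul _ g₄, Matrix.mul_apply, Fin.sum_univ_four, e₄, z₃, w₃]
    simp
  · rw [← mul_assoc g, simGroup_val_mul _ g₄, Matrix.mul_apply, Fin.sum_univ_four, e₄]
    simp
    apply mul_left_cancel₀ hp0
    linear_combination h6

theorem last_diag_ne_zero {g : simGroup p} (h0 : g.1 3 0 = 0) (h1 : g.1 3 1 = 0)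
    (h2 : g.1 3 2 = 0) : g.1 3 3 ≠ 0 := by
  intro h3
  have h : g.1.val * (g⁻¹).1.val = 1 := by
    rw [← simGroup_val_mul, mul_inv_cancel, simGroup_val_one]
  have := congrFun (congrFun h 3) 3
  rw [Matrix.mul_apply, Fin.sum_univ_four, h0, h1, h2, h3] at this
  simp at this

/-- The zeros in the last row force zeros at (2,1) and (0,1) by the row relations. What remains is
the block in coordinates 0 and 2, whose lower row has a real ratio and is cleared by SL₂(ℤ). The
last clause, that the old lower row is an integral multiple of the new (2,2) entry, is needed for
the minimality argument behind the injectivity of Φ. -/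
theorem exists_mul_isBorel_of_last_row {g : simGroup p} (h0 : g.1 3 0 = 0) (h1 : g.1 3 1 = 0)
    (h2 : g.1 3 2 = 0) {x y : GaussField}
    (hx : x = g.1 2 0) (hy : y = g.1 2 2) :
    ∃ γ ∈ modularGroup p, IsBorel (g * γ) ∧ (g * γ).1 3 3 = g.1 3 3 ∧
      ∃ a b : ℤ, x = (g * γ).1 2 2 * a ∧ y = (g * γ).1 2 2 * b := by
  subst hx hy
  obtain ⟨n, hn⟩ := exists_denominator p g
  obtain ⟨d, hd⟩ := exists_similitude g
  have hp0 : (p : GaussField) ^ n ≠ 0 := by rw [← pzpow_natCast]; exact pzpow_ne_zero _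
  have hu := last_diag_ne_zero h0 h1 h2
  have hs : star (g.1 3 3) ≠ 0 := by simpa using hu
  have z1 : g.1 2 1 = 0 := by
    have := row_relation g hd 2 3
    rw [h0, h1, h2] at this
    simpa [matJ, hu] using this
  have z2 : g.1 0 1 = 0 := by
    have := row_relation g hd 0 3
    rw [h0, h1, h2] at this
    simpa [matJ, hu] using this
  have r := row_relation g hd 2 2
  rw [z1] at r
  obtain ⟨α, β, γ, δ, h3, h4⟩ := exists_sl2_int_mul_eq_zero (hn 2 0) (hn 2 2) (by
    simp [matJ] at r ⊢
    linear_combination ((p : GaussField) ^ n * (p : GaussField) ^ n) * r)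
  have h4' : g.1 2 0 * α + g.1 2 2 * γ = 0 := by
    apply mul_left_cancel₀ hp0
    linear_combination h4
  obtain ⟨w, hw, e⟩ := exists_sl2_zero_two (p := p) h3
  have h3' : (α : GaussField) * δ - β * γ = 1 := by exact_mod_cast h3
  refine ⟨w, hw, ⟨?_, ?_, ?_, ?_, ?_, ?_⟩, ?_, -γ, α, ?_, ?_⟩ <;>
    rw [simGroup_val_mul, Matrix.mul_apply, Fin.sum_univ_four, e] <;> simp [h0, h1, h2, z1, z2]
  · exact h4'
  · linear_combination (-g.1 2 0) * h3' + δ * h4'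
  · linear_combination (-g.1 2 2) * h3' - β * h4'

/-- The Iwasawa decomposition. -/
theorem exists_mul_isBorel (g : simGroup p) : ∃ γ ∈ modularGroup p, IsBorel (g * γ) := by
  obtain ⟨γ, hγ, h0, h1, h2⟩ := exists_mul_last_row g
  obtain ⟨δ, hδ, h, -⟩ := exists_mul_isBorel_of_last_row h0 h1 h2 rfl rfl
  exact ⟨γ * δ, mul_mem hγ hδ, by rwa [← mul_assoc]⟩

theorem exists_isBorel_mul (g : simGroup p) : ∃ γ ∈ modularGroup p, IsBorel (γ * g) := by
  obtain ⟨γ, hγ, h⟩ := exists_mul_isBorel g⁻¹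
  exact ⟨γ⁻¹, inv_mem hγ, by simpa using h.inv⟩

theorem IsBorel.mem_parabolicGroup {g : simGroup p} (h : IsBorel g) : g ∈ parabolicGroup p :=
  ⟨h.2.2.2.1, h.2.2.2.2.1, h.2.2.2.2.2⟩

theorem exists_mul_mem_parabolicGroup (g : simGroup p) :
    ∃ γ ∈ modularGroup p, γ * g ∈ parabolicGroup p :=
  let ⟨γ, hγ, h⟩ := exists_isBorel_mul g
  ⟨γ, hγ, h.mem_parabolicGroup⟩

end SimilitudeMatrices

/-! ### Unipotent and torus elements; exponents of a coset -/

section BorelCosets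

theorem re_ratCast (r : ℚ) : (r : GaussField).re = r := rfl

theorem im_ratCast (r : ℚ) : (r : GaussField).im = 0 := rfl

theorem ratCast_mem_gaussIntegers_iff {r : ℚ} :
    (r : GaussField) ∈ gaussIntegers ↔ ∃ a : ℤ, r = a :=
  algebraMap_mem_gaussIntegers_iff

theorem eq_ratCast_of_star {x : GaussField} (h : star x = x) : x = (x.re : GaussField) := by
  have := congrArg QuadraticAlgebra.im h
  simp at this
  ext
  · rfl
  · rw [im_ratCast]
    linarith

theorem ratCast_two_mul_re (v z : GaussField) :
    ((2 * (star v * z).re : ℚ) : GaussField) = star v * z + star z * v := by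
  ext
  · rw [re_ratCast]; simp; ring
  · rw [im_ratCast]; simp; ring

theorem ratCast_norm_sq (v : GaussField) :
    ((v.re ^ 2 + v.im ^ 2 : ℚ) : GaussField) = star v * v := by
  ext
  · rw [re_ratCast]; simp; ring
  · rw [im_ratCast]; simp; ring

/-- The unipotent matrix `(1, S; 0, 1) (A, 0; 0, D)` with `D = (1, u; 0, 1)` and
`S = (s, z; z̄, w)`. -/
def uniMatrix (u z : GaussField) (s w : ℚ) : Matrix (Fin 4) (Fin 4) GaussField :=
  !![1, 0, (s : GaussField), s * u + z; -star u, 1, star z, star z * u + w; 0, 0, 1, u; 0, 0, 0, 1]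

theorem uniMatrix_similitude (u z : GaussField) (s w : ℚ) :
    (uniMatrix u z s w)ᴴ * matJ * uniMatrix u z s w = matJ := by
  ext i j : 1
  rw [conj_matJ_apply]
  fin_cases i <;> fin_cases j <;> simp [matJ, uniMatrix] <;> ring

/-- The unipotent group is a semidirect product: the parameter u adds, and v acts on the Hermitian
matrix (s, z; z̄, w) by congruence. The correction terms in the last two parameters come from this
action. -/
theorem uniMatrix_mul (v y u z : GaussField) (r q s w : ℚ) :
    uniMatrix v y r q * uniMatrix u z s w =
      uniMatrix (v + u) (y + z - v * s) (r + s)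
        (q + w - 2 * (star v * z).re + (v.re ^ 2 + v.im ^ 2) * s) := by
  ext i j : 1
  rw [Matrix.mul_apply, Fin.sum_univ_four]
  have h1 := ratCast_two_mul_re v z
  have h2 := ratCast_norm_sq v
  have h3 : ((q + w - 2 * (star v * z).re + (v.re ^ 2 + v.im ^ 2) * s : ℚ) : GaussField) =
      q + w - (star v * z + star z * v) + star v * v * s := by
    rw [Rat.cast_add, Rat.cast_sub, Rat.cast_add, h1, Rat.cast_mul (_ + _), h2]
  rw [uniMatrix, uniMatrix, uniMatrix, h3]
  fin_cases i <;> fin_cases j <;> simp <;> ring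

theorem uniMatrix_injective {u z u' z' : GaussField} {s w s' w' : ℚ}
    (h : uniMatrix u z s w = uniMatrix u' z' s' w') : u = u' ∧ z = z' ∧ s = s' ∧ w = w' := by
  have hu : u = u' := by simpa [uniMatrix] using congrFun (congrFun h 2) 3
  have hz : z = z' := by
    have : star z = star z' := by simpa [uniMatrix] using congrFun (congrFun h 1) 2
    exact star_injective this
  have hs : s = s' := by simpa [uniMatrix] using congrFun (congrFun h 0) 2
  have hw : w = w' := by
    have := congrFun (congrFun h 1) 3
    simpa [uniMatrix, hu, hz] using this
  exact ⟨hu, hz, hs, hw⟩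

/-- The parameters of `uniMatrix` lie in a given subring. -/
def ParamsMem (R : Subring GaussField) (u z : GaussField) (s w : ℚ) : Prop :=
  u ∈ R ∧ z ∈ R ∧ (s : GaussField) ∈ R ∧ (w : GaussField) ∈ R

theorem ParamsMem.uniMatrix_mem {R : Subring GaussField} (hR : ∀ x ∈ R, star x ∈ R)
    {u z : GaussField} {s w : ℚ} (h : ParamsMem R u z s w) (i j : Fin 4) :
    uniMatrix u z s w i j ∈ R := by
  obtain ⟨hu, hz, hs, hw⟩ := h
  have hsu := R.mul_mem hs hu
  have hzu := R.mul_mem (hR z hz) hu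
  refine forall_fin_four_mem ?_ ?_ ?_ ?_ i j
  · simp [uniMatrix, hs, R.zero_mem, R.one_mem, R.add_mem hsu hz]
  · simp [uniMatrix, hR, hu, hz, R.one_mem, R.add_mem hzu hw]
  · simp [uniMatrix, hu, R.zero_mem, R.one_mem]
  · simp [uniMatrix, R.zero_mem, R.one_mem]

theorem paramsMem_of_uniMatrix {R : Subring GaussField} (hR : ∀ x ∈ R, star x ∈ R)
    {u z : GaussField} {s w : ℚ} (h : ∀ i j, uniMatrix u z s w i j ∈ R) : ParamsMem R u z s w := by
  have hu : u ∈ R := by simpa [uniMatrix] using h 2 3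
  have hz : star z ∈ R := by simpa [uniMatrix] using h 1 2
  have hs : (s : GaussField) ∈ R := by simpa [uniMatrix] using h 0 2
  have hw : star z * u + w ∈ R := by simpa [uniMatrix] using h 1 3
  refine ⟨hu, by simpa using hR _ hz, hs, ?_⟩
  have := R.sub_mem hw (R.mul_mem hz hu)
  rwa [add_sub_cancel_left] at this

variable {p : ℕ}

theorem ParamsMem.away {u z : GaussField} {s w : ℚ} (h : ParamsMem gaussIntegers u z s w) :
    ParamsMem (gaussIntegersAway p) u z s w :=
  ⟨gaussIntegers_le_away p h.1, gaussIntegers_le_away p h.2.1, gaussIntegers_le_away p h.2.2.1,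
    gaussIntegers_le_away p h.2.2.2⟩

variable [Fact p.Prime]

/-- The unipotent element of `S_p^2` with the given parameters. -/
def uni {u z : GaussField} {s w : ℚ} (h : ParamsMem (gaussIntegersAway p) u z s w) : simGroup p :=
  simOfMatrix p (uniMatrix u z s w) (h.uniMatrix_mem fun _ => star_mem_away) 0
    (by rw [uniMatrix_similitude]; simp)

theorem uni_val {u z : GaussField} {s w : ℚ} (h : ParamsMem (gaussIntegersAway p) u z s w) :
    (uni h).1.val = uniMatrix u z s w := rfl

theorem uni_mem_modularGroup_iff {u z : GaussField} {s w : ℚ}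
    (h : ParamsMem (gaussIntegersAway p) u z s w) :
    uni h ∈ modularGroup p ↔ ParamsMem gaussIntegers u z s w :=
  ⟨fun H => paramsMem_of_uniMatrix (fun _ => star_mem_gaussIntegers) H.1,
    fun H => ⟨H.uniMatrix_mem fun _ => star_mem_gaussIntegers, uniMatrix_similitude _ _ _ _⟩⟩

/-- The exponents on the diagonal of `torus p m₀ m₁ m₂`. -/
def torusExp (m : Fin 3 → ℤ) : Fin 4 → ℤ := ![m 0 - m 1, m 0 - m 2, m 1, m 2]

theorem torusExp_add (m m' : Fin 3 → ℤ) (i : Fin 4) :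
    torusExp (m + m') i = torusExp m i + torusExp m' i := by
  fin_cases i <;> simp [torusExp] <;> ring

theorem torusExp_neg (m : Fin 3 → ℤ) (i : Fin 4) : torusExp (-m) i = -torusExp m i := by
  fin_cases i <;> simp [torusExp] <;> ring

theorem torusExp_injective : Function.Injective torusExp := by
  intro m m' h
  have h0 := congrFun h 0
  have h2 := congrFun h 2
  have h3 := congrFun h 3
  simp [torusExp] at h0 h2 h3
  ext i
  fin_cases i <;> simp <;> omega

/-- The torus element with exponents `m`. -/
def tor (p : ℕ) [Fact p.Prime] (m : Fin 3 → ℤ) : simGroup p := torus p (m 0) (m 1) (m 2)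

theorem tor_apply (m : Fin 3 → ℤ) (i j : Fin 4) :
    (tor p m).1.val i j = if i = j then pzpow p (torusExp m i) else 0 := rfl

theorem tor_mul_apply (m : Fin 3 → ℤ) (g : simGroup p) (i j : Fin 4) :
    (tor p m * g).1.val i j = pzpow p (torusExp m i) * g.1.val i j := by
  rw [simGroup_val_mul, Matrix.mul_apply, Finset.sum_eq_single i]
  · rw [tor_apply, if_pos rfl]
  · intro k _ hk
    rw [tor_apply, if_neg hk.symm, zero_mul]
  · simp

theorem mul_tor_apply (m : Fin 3 → ℤ) (g : simGroup p) (i j : Fin 4) :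
    (g * tor p m).1.val i j = g.1.val i j * pzpow p (torusExp m j) := by
  rw [simGroup_val_mul, Matrix.mul_apply, Finset.sum_eq_single j]
  · rw [tor_apply, if_pos rfl]
  · intro k _ hk
    rw [tor_apply, if_neg hk, mul_zero]
  · simp

theorem tor_add (m m' : Fin 3 → ℤ) : tor p (m + m') = tor p m * tor p m' :=
  simGroup_ext fun i j => by
    rw [tor_mul_apply, tor_apply, tor_apply, torusExp_add]
    split_ifs with h
    · rw [h, pzpow_add]
    · rw [mul_zero]

theorem tor_zero : tor p 0 = 1 :=
  simGroup_ext fun i j => by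
    rw [tor_apply, simGroup_val_one, Matrix.one_apply]
    refine if_congr Iff.rfl ?_ rfl
    rw [← pzpow_zero (p := p)]
    congr 1
    fin_cases i <;> rfl

/-- `g` is triangular, with the same diagonal as `tor p m`. -/
def HasDiag (g : simGroup p) (m : Fin 3 → ℤ) : Prop :=
  IsBorel g ∧ ∀ i, g.1.val i i = pzpow p (torusExp m i)

theorem IsBorel.mul_diag {g h : simGroup p} (hg : IsBorel g) (hh : IsBorel h) (i : Fin 4) :
    (g * h).1.val i i = g.1.val i i * h.1.val i i := by
  obtain ⟨a1, a2, a3, a4, a5, a6⟩ := hg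
  obtain ⟨b1, b2, b3, b4, b5, b6⟩ := hh
  rw [simGroup_val_mul, Matrix.mul_apply, Fin.sum_univ_four]
  fin_cases i <;> simp [*]

theorem HasDiag.mul {g h : simGroup p} {m m' : Fin 3 → ℤ} (hg : HasDiag g m) (hh : HasDiag h m') :
    HasDiag (g * h) (m + m') :=
  ⟨hg.1.mul hh.1, fun i => by rw [hg.1.mul_diag hh.1, hg.2, hh.2, torusExp_add, pzpow_add]⟩

theorem HasDiag.inv {g : simGroup p} {m : Fin 3 → ℤ} (hg : HasDiag g m) : HasDiag g⁻¹ (-m) :=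
  ⟨hg.1.inv, fun i => by
    have h := hg.1.mul_diag hg.1.inv i
    rw [mul_inv_cancel, simGroup_val_one, Matrix.one_apply_eq, hg.2] at h
    apply mul_left_cancel₀ (pzpow_ne_zero (p := p) (torusExp m i))
    rw [← h, torusExp_neg, ← pzpow_add, add_neg_cancel, pzpow_zero]⟩

theorem hasDiag_tor (m : Fin 3 → ℤ) : HasDiag (tor p m) m := by
  refine ⟨⟨?_, ?_, ?_, ?_, ?_, ?_⟩, fun i => by rw [tor_apply, if_pos rfl]⟩ <;>
    exact (tor_apply _ _ _).trans (if_neg (by decide))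

theorem hasDiag_zero_iff {n : simGroup p} : HasDiag n 0 ↔ IsUpperUnipotent p n := by
  have e : ∀ i, pzpow p (torusExp 0 i) = 1 := fun i => by
    rw [← pzpow_zero (p := p)]
    congr 1
    fin_cases i <;> rfl
  simp only [HasDiag, IsUpperUnipotent, e, IsBorel]
  exact and_comm

theorem hasDiag_uni {u z : GaussField} {s w : ℚ}
    (h : ParamsMem (gaussIntegersAway p) u z s w) : HasDiag (uni h) 0 := by
  rw [hasDiag_zero_iff]
  refine ⟨fun i => ?_, ?_, ?_, ?_, ?_, ?_, ?_⟩ <;> rw [uni_val]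
  · fin_cases i <;> simp [uniMatrix]
  all_goals simp [uniMatrix]

/-- The row relations between rows 0 and 1 say that BD⁻¹ is Hermitian; the one between rows 1 and 2
determines A from D. So u, z and two rational numbers describe the matrix completely. -/
theorem exists_eq_uni {n : simGroup p} (h : HasDiag n 0) :
    ∃ (u z : GaussField) (s w : ℚ) (H : ParamsMem (gaussIntegersAway p) u z s w), n = uni H := by
  obtain ⟨h1, a1, a2, a3, a4, a5, a6⟩ := hasDiag_zero_iff.1 h
  obtain ⟨d, hd⟩ := exists_similitude n
  have hd0 : pzpow p d = 1 := by
    have := row_relation n hd 2 0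
    simpa [h1, a1, a2, a3, a4, a5, a6, matJ] using this.symm
  have r00 := row_relation n hd 0 0
  have r01 := row_relation n hd 0 1
  have r11 := row_relation n hd 1 1
  have r12 := row_relation n hd 1 2
  simp [h1, a1, a2, a3, matJ] at r00 r01 r11 r12
  have hs := eq_ratCast_of_star (x := n.1 0 2) (by linear_combination -r00)
  have h10 : n.1 1 0 = -star (n.1 2 3) := by linear_combination -r12
  have h03 : n.1 0 3 = n.1 0 2 * n.1 2 3 + star (n.1 1 2) := by
    rw [h10] at r01
    simp at r01
    linear_combination r01
  have hw := eq_ratCast_of_star (x := n.1 1 3 - n.1 1 2 * n.1 2 3) (by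
    rw [h10] at r11
    simp at r11 ⊢
    linear_combination -r11)
  set s := (n.1 0 2).re
  set w := (n.1 1 3 - n.1 1 2 * n.1 2 3).re
  have hM : n.1.val = uniMatrix (n.1 2 3) (star (n.1 1 2)) s w := by
    ext i j : 1
    fin_cases i <;> fin_cases j <;>
      simp [uniMatrix, h1, a1, a2, a3, a4, a5, a6, ← hs, ← hw, h10, h03]
  have H : ParamsMem (gaussIntegersAway p) (n.1 2 3) (star (n.1 1 2)) s w :=
    paramsMem_of_uniMatrix (fun _ => star_mem_away) fun i j => by rw [← hM]; exact n.2.1 i j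
  exact ⟨_, _, _, _, H, simGroup_ext fun i j => congrFun (congrFun hM i) j⟩

theorem HasDiag.hasExponents {g : simGroup p} {m : Fin 3 → ℤ} (hg : HasDiag g m) :
    HasExponents p (coset (modularGroup p) g) m := by
  refine ⟨(tor p m)⁻¹ * g, ?_, ?_⟩
  · rw [← hasDiag_zero_iff]
    have := (hasDiag_tor m).inv.mul hg
    rwa [neg_add_cancel] at this
  · change _ = coset _ (tor p m * _)
    rw [mul_inv_cancel_left]

theorem HasExponents.exists_hasDiag {c : Cosets (modularGroup p)} {m : Fin 3 → ℤ}
    (h : HasExponents p c m) : ∃ g, HasDiag g m ∧ c = coset (modularGroup p) g := by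
  obtain ⟨n, hn, rfl⟩ := h
  have := (hasDiag_tor m).mul (hasDiag_zero_iff.2 hn)
  rw [add_zero] at this
  exact ⟨_, this, rfl⟩

/-- The diagonal of g'g⁻¹ consists of powers of p lying in ℤ[i], so the exponents can only grow from
g to g'; exchanging g and g' gives equality. -/
theorem HasDiag.eq_of_coset_eq {g g' : simGroup p} {m m' : Fin 3 → ℤ} (hg : HasDiag g m)
    (hg' : HasDiag g' m') (h : coset (modularGroup p) g = coset (modularGroup p) g') :
    m = m' := by
  have key : ∀ {g g' : simGroup p} {m m' : Fin 3 → ℤ}, HasDiag g m → HasDiag g' m' →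
      coset (modularGroup p) g = coset (modularGroup p) g' → ∀ i, torusExp m i ≤ torusExp m' i := by
    intro g g' m m' hg hg' h i
    have h1 := (hg'.mul hg.inv).2 i
    have h2 := (coset_eq_iff.1 h).1 i i
    change (g' * g⁻¹).1.val i i ∈ _ at h2
    rw [h1, pzpow_mem_gaussIntegers_iff, torusExp_add, torusExp_neg] at h2
    linarith
  exact torusExp_injective (funext fun i => le_antisymm (key hg hg' h i) (key hg' hg h.symm i))

theorem HasExponents.unique {c : Cosets (modularGroup p)} {m m' : Fin 3 → ℤ}
    (h : HasExponents p c m) (h' : HasExponents p c m') : m = m' := by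
  obtain ⟨g, hg, rfl⟩ := h.exists_hasDiag
  obtain ⟨g', hg', e⟩ := h'.exists_hasDiag
  exact hg.eq_of_coset_eq hg' e

/-- A triangular element can be normalised to have powers of `p` on the diagonal. -/
theorem IsBorel.exists_hasDiag (hp : Prime (p : GaussianInt)) {g : simGroup p} (hg : IsBorel g) :
    ∃ γ ∈ modularGroup p, ∃ m, HasDiag (γ * g) m ∧
      (∃ ε ∈ gaussIntegers, g.1 3 3 = pzpow p (m 2) * ε) ∧
      ∃ ε ∈ gaussIntegers, g.1 2 2 = pzpow p (m 1) * ε := by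
  have hu (i : Fin 4) : g.1 i i * (g⁻¹).1 i i = 1 := by
    rw [← hg.mul_diag hg.inv, mul_inv_cancel, simGroup_val_one, Matrix.one_apply_eq]
  obtain ⟨e₁, ε₁, h1, n1, d1⟩ := isUnit_away hp (g.2.1 2 2) ((g⁻¹).2.1 2 2) (hu 2)
  obtain ⟨e₂, ε₂, h2, n2, d2⟩ := isUnit_away hp (g.2.1 3 3) ((g⁻¹).2.1 3 3) (hu 3)
  obtain ⟨d, hd⟩ := exists_similitude g
  obtain ⟨γ, hγ, eγ⟩ := exists_modular (p := p)
    (M := !![star ε₁, 0, 0, 0; 0, star ε₂, 0, 0; 0, 0, star ε₁, 0; 0, 0, 0, star ε₂])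
    (forall_fin_four_mem (by simp [zero_mem, star_mem_gaussIntegers, h1])
      (by simp [zero_mem, star_mem_gaussIntegers, h2])
      (by simp [zero_mem, star_mem_gaussIntegers, h1])
      (by simp [zero_mem, star_mem_gaussIntegers, h2])) (by
      ext i j : 1
      rw [conj_matJ_apply]
      fin_cases i <;> fin_cases j <;> simp [matJ] <;>
        first | linear_combination n1 | linear_combination n2)
  have hγB : IsBorel γ := by
    refine ⟨?_, ?_, ?_, ?_, ?_, ?_⟩ <;> rw [eγ] <;> simp
  obtain ⟨a1, a2, a3, a4, a5, a6⟩ := hg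
  -- The row relations pair the diagonal entries 2 and 0, and 3 and 1. Paired entries share the same
  -- unit, so one diagonal element of Γ₂ normalises all four.
  have r0 := row_relation g hd 2 0
  have r1 := row_relation g hd 3 1
  simp [a1, a2, a3, a4, a5, a6, matJ] at r0 r1
  rw [d1] at r0
  rw [d2] at r1
  have hz (e : ℤ) : pzpow p (d - e) * pzpow p e = pzpow p d := by
    rw [← pzpow_add, sub_add_cancel]
  have s0 : g.1 0 0 = pzpow p (d - e₁) * ε₁ := by
    have h := congrArg star r0
    simp [star_pzpow] at h
    apply mul_left_cancel₀ (pzpow_ne_zero (p := p) e₁)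
    have hz := hz e₁
    linear_combination ε₁ * h - ε₁ * hz - pzpow p e₁ * g.1 0 0 * n1
  have s1 : g.1 1 1 = pzpow p (d - e₂) * ε₂ := by
    have h := congrArg star r1
    simp [star_pzpow] at h
    apply mul_left_cancel₀ (pzpow_ne_zero (p := p) e₂)
    have hz := hz e₂
    linear_combination ε₂ * h - ε₂ * hz - pzpow p e₂ * g.1 1 1 * n2
  refine ⟨γ, hγ, ![d, e₁, e₂], ⟨hγB.mul ⟨a1, a2, a3, a4, a5, a6⟩, fun i => ?_⟩,
    ⟨ε₂, h2, d2⟩, ε₁, h1, d1⟩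
  rw [hγB.mul_diag ⟨a1, a2, a3, a4, a5, a6⟩, eγ]
  fin_cases i <;> simp [torusExp]
  · rw [s0]; linear_combination pzpow p (d - e₁) * n1
  · rw [s1]; linear_combination pzpow p (d - e₂) * n2
  · rw [d1]; linear_combination pzpow p e₁ * n1
  · rw [d2]; linear_combination pzpow p e₂ * n2

theorem exists_hasDiag_mul (hp : Prime (p : GaussianInt)) (g : simGroup p) :
    ∃ γ ∈ modularGroup p, ∃ m, HasDiag (γ * g) m := by
  obtain ⟨γ, hγ, h⟩ := exists_isBorel_mul g
  obtain ⟨δ, hδ, m, hm, -⟩ := h.exists_hasDiag hp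
  exact ⟨δ * γ, mul_mem hδ hγ, m, by rwa [mul_assoc]⟩

theorem exists_hasDiag_coset (hp : Prime (p : GaussianInt)) (c : Cosets (modularGroup p)) :
    ∃ g m, HasDiag g m ∧ c = coset (modularGroup p) g := by
  obtain ⟨x, rfl⟩ := exists_coset_eq c
  obtain ⟨γ, hγ, m, hm⟩ := exists_hasDiag_mul hp x
  exact ⟨_, m, hm, (coset_mul_left hγ x).symm⟩

end BorelCosets

/-! ### The Satake map: multiplicativity and injectivity -/

section Satake

variable {p : ℕ}

/-- The monomial `x₀ ^ m₀ (x₁ p⁻²) ^ m₁ (x₂ p⁻⁴) ^ m₂`. -/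
def satakeMonomial (p : ℕ) (m : Fin 3 → ℤ) : LaurentRing :=
  AddMonoidAlgebra.single m ((((p : ℚ) ^ 2) ^ (-1 : ℤ)) ^ (m 1) * (((p : ℚ) ^ 2) ^ (-2 : ℤ)) ^ (m 2))

theorem satakeMonomial_zero : satakeMonomial p 0 = 1 := by
  rw [satakeMonomial, AddMonoidAlgebra.one_def]
  simp

variable [Fact p.Prime]

theorem satakeMonomial_add (m m' : Fin 3 → ℤ) :
    satakeMonomial p (m + m') = satakeMonomial p m * satakeMonomial p m' := by
  have hp := cast_p_ne_zero p
  have h1 : ((p : ℚ) ^ 2) ^ (-1 : ℤ) ≠ 0 := zpow_ne_zero _ (pow_ne_zero _ hp)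
  have h2 : ((p : ℚ) ^ 2) ^ (-2 : ℤ) ≠ 0 := zpow_ne_zero _ (pow_ne_zero _ hp)
  rw [satakeMonomial, satakeMonomial, satakeMonomial, AddMonoidAlgebra.single_mul_single]
  congr 1
  rw [Pi.add_apply, Pi.add_apply, zpow_add₀ h1, zpow_add₀ h2]
  ring

theorem HasExponents.satakeCoset_eq {c : Cosets (modularGroup p)} {m : Fin 3 → ℤ}
    (h : HasExponents p c m) : satakeCoset p c = satakeMonomial p m := by
  have hex : ∃ m, HasExponents p c m := ⟨m, h⟩
  rw [satakeCoset, dif_pos hex, hex.choose_spec.unique h, satakeMonomial]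

theorem HasDiag.satakeCoset_eq {g : simGroup p} {m : Fin 3 → ℤ} (h : HasDiag g m) :
    satakeCoset p (coset (modularGroup p) g) = satakeMonomial p m :=
  h.hasExponents.satakeCoset_eq

/-- The Satake map on all formal sums of cosets. -/
def satakeSum (p : ℕ) [Fact p.Prime] : (Cosets (modularGroup p) →₀ ℚ) →ₗ[ℚ] LaurentRing :=
  Finsupp.linearCombination ℚ (satakeCoset p)

theorem satake_apply (v : Hecke2 p) : satake p v = satakeSum p (HeckeAlgebra.toSum v) := rfl

theorem satakeSum_single (c : Cosets (modularGroup p)) (a : ℚ) :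
    satakeSum p (Finsupp.single c a) = a • satakeCoset p c :=
  Finsupp.linearCombination_single _ _ _

/-- Diagonals of triangular matrices multiply, so exponents add. As each coset has a triangular
representative, this already yields the multiplicativity of Φ. -/
theorem satakeSum_rightMul (hp : Prime (p : GaussianInt)) {h : simGroup p} {m : Fin 3 → ℤ}
    (hm : HasDiag h m) (x : Cosets (modularGroup p) →₀ ℚ) :
    satakeSum p (rightMul h x) = satakeSum p x * satakeMonomial p m := by
  have key : satakeSum p ∘ₗ rightMul h =
      LinearMap.mulRight ℚ (satakeMonomial p m) ∘ₗ satakeSum p := by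
    refine Finsupp.lhom_ext' fun c => LinearMap.ext_ring ?_
    obtain ⟨g, m', hg, rfl⟩ := exists_hasDiag_coset hp c
    simp only [LinearMap.comp_apply, Finsupp.lsingle_apply, rightMul_single, satakeSum_single,
      one_smul, LinearMap.mulRight_apply, hg.satakeCoset_eq, (hg.mul hm).satakeCoset_eq,
      satakeMonomial_add]
  exact LinearMap.congr_fun key x

theorem satakeSum_mulLeft (hp : Prime (p : GaussianInt)) (v : Hecke2 p)
    (x : Cosets (modularGroup p) →₀ ℚ) :
    satakeSum p (HeckeAlgebra.mulLeft v x) = satake p v * satakeSum p x := by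
  have key : satakeSum p ∘ₗ HeckeAlgebra.mulLeft v =
      LinearMap.mulLeft ℚ (satake p v) ∘ₗ satakeSum p := by
    refine Finsupp.lhom_ext' fun c => LinearMap.ext_ring ?_
    obtain ⟨g, m', hg, rfl⟩ := exists_hasDiag_coset hp c
    simp only [LinearMap.comp_apply, Finsupp.lsingle_apply, HeckeAlgebra.mulLeft_single,
      satakeSum_single, one_smul, LinearMap.mulLeft_apply, hg.satakeCoset_eq,
      satakeSum_rightMul hp hg, satake_apply]
  exact LinearMap.congr_fun key x

theorem satake_mul (hp : Prime (p : GaussianInt)) (v w : Hecke2 p) :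
    satake p (v * w) = satake p v * satake p w :=
  satakeSum_mulLeft hp v _

theorem satake_one : satake p (1 : Hecke2 p) = 1 := by
  rw [satake_apply, HeckeAlgebra.toSum_one, satakeSum_single, one_smul, ← tor_zero,
    (hasDiag_tor 0).satakeCoset_eq, satakeMonomial_zero]

/-- Any row can be moved to the bottom within Γ₂, up to the sign σ. This lets a bound on last rows
control every entry of a matrix. -/
theorem exists_weyl_row (i : Fin 4) : ∃ w ∈ modularGroup p, ∃ σ ∈ gaussIntegers, σ * σ = 1 ∧
    ∀ (g : simGroup p) (j : Fin 4), (w * g).1 3 j = σ * g.1 i j := by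
  obtain ⟨x, hx, ex⟩ := exists_sl2_one_three (p := p) (a := 0) (b := 1) (c := -1) (d := 0)
    (by norm_num)
  obtain ⟨y, hy, ey⟩ := exists_levi (p := p) (α := 0) (β := 1) (γ := -1) (δ := 0)
    (zero_mem _) (one_mem _) (neg_mem (one_mem _)) (zero_mem _) (by norm_num)
  have h1 : (-1 : GaussField) ∈ gaussIntegers := neg_mem (one_mem _)
  have hxr (g : simGroup p) (j : Fin 4) : (x * g).1 3 j = -1 * g.1 1 j := by
    rw [simGroup_val_mul, Matrix.mul_apply, Fin.sum_univ_four, ex]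
    simp
  fin_cases i
  · refine ⟨x * y, mul_mem hx hy, 1, one_mem _, by norm_num, fun g j => ?_⟩
    rw [mul_assoc, hxr, simGroup_val_mul, Matrix.mul_apply, Fin.sum_univ_four, ey]
    simp
  · exact ⟨x, hx, -1, h1, by norm_num, hxr⟩
  · refine ⟨y, hy, -1, h1, by norm_num, fun g j => ?_⟩
    rw [simGroup_val_mul, Matrix.mul_apply, Fin.sum_univ_four, ey]
    simp
  · exact ⟨1, one_mem _, 1, one_mem _, by norm_num, fun g j => by simp⟩

/-- A coset whose exponents are minimal in a bi-invariant set is the coset of a torus element. -/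
theorem coset_eq_tor_of_minimal (hp : Prime (p : GaussianInt)) {S : simGroup p → Prop}
    (hl : ∀ g, ∀ γ ∈ modularGroup p, S g → S (γ * g))
    (hr : ∀ g, ∀ γ ∈ modularGroup p, S g → S (g * γ)) {m : Fin 3 → ℤ}
    (hmin : ∀ g m', HasDiag g m' → S g → m 2 < m' 2 ∨ (m 2 = m' 2 ∧ m 1 ≤ m' 1))
    {g : simGroup p} (hg : HasDiag g m) (hS : S g) :
    coset (modularGroup p) g = coset (modularGroup p) (tor p m) := by
  -- Move row i to the bottom and turn it into (0, 0, 0, *) by right multiplication with Γ₂.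
  -- Minimality bounds the exponent of * below by m 2, and the row is * times an integral row.
  have int (i j : Fin 4) : pzpow p (-m 2) * g.1 i j ∈ gaussIntegers := by
    obtain ⟨w, hw, σ, hσ, hσ2, hrow⟩ := exists_weyl_row (p := p) i
    obtain ⟨γ, hγ, h0, h1, h2⟩ := exists_mul_last_row (w * g)
    obtain ⟨δ, hδ, hB, h3, -⟩ := exists_mul_isBorel_of_last_row h0 h1 h2 rfl rfl
    obtain ⟨η, hη, m', hm', ⟨ε, hε, e⟩, -⟩ := hB.exists_hasDiag hp
    have hS' := hl _ η hη (hr _ δ hδ (hr _ γ hγ (hl _ w hw hS)))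
    have hle : m 2 ≤ m' 2 := by rcases hmin _ _ hm' hS' with h | h <;> omega
    have h4 : (w * g).1 3 j = (w * g * γ).1 3 3 * (γ⁻¹).1 3 j := by
      have : w * g = w * g * γ * γ⁻¹ := by group
      conv_lhs => rw [this, simGroup_val_mul, Matrix.mul_apply, Fin.sum_univ_four, h0, h1, h2]
      ring
    have h5 : g.1 i j = σ * (pzpow p (m' 2) * ε * (γ⁻¹).1 3 j) := by
      rw [← e, h3, ← h4, hrow, ← mul_assoc, hσ2, one_mul]
    rw [h5]
    have h6 : pzpow p (-m 2) * (σ * (pzpow p (m' 2) * ε * (γ⁻¹).1 3 j)) =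
        pzpow p (m' 2 - m 2) * (σ * ε * (γ⁻¹).1 3 j) := by
      rw [show m' 2 - m 2 = -m 2 + m' 2 by ring, pzpow_add]; ring
    rw [h6]
    exact mul_mem (pzpow_mem_gaussIntegers_iff.2 (by omega))
      (mul_mem (mul_mem hσ hε) ((inv_mem hγ).1 3 j))
  have hn := hg.mul (hasDiag_tor m).inv
  rw [add_neg_cancel] at hn
  obtain ⟨u, z, s, w, H, e⟩ := exists_eq_uni hn
  have hg' : g = uni H * tor p m := by rw [← e]; group
  have col (i : Fin 4) : uniMatrix u z s w i 3 ∈ gaussIntegers := by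
    have := int i 3
    rw [hg', mul_tor_apply, uni_val] at this
    have h3 : torusExp m 3 = m 2 := rfl
    rwa [h3, mul_comm, mul_assoc, ← pzpow_add, add_neg_cancel, pzpow_zero, mul_one] at this
  have hu : u ∈ gaussIntegers := by simpa [uniMatrix] using col 2
  have hz : (s : GaussField) * u + z ∈ gaussIntegers := by simpa [uniMatrix] using col 0
  have hw : star z * u + w ∈ gaussIntegers := by simpa [uniMatrix] using col 1
  have H0 : ParamsMem (gaussIntegersAway p) 0 0 s 0 :=
    ⟨zero_mem _, zero_mem _, H.2.2.1, by simp [zero_mem]⟩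
  -- Integrality of the last column allows everything but s to be split off on the left by an
  -- element of Γ₂. These parameters solve `uniMatrix_mul` with second factor (0, 0, s, 0).
  have Hγ : ParamsMem gaussIntegers u (z + u * s) 0 (w - (u.re ^ 2 + u.im ^ 2) * s) := by
    refine ⟨hu, by rwa [add_comm, mul_comm], by simp [zero_mem], ?_⟩
    have h1 : ((w - (u.re ^ 2 + u.im ^ 2) * s : ℚ) : GaussField) =
        star z * u + w - star (s * u + z) * u := by
      rw [Rat.cast_sub, Rat.cast_mul (_ + _), ratCast_norm_sq]
      simp
      ring
    rw [h1]
    exact sub_mem hw (mul_mem (star_mem_gaussIntegers hz) hu)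
  have hfac : uni H = uni (p := p) Hγ.away * uni H0 := simGroup_ext fun i j => by
    rw [simGroup_val_mul, uni_val, uni_val, uni_val, uniMatrix_mul]
    simp
  have hg₁ : coset (modularGroup p) g = coset (modularGroup p) (uni H0 * tor p m) := by
    rw [hg', hfac, mul_assoc, coset_mul_left ((uni_mem_modularGroup_iff _).2 Hγ)]
  have hS₁ : S (uni H0 * tor p m) := by
    have : uni H0 * tor p m = (uni (p := p) Hγ.away)⁻¹ * g := by rw [hg', hfac]; group
    rw [this]
    exact hl _ _ (inv_mem ((uni_mem_modularGroup_iff _).2 Hγ)) hS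
  -- Exchanging rows 0 and 2 keeps the last row and puts s·p^(m 1), up to sign, into position (2,2).
  -- After triangularisation the last exponent is at most m 2, so the second clause of minimality
  -- applies: m 1 ≤ m' 1. But s·p^(m 1) is an integral multiple of p^(m' 1).
  have hs : (s : GaussField) ∈ gaussIntegers := by
    obtain ⟨x, hx, ex⟩ := exists_sl2_zero_two (p := p) (a := 0) (b := 1) (c := -1) (d := 0)
      (by norm_num)
    have r3 (j : Fin 4) : (x * (uni H0 * tor p m)).1 3 j = (uni H0 * tor p m).1 3 j := by
      rw [simGroup_val_mul x, Matrix.mul_apply, Fin.sum_univ_four, ex]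
      simp
    have r2 (j : Fin 4) : (x * (uni H0 * tor p m)).1 2 j = -(uni H0 * tor p m).1 0 j := by
      rw [simGroup_val_mul x, Matrix.mul_apply, Fin.sum_univ_four, ex]
      simp
    have e0 : (x * (uni H0 * tor p m)).1 3 0 = 0 := by
      rw [r3, mul_tor_apply, uni_val]; simp [uniMatrix]
    have e1 : (x * (uni H0 * tor p m)).1 3 1 = 0 := by
      rw [r3, mul_tor_apply, uni_val]; simp [uniMatrix]
    have e2 : (x * (uni H0 * tor p m)).1 3 2 = 0 := by
      rw [r3, mul_tor_apply, uni_val]; simp [uniMatrix]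
    obtain ⟨γ, hγ, hB, h3, -, b, -, h4⟩ := exists_mul_isBorel_of_last_row e0 e1 e2 rfl rfl
    obtain ⟨η, hη, m', hm', ⟨ε, hε, f3⟩, ⟨ε', hε', f2⟩⟩ := hB.exists_hasDiag hp
    have hmin' := hmin _ _ hm' (hl _ η hη (hr _ γ hγ (hl _ x hx hS₁)))
    rw [h3, r3, mul_tor_apply, uni_val] at f3
    rw [r2, mul_tor_apply, uni_val, f2] at h4
    have t3 : torusExp m 3 = m 2 := rfl
    have t2 : torusExp m 2 = m 1 := rfl
    simp [uniMatrix, t3] at f3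
    simp [uniMatrix, t2] at h4
    have hle : m' 2 ≤ m 2 := by
      have : ε = pzpow p (m 2 - m' 2) := by
        apply mul_left_cancel₀ (pzpow_ne_zero (p := p) (m' 2))
        rw [← f3, ← pzpow_add, add_sub_cancel]
      rw [this, pzpow_mem_gaussIntegers_iff] at hε
      omega
    have hle' : m 1 ≤ m' 1 := by omega
    have hs' : (s : GaussField) = pzpow p (m' 1 - m 1) * (-(ε' * b)) := by
      apply mul_right_cancel₀ (pzpow_ne_zero (p := p) (m 1))
      have : pzpow p (m' 1 - m 1) * pzpow p (m 1) = pzpow p (m' 1) := by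
        rw [← pzpow_add, sub_add_cancel]
      linear_combination -h4 + ε' * b * this
    rw [hs']
    exact mul_mem (pzpow_mem_gaussIntegers_iff.2 (by omega))
      (neg_mem (mul_mem hε' (intCast_mem _ b)))
  rw [hg₁, coset_mul_left]
  exact (uni_mem_modularGroup_iff _).2 ⟨zero_mem _, zero_mem _, hs, by simp [zero_mem]⟩

/-- In the support of a nonzero v choose a coset for which (m₂, m₁) is lexicographically minimal. By
`coset_eq_tor_of_minimal` it is the only coset of the support with its exponents, so its monomial
survives in Φ(v). -/
theorem satake_injective (hp : Prime (p : GaussianInt)) : Function.Injective (satake p) := by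
  rw [injective_iff_map_eq_zero]
  intro v hv
  by_contra hne
  have hsupp : (HeckeAlgebra.toSum v).support.Nonempty := by
    rw [Finsupp.support_nonempty_iff]
    exact fun h => hne (HeckeAlgebra.toSum_injective (by rw [h, map_zero]))
  have hex : ∀ c : Cosets (modularGroup p), ∃ m, HasExponents p c m := fun c => by
    obtain ⟨g, m, hg, rfl⟩ := exists_hasDiag_coset hp c
    exact ⟨m, hg.hasExponents⟩
  choose e he using hex
  obtain ⟨c₀, hc₀, hmin⟩ := Finset.exists_min_image _ (fun c => toLex (e c 2, e c 1)) hsupp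
  have hmin' : ∀ g m', HasDiag g m' → HeckeAlgebra.coeff v g ≠ 0 →
      e c₀ 2 < m' 2 ∨ (e c₀ 2 = m' 2 ∧ e c₀ 1 ≤ m' 1) := by
    intro g m' hg h
    have := hmin _ (Finsupp.mem_support_iff.2 h)
    rw [(he _).unique hg.hasExponents, Prod.Lex.le_iff] at this
    exact this
  have huniq : ∀ c ∈ (HeckeAlgebra.toSum v).support, e c = e c₀ → c = c₀ := by
    have key : ∀ c ∈ (HeckeAlgebra.toSum v).support, e c = e c₀ →
        c = coset (modularGroup p) (tor p (e c₀)) := by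
      intro c hc h
      obtain ⟨g, hg, hgc⟩ := (he c).exists_hasDiag
      rw [h] at hg
      rw [hgc]
      refine coset_eq_tor_of_minimal hp (S := fun g => HeckeAlgebra.coeff v g ≠ 0)
        (fun g γ hγ h => by rwa [HeckeAlgebra.coeff_mul_left v hγ])
        (fun g γ hγ h => by rwa [HeckeAlgebra.coeff_mul_right v hγ]) hmin' hg ?_
      rw [hgc, Finsupp.mem_support_iff] at hc
      exact hc
    intro c hc h
    exact (key c hc h).trans (key c₀ hc₀ rfl).symm
  have hcoef : (satake p v).coeff (e c₀) = 0 := by rw [hv]; rfl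
  rw [satake_apply, satakeSum, Finsupp.linearCombination_apply, Finsupp.sum,
    AddMonoidAlgebra.coeff_sum, Finsupp.finsetSum_apply, Finset.sum_eq_single_of_mem c₀ hc₀,
    AddMonoidAlgebra.coeff_smul_apply, (he c₀).satakeCoset_eq, satakeMonomial,
    AddMonoidAlgebra.coeff_single, Finsupp.single_eq_same, smul_eq_mul] at hcoef
  · have hp0 := cast_p_ne_zero p
    refine absurd hcoef (mul_ne_zero (Finsupp.mem_support_iff.1 hc₀) (mul_ne_zero ?_ ?_)) <;>
      exact zpow_ne_zero _ (zpow_ne_zero _ (pow_ne_zero _ hp0))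
  · intro c hc hcne
    rw [AddMonoidAlgebra.coeff_smul_apply, (he c).satakeCoset_eq, satakeMonomial,
      AddMonoidAlgebra.coeff_single, Finsupp.single_eq_of_ne, smul_zero]
    exact fun h => hcne (huniq c hc h.symm)

end Satake

/-! ### Elements of the Hecke ring as sums over indexed families of cosets -/

section SumOfCosets

variable {G : Type*} [Group G] {Γ : Subgroup G}

namespace HeckeAlgebra

/-- `v` is the sum of the cosets `Γ e(i)`. -/
def IsSumOf {ι : Type*} [Fintype ι] (v : HeckeAlgebra Γ) (e : ι → G) : Prop :=
  toSum v = ∑ i, Finsupp.single (coset Γ (e i)) 1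

variable {ι κ : Type*} [Fintype ι] [Fintype κ]

open Classical in
theorem isSumOf_of_coeff {v : HeckeAlgebra Γ} {e : ι → G}
    (he : Function.Injective fun i => coset Γ (e i))
    (h : ∀ g, coeff v g = if ∃ i, coset Γ g = coset Γ (e i) then 1 else 0) : IsSumOf v e := by
  refine Finsupp.ext fun c => ?_
  obtain ⟨g, rfl⟩ := exists_coset_eq c
  rw [Finsupp.finsetSum_apply]
  refine (h g).trans ?_
  split_ifs with hex
  · obtain ⟨i, hi⟩ := hex
    rw [hi, Finset.sum_eq_single i, Finsupp.single_eq_same]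
    · intro j _ hj
      exact Finsupp.single_eq_of_ne fun h => hj (he h.symm)
    · simp
  · refine (Finset.sum_eq_zero fun i _ => ?_).symm
    exact Finsupp.single_eq_of_ne fun h => hex ⟨i, h⟩

theorem isSumOf_doubleCoset [IsHeckePair Γ] {h : G} {e : ι → G}
    (he : Function.Injective fun i => coset Γ (e i))
    (hmem : ∀ i, coset Γ (e i) ∈ cosetsIn Γ h)
    (hsurj : ∀ g, coset Γ g ∈ cosetsIn Γ h → ∃ i, coset Γ g = coset Γ (e i)) :
    IsSumOf (doubleCoset Γ h) e := by
  classical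
  refine isSumOf_of_coeff he fun g => ?_
  rw [coeff_doubleCoset]
  refine if_congr ⟨hsurj g, ?_⟩ rfl rfl
  rintro ⟨i, hi⟩
  rw [hi]
  exact hmem i

theorem IsSumOf.deg_eq {v : HeckeAlgebra Γ} {e : ι → G} (h : IsSumOf v e) :
    deg v = Nat.card ι := by
  have : deg v = sumCoeffs (toSum v) := rfl
  rw [this, h, map_sum]
  simp [sumCoeffs_single]

theorem IsSumOf.add {v w : HeckeAlgebra Γ} {e : ι → G} {f : κ → G} (hv : IsSumOf v e)
    (hw : IsSumOf w f) : IsSumOf (v + w) (Sum.elim e f) := by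
  rw [IsSumOf, map_add, hv, hw, Fintype.sum_sum_type]
  rfl

theorem IsSumOf.eq {v w : HeckeAlgebra Γ} {e : ι → G} (hv : IsSumOf v e) (hw : IsSumOf w e) :
    v = w :=
  toSum_injective (hv.trans hw.symm)

theorem IsSumOf.heckeEmbedding {S₀ : Subgroup G} {v : HeckeAlgebra Γ} {e : ι → S₀}
    (h : IsSumOf v fun i => (e i : G)) : IsSumOf (heckeEmbedding Γ S₀ v) e := by
  classical
  refine Finsupp.ext fun c => ?_
  obtain ⟨g, rfl⟩ := exists_coset_eq c
  refine (DFunLike.congr_fun h (coset Γ (g : G))).trans ?_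
  rw [Finsupp.finsetSum_apply, Finsupp.finsetSum_apply]
  refine Finset.sum_congr rfl fun i _ => ?_
  rw [Finsupp.single_apply, Finsupp.single_apply]
  refine if_congr ?_ rfl rfl
  rw [← cosetInclusion_coset, ← cosetInclusion_coset]
  exact (cosetInclusion_injective Γ S₀).eq_iff

end HeckeAlgebra

end SumOfCosets

/-! ### Unique reduced representatives of cosets -/

section ReducedParameters

/-- The rational numbers in `[0, 1)` with denominator dividing `n`. -/
def UnitFrac (n : ℕ) : Type := {x : ℚ // (0 ≤ x ∧ x < 1) ∧ ∃ a : ℤ, n * x = a}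

/-- The elements of `ℚ(i)` with both coordinates in `[0, 1)`, with denominator dividing `n`. -/
def GaussUnitFrac (n : ℕ) : Type :=
  {x : GaussField // ((0 ≤ x.re ∧ x.re < 1) ∧ 0 ≤ x.im ∧ x.im < 1) ∧ (n : GaussField) * x ∈ gaussIntegers}

/-- The equivalence between `{0, …, n - 1}` and the fractions `i / n`. -/
def unitFracEquiv (n : ℕ) [NeZero n] : Fin n ≃ UnitFrac n := by
  have hn : (0 : ℚ) < n := Nat.cast_pos.2 (NeZero.pos n)
  refine Equiv.ofBijective (fun i => ⟨(i : ℕ) / n, ⟨by positivity, ?_⟩, (i : ℕ), ?_⟩) ⟨?_, ?_⟩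
  · rw [div_lt_one hn]
    exact_mod_cast i.2
  · field_simp
    simp
  · intro i j h
    have h1 := congrArg Subtype.val h
    simp only at h1
    rw [div_left_inj' hn.ne'] at h1
    exact Fin.ext (by exact_mod_cast h1)
  · rintro ⟨x, ⟨h0, h1⟩, a, ha⟩
    have ha0 : 0 ≤ a := by
      have : (0 : ℚ) ≤ a := by rw [← ha]; positivity
      exact_mod_cast this
    obtain ⟨k, rfl⟩ := Int.eq_ofNat_of_zero_le ha0
    have hk : k < n := by
      have : (k : ℚ) < n := by
        have : ((k : ℤ) : ℚ) < n := by rw [← ha]; nlinarith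
        exact_mod_cast this
      exact_mod_cast this
    refine ⟨⟨k, hk⟩, Subtype.ext ?_⟩
    simp only
    rw [div_eq_iff hn.ne', mul_comm, ha]
    simp

theorem unitFracEquiv_val (n : ℕ) [NeZero n] (i : Fin n) :
    (unitFracEquiv n i).1 = (i : ℕ) / n := rfl

/-- A reduced element of `ℚ(i)` is given by its coordinates. -/
def gaussUnitFracEquiv (n : ℕ) : GaussUnitFrac n ≃ UnitFrac n × UnitFrac n where
  toFun x := (⟨x.1.re, x.2.1.1, by
      have := (mem_gaussIntegers_iff.1 x.2.2).1
      simpa using this⟩, ⟨x.1.im, x.2.1.2, by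
      have := (mem_gaussIntegers_iff.1 x.2.2).2
      simpa using this⟩)
  invFun y := ⟨⟨y.1.1, y.2.1⟩, ⟨y.1.2.1, y.2.2.1⟩, mem_gaussIntegers_iff.2
    ⟨by simpa using y.1.2.2, by simpa using y.2.2.2⟩⟩
  left_inv x := rfl
  right_inv y := rfl

instance (n : ℕ) [NeZero n] : Fintype (UnitFrac n) := Fintype.ofEquiv _ (unitFracEquiv n)

instance (n : ℕ) [NeZero n] : Fintype (GaussUnitFrac n) :=
  Fintype.ofEquiv _ (gaussUnitFracEquiv n).symm

theorem card_unitFrac (n : ℕ) [NeZero n] : Fintype.card (UnitFrac n) = n := by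
  rw [← Fintype.card_congr (unitFracEquiv n), Fintype.card_fin]

theorem card_gaussUnitFrac (n : ℕ) [NeZero n] : Fintype.card (GaussUnitFrac n) = n ^ 2 := by
  rw [Fintype.card_congr (gaussUnitFracEquiv n), Fintype.card_prod, card_unitFrac, sq]

/-- All the coordinates of the parameters lie in `[0, 1)`. -/
def ParamsReduced (u z : GaussField) (s w : ℚ) : Prop :=
  ((0 ≤ u.re ∧ u.re < 1) ∧ 0 ≤ u.im ∧ u.im < 1) ∧ ((0 ≤ z.re ∧ z.re < 1) ∧ 0 ≤ z.im ∧ z.im < 1) ∧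
    (0 ≤ s ∧ s < 1) ∧ 0 ≤ w ∧ w < 1

theorem eq_of_reduced {x y : ℚ} (hx : 0 ≤ x ∧ x < 1) (hy : 0 ≤ y ∧ y < 1)
    (h : ∃ a : ℤ, x - y = a) : x = y := by
  obtain ⟨a, ha⟩ := h
  have h1 : (a : ℚ) < 1 := by rw [← ha]; linarith [hx.2, hy.1]
  have h2 : (-1 : ℚ) < a := by rw [← ha]; linarith [hx.1, hy.2]
  have h3 : a < 1 := by exact_mod_cast h1
  have h4 : -1 < a := by exact_mod_cast h2
  have : a = 0 := by omega
  rw [this] at ha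
  simp at ha
  linarith

theorem gauss_eq_of_reduced {x y : GaussField}
    (hx : (0 ≤ x.re ∧ x.re < 1) ∧ 0 ≤ x.im ∧ x.im < 1)
    (hy : (0 ≤ y.re ∧ y.re < 1) ∧ 0 ≤ y.im ∧ y.im < 1) (h : x - y ∈ gaussIntegers) : x = y := by
  have h := mem_gaussIntegers_iff.1 h
  ext
  · exact eq_of_reduced hx.1 hy.1 (by simpa using h.1)
  · exact eq_of_reduced hx.2 hy.2 (by simpa using h.2)

theorem exists_gauss_floor (x : GaussField) : ∃ v ∈ gaussIntegers,
    (0 ≤ (x - v).re ∧ (x - v).re < 1) ∧ 0 ≤ (x - v).im ∧ (x - v).im < 1 := by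
  refine ⟨⟨⌊x.re⌋, ⌊x.im⌋⟩, ⟨_, _, rfl⟩, ?_⟩
  have h (r : ℚ) : 0 ≤ r - ⌊r⌋ ∧ r - ⌊r⌋ < 1 := ⟨Int.fract_nonneg r, Int.fract_lt_one r⟩
  simp only [QuadraticAlgebra.re_sub, QuadraticAlgebra.im_sub]
  exact ⟨h x.re, h x.im⟩

theorem exists_rat_floor (x : ℚ) : ∃ v : ℚ, (v : GaussField) ∈ gaussIntegers ∧
    0 ≤ x - v ∧ x - v < 1 :=
  ⟨⌊x⌋, ratCast_mem_gaussIntegers_iff.2 ⟨_, rfl⟩, Int.fract_nonneg x, Int.fract_lt_one x⟩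

variable {p : ℕ} [Fact p.Prime]

/-- Every coset has a reduced representative. -/
theorem exists_reduced (hp : Prime (p : GaussianInt)) (g : simGroup p) :
    ∃ (m : Fin 3 → ℤ) (u z : GaussField) (s w : ℚ)
      (H : ParamsMem (gaussIntegersAway p) u z s w), ParamsReduced u z s w ∧
      coset (modularGroup p) g = coset (modularGroup p) (uni H * tor p m) := by
  obtain ⟨γ, hγ, m, hm⟩ := exists_hasDiag_mul hp g
  have hn := hm.mul (hasDiag_tor m).inv
  rw [add_neg_cancel] at hn
  obtain ⟨u, z, s, w, H, e⟩ := exists_eq_uni hn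
  -- The order matters: by `uniMatrix_mul`, removing v from u and r from s shifts z by v(s - r), and
  -- w is affected by v, s and the new z. Hence z comes third and w last.
  obtain ⟨v, hv, hu⟩ := exists_gauss_floor u
  obtain ⟨r, hr, hs⟩ := exists_rat_floor s
  obtain ⟨y, hy, hz⟩ := exists_gauss_floor (z + v * ((s - r : ℚ) : GaussField))
  set z' := z + v * ((s - r : ℚ) : GaussField) - y
  obtain ⟨q, hq, hw⟩ := exists_rat_floor
    (w + 2 * (star v * z').re - (v.re ^ 2 + v.im ^ 2) * (s - r))
  set w' := w + 2 * (star v * z').re - (v.re ^ 2 + v.im ^ 2) * (s - r) - q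
  have Hγ : ParamsMem gaussIntegers v y r q := ⟨hv, hy, hr, hq⟩
  have hM : uniMatrix u z s w = uniMatrix v y r q * uniMatrix (u - v) z' (s - r) w' := by
    rw [uniMatrix_mul]
    congr 1 <;> (try simp only [z', w']) <;> ring
  have hM' : uniMatrix (u - v) z' (s - r) w' =
      ((uni (p := p) Hγ.away)⁻¹ * uni H).1.val := by
    have h1 : ((uni (p := p) Hγ.away)⁻¹ * uni (p := p) Hγ.away).1.val = 1 := by
      rw [inv_mul_cancel]; rfl
    rw [simGroup_val_mul, uni_val, hM, ← uni_val (p := p) Hγ.away, ← Matrix.mul_assoc,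
      ← simGroup_val_mul, h1, Matrix.one_mul]
  have H' : ParamsMem (gaussIntegersAway p) (u - v) z' (s - r) w' :=
    paramsMem_of_uniMatrix (fun _ => star_mem_away) fun i j => by
      rw [hM']
      exact ((uni (p := p) Hγ.away)⁻¹ * uni H).2.1 i j
  refine ⟨m, u - v, z', s - r, w', H', ⟨hu, hz, hs, hw⟩, ?_⟩
  have h2 : γ * g = uni H * tor p m := by rw [← e]; group
  have h3 : uni H = uni (p := p) Hγ.away * uni H' :=
    simGroup_ext fun i j => by
      rw [simGroup_val_mul, uni_val, uni_val, uni_val, hM]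
  rw [← coset_mul_left hγ g, h2, h3, mul_assoc,
    coset_mul_left ((uni_mem_modularGroup_iff _).2 Hγ)]

/-- Two representatives of a coset differ on the left by an integral unipotent. It shifts u by v, so
v = 0; after that the other parameters are shifted by integral amounts only. -/
theorem reduced_unique {m m' : Fin 3 → ℤ} {u z u' z' : GaussField} {s w s' w' : ℚ}
    {H : ParamsMem (gaussIntegersAway p) u z s w}
    {H' : ParamsMem (gaussIntegersAway p) u' z' s' w'}
    (hr : ParamsReduced u z s w) (hr' : ParamsReduced u' z' s' w')
    (h : coset (modularGroup p) (uni H * tor p m) = coset (modularGroup p) (uni H' * tor p m')) :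
    m = m' ∧ u = u' ∧ z = z' ∧ s = s' ∧ w = w' := by
  have d1 := (hasDiag_uni H).mul (hasDiag_tor m)
  have d2 := (hasDiag_uni H').mul (hasDiag_tor m')
  have hm := d1.eq_of_coset_eq d2 h
  rw [zero_add, zero_add] at hm
  subst hm
  refine ⟨rfl, ?_⟩
  have hd := (hasDiag_uni H').mul (hasDiag_uni H).inv
  rw [neg_zero, add_zero] at hd
  obtain ⟨v, y, r, q, K, e⟩ := exists_eq_uni hd
  have hK : uni K ∈ modularGroup p := by
    rw [← e]
    have := coset_eq_iff.1 h
    convert this using 1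
    group
  obtain ⟨hv, hy, hr₀, hq⟩ := (uni_mem_modularGroup_iff K).1 hK
  have e' : uni H' = uni K * uni H := by rw [← e]; group
  have hM : uniMatrix u' z' s' w' = uniMatrix v y r q * uniMatrix u z s w := by
    have := congrArg (fun g : simGroup p => g.1.val) e'
    exact this
  rw [uniMatrix_mul] at hM
  obtain ⟨eu, ez, es, ew⟩ := uniMatrix_injective hM
  have hu : u' = u := gauss_eq_of_reduced hr'.1 hr.1 (by rw [eu]; simpa using hv)
  have hv0 : v = 0 := by rw [hu] at eu; simpa using eu.symm
  subst hv0
  simp at ez es ew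
  refine ⟨hu.symm, ?_, ?_, ?_⟩
  · refine (gauss_eq_of_reduced hr'.2.1 hr.2.1 ?_).symm
    rw [ez]; simpa using hy
  · refine (eq_of_reduced hr'.2.2.1 hr.2.2.1 ?_).symm
    rw [es]; simpa using ratCast_mem_gaussIntegers_iff.1 hr₀
  · refine (eq_of_reduced hr'.2.2.2 hr.2.2.2 ?_).symm
    rw [ew]; simpa using ratCast_mem_gaussIntegers_iff.1 hq

end ReducedParameters

/-! ### Double cosets as a relation -/

section Linked

variable {G : Type*} [Group G]

/-- `g` lies in the double coset `B h B`. -/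
def Linked (B : Subgroup G) (g h : G) : Prop := ∃ γ ∈ B, ∃ δ ∈ B, g = γ * h * δ

variable {B C : Subgroup G} {g h k : G}

theorem coset_mem_cosetsIn_iff_linked : coset B g ∈ cosetsIn B h ↔ Linked B g h := mem_cosetsIn_iff

theorem Linked.symm (H : Linked B g h) : Linked B h g := by
  obtain ⟨γ, hγ, δ, hδ, rfl⟩ := H
  exact ⟨γ⁻¹, inv_mem hγ, δ⁻¹, inv_mem hδ, by group⟩

theorem Linked.trans (H : Linked B g h) (K : Linked B h k) : Linked B g k := by
  obtain ⟨γ, hγ, δ, hδ, rfl⟩ := H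
  obtain ⟨α, hα, β, hβ, rfl⟩ := K
  exact ⟨γ * α, mul_mem hγ hα, β * δ, mul_mem hβ hδ, by group⟩

theorem Linked.mono (hBC : B ≤ C) (H : Linked B g h) : Linked C g h := by
  obtain ⟨γ, hγ, δ, hδ, rfl⟩ := H
  exact ⟨γ, hBC hγ, δ, hBC hδ, rfl⟩

theorem Linked.of_coset_eq (H : coset B g = coset B h) : Linked B g h :=
  ⟨g * h⁻¹, coset_eq_iff.1 H.symm, 1, B.one_mem, by group⟩

theorem linked_subgroupOf_iff {S : Subgroup G} {g h : S} :
    Linked (B.subgroupOf S) g h ↔ Linked (B ⊓ S) (g : G) (h : G) := by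
  constructor
  · rintro ⟨γ, hγ, δ, hδ, rfl⟩
    exact ⟨γ, ⟨hγ, γ.2⟩, δ, ⟨hδ, δ.2⟩, rfl⟩
  · rintro ⟨γ, hγ, δ, hδ, e⟩
    exact ⟨⟨γ, hγ.2⟩, hγ.1, ⟨δ, hδ.2⟩, hδ.1, Subtype.ext e⟩

end Linked

/-! ### Elements of the double cosets of torus elements -/

section Membership

theorem rat_eq_zero_of_reduced {x : ℚ} (hx : 0 ≤ x ∧ x < 1) (h : (x : GaussField) ∈ gaussIntegers) :
    x = 0 :=
  eq_of_reduced hx (by norm_num) (by simpa using ratCast_mem_gaussIntegers_iff.1 h)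

theorem gauss_eq_zero_of_reduced {x : GaussField}
    (hx : (0 ≤ x.re ∧ x.re < 1) ∧ 0 ≤ x.im ∧ x.im < 1) (h : x ∈ gaussIntegers) : x = 0 :=
  gauss_eq_of_reduced hx (by simp) (by simpa using h)

variable {p : ℕ} [Fact p.Prime]

/-- The intersection of the modular group and the parabolic subgroup. -/
abbrev parabolicModular (p : ℕ) [Fact p.Prime] : Subgroup (simGroup p) :=
  modularGroup p ⊓ parabolicGroup p

theorem natCast_p_ne_zero : (p : GaussField) ≠ 0 := by
  rw [← pzpow_one]; exact pzpow_ne_zero _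

theorem pzpow_neg_one : pzpow p (-1) = (p : GaussField)⁻¹ :=
  eq_inv_of_mul_eq_one_left (by
    rw [← pzpow_one (p := p), ← pzpow_add, neg_add_cancel, pzpow_zero])

/-- `uni H * tor p m` is in the double coset of `tor p m` when the parameters conjugated by
`tor p m` are integral. -/
theorem linked_uni_mul_tor {u z : GaussField} {s w : ℚ} (H : ParamsMem (gaussIntegersAway p) u z s w)
    {m : Fin 3 → ℤ} (hu : pzpow p (m 2 - m 1) * u ∈ gaussIntegers)
    (hz : pzpow p (m 1 + m 2 - m 0) * z ∈ gaussIntegers)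
    (hs : pzpow p (2 * m 1 - m 0) * s ∈ gaussIntegers)
    (hw : pzpow p (2 * m 2 - m 0) * w ∈ gaussIntegers) :
    Linked (parabolicModular p) (uni H * tor p m) (tor p m) := by
  have cs : (((p : ℚ) ^ (2 * m 1 - m 0) * s : ℚ) : GaussField) = pzpow p (2 * m 1 - m 0) * s := by
    push_cast [pzpow]; rfl
  have cw : (((p : ℚ) ^ (2 * m 2 - m 0) * w : ℚ) : GaussField) = pzpow p (2 * m 2 - m 0) * w := by
    push_cast [pzpow]; rfl
  have K : ParamsMem gaussIntegers (pzpow p (m 2 - m 1) * u) (pzpow p (m 1 + m 2 - m 0) * z)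
      ((p : ℚ) ^ (2 * m 1 - m 0) * s) ((p : ℚ) ^ (2 * m 2 - m 0) * w) :=
    ⟨hu, hz, by rwa [cs], by rwa [cw]⟩
  refine ⟨1, one_mem _, uni (p := p) K.away, ⟨(uni_mem_modularGroup_iff _).2 K,
    (hasDiag_uni _).1.mem_parabolicGroup⟩, ?_⟩
  rw [one_mul]
  refine simGroup_ext fun i j => ?_
  rw [mul_tor_apply, tor_mul_apply, uni_val, uni_val]
  have key (a b c : ℤ) (h : a = b + c) : pzpow p a = pzpow p b * pzpow p c := by
    rw [h, pzpow_add]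
  fin_cases i <;> fin_cases j <;> simp only [uniMatrix, torusExp, cs, cw] <;> simp [star_pzpow]
  · linear_combination (s : GaussField) * key (m 1) (m 0 - m 1) (2 * m 1 - m 0) (by ring)
  · have h1 := key (m 1) (m 0 - m 1) (2 * m 1 - m 0) (by ring)
    have h2 := key (m 2) (m 1) (m 2 - m 1) (by ring)
    have h3 := key (m 2) (m 0 - m 1) (m 1 + m 2 - m 0) (by ring)
    linear_combination z * h3 + s * u * h2 + s * u * pzpow p (m 2 - m 1) * h1
  · linear_combination star u * key (m 0 - m 1) (m 0 - m 2) (m 2 - m 1) (by ring)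
  · linear_combination star z * key (m 1) (m 0 - m 2) (m 1 + m 2 - m 0) (by ring)
  · have h1 := key (m 1) (m 0 - m 2) (m 1 + m 2 - m 0) (by ring)
    have h2 := key (m 2) (m 1) (m 2 - m 1) (by ring)
    have h3 := key (m 2) (m 0 - m 2) (2 * m 2 - m 0) (by ring)
    linear_combination (w : GaussField) * h3 + star z * u * h2 +
      star z * u * pzpow p (m 2 - m 1) * h1
  · linear_combination u * key (m 2) (m 1) (m 2 - m 1) (by ring)

/-- This Weyl element does not touch the last row and so belongs to Γ_{1,1}; the two swaps that
follow use elements outside the parabolic subgroup and link within Γ₂ only. -/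
theorem linked_tor_swap_zero_two (d e₁ e₂ : ℤ) :
    Linked (parabolicModular p) (tor p ![d, e₁, e₂]) (tor p ![d, d - e₁, e₂]) := by
  obtain ⟨x, hx, ex⟩ := exists_sl2_zero_two (p := p) (a := 0) (b := 1) (c := -1) (d := 0)
    (by norm_num)
  have hxP : x ∈ parabolicModular p := ⟨hx, by refine ⟨?_, ?_, ?_⟩ <;> simp [ex]⟩
  have : x * tor p ![d, e₁, e₂] = tor p ![d, d - e₁, e₂] * x := simGroup_ext fun i j => by
    rw [mul_tor_apply, tor_mul_apply, ex]
    fin_cases i <;> fin_cases j <;> simp [torusExp]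
  exact ⟨x⁻¹, inv_mem hxP, x, hxP, by rw [mul_assoc, ← this]; group⟩

theorem linked_tor_swap_one_three (d e₁ e₂ : ℤ) :
    Linked (modularGroup p) (tor p ![d, e₁, e₂]) (tor p ![d, e₁, d - e₂]) := by
  obtain ⟨x, hx, ex⟩ := exists_sl2_one_three (p := p) (a := 0) (b := 1) (c := -1) (d := 0)
    (by norm_num)
  have : x * tor p ![d, e₁, e₂] = tor p ![d, e₁, d - e₂] * x := simGroup_ext fun i j => by
    rw [mul_tor_apply, tor_mul_apply, ex]
    fin_cases i <;> fin_cases j <;> simp [torusExp]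
  exact ⟨x⁻¹, inv_mem hx, x, hx, by rw [mul_assoc, ← this]; group⟩

theorem exists_levi_swap : ∃ x ∈ modularGroup p, x.1.val =
    !![0, 1, 0, 0; -1, 0, 0, 0; 0, 0, 0, 1; 0, 0, -1, 0] := by
  obtain ⟨x, hx, ex⟩ := exists_levi (p := p) (α := 0) (β := 1) (γ := -1) (δ := 0)
    (zero_mem _) (one_mem _) (neg_mem (one_mem _)) (zero_mem _) (by norm_num)
  exact ⟨x, hx, by rw [ex]; simp⟩

theorem linked_tor_levi (d e₁ e₂ : ℤ) :
    Linked (modularGroup p) (tor p ![d, e₁, e₂]) (tor p ![d, e₂, e₁]) := by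
  obtain ⟨x, hx, ex⟩ := exists_levi_swap (p := p)
  have : x * tor p ![d, e₁, e₂] = tor p ![d, e₂, e₁] * x := simGroup_ext fun i j => by
    rw [mul_tor_apply, tor_mul_apply, ex]
    fin_cases i <;> fin_cases j <;> simp [torusExp]
  exact ⟨x⁻¹, inv_mem hx, x, hx, by rw [mul_assoc, ← this]; group⟩

theorem linked_uni_levi {s : ℚ} (H : ParamsMem (gaussIntegersAway p) 0 0 0 s)
    (H' : ParamsMem (gaussIntegersAway p) 0 0 s 0) :
    Linked (modularGroup p) (uni H) (uni H') := by
  obtain ⟨x, hx, ex⟩ := exists_levi_swap (p := p)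
  have : x * uni H = uni H' * x := simGroup_ext fun i j => by
    rw [simGroup_val_mul, simGroup_val_mul, uni_val, uni_val, Matrix.mul_apply, Matrix.mul_apply,
      Fin.sum_univ_four, Fin.sum_univ_four, ex]
    fin_cases i <;> fin_cases j <;> simp [uniMatrix]
  exact ⟨x⁻¹, inv_mem hx, x, hx, by rw [mul_assoc, ← this]; group⟩

theorem exists_inverse_mod {x : ℤ} (hx : ¬ (p : ℤ) ∣ x) : ∃ y k : ℤ, x * y = 1 + p * k := by
  have hq := (Nat.prime_iff_prime_int.1 (Fact.out : p.Prime)).irreducible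
  obtain ⟨a, b, h⟩ := hq.coprime_iff_not_dvd.2 hx
  exact ⟨b, -a, by linear_combination h⟩

/-- In coordinates 0 and 2, with xy = 1 + pk, one has (1, x/p; 0, 1)(-k, -x; y, p) = (1, 0; py,
1)·diag(p⁻¹, p). -/
theorem linked_uni_symmetric {s : ℚ} (H : ParamsMem (gaussIntegersAway p) 0 0 s 0) {x : ℤ}
    (hs : p * s = x) (hx : ¬ (p : ℤ) ∣ x) :
    Linked (parabolicModular p) (uni H) (tor p ![0, 1, 0]) := by
  obtain ⟨y, k, h⟩ := exists_inverse_mod hx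
  obtain ⟨α, hα, eα⟩ := exists_sl2_zero_two (p := p) (a := -k) (b := -x) (c := y) (d := p)
    (by linear_combination h)
  obtain ⟨β, hβ, eβ⟩ := exists_sl2_zero_two (p := p) (a := 1) (b := 0) (c := p * y) (d := 1)
    (by norm_num)
  have h' : (x : GaussField) * y = 1 + p * k := by exact_mod_cast h
  have hs' : (p : GaussField) * s = x := by exact_mod_cast congrArg (Rat.cast (K := GaussField)) hs
  have hP := natCast_p_ne_zero (p := p)
  refine ⟨β, ⟨hβ, ?_⟩, α⁻¹, inv_mem ⟨hα, ?_⟩, ?_⟩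
  · refine ⟨?_, ?_, ?_⟩ <;> simp [eβ]
  · refine ⟨?_, ?_, ?_⟩ <;> simp [eα]
  · rw [eq_mul_inv_iff_mul_eq]
    refine simGroup_ext fun i j => ?_
    rw [mul_tor_apply, simGroup_val_mul, uni_val, Matrix.mul_apply, Fin.sum_univ_four, eα, eβ]
    fin_cases i <;> fin_cases j <;>
      simp [uniMatrix, torusExp, pzpow_zero, pzpow_one, pzpow_neg_one]
    · apply mul_left_cancel₀ hP
      rw [mul_inv_cancel₀ hP]
      linear_combination y * hs' + h'
    · linear_combination hs'
    · field_simp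

/-- Completing the square in the Hermitian matrix (s, z; z̄, w): as ps is invertible modulo p there
is an integral v with z - vs integral, and congruence by v leaves s together with integral entries.
The determinant condition is what makes the new lower right entry integral. -/
theorem linked_uni_of_det {z : GaussField} {s w : ℚ} (H : ParamsMem (gaussIntegersAway p) 0 z s w)
    {x : ℤ} (hs : p * s = x) (hx : ¬ (p : ℤ) ∣ x) (hz : p * z ∈ gaussIntegers)
    (hw : (p : GaussField) * w ∈ gaussIntegers)
    (hd : (p : GaussField) * (s * w - star z * z) ∈ gaussIntegers) :
    Linked (parabolicModular p) (uni H) (tor p ![0, 1, 0]) := by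
  obtain ⟨y, k, h⟩ := exists_inverse_mod hx
  have h' : (x : GaussField) * y = 1 + p * k := by exact_mod_cast h
  have hs' : (p : GaussField) * s = x := by exact_mod_cast congrArg (Rat.cast (K := GaussField)) hs
  have hO (n : ℤ) : (n : GaussField) ∈ gaussIntegers := intCast_mem _ n
  set v : GaussField := y * (p * z)
  have hv : v ∈ gaussIntegers := mul_mem (hO _) hz
  have hz1 : z - v * s ∈ gaussIntegers := by
    have : z - v * s = -(k : GaussField) * (p * z) := by
      linear_combination (-(y * z)) * hs' - z * h'
    rw [this]
    exact mul_mem (neg_mem (hO _)) hz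
  set w₁ : ℚ := w - 2 * (star v * z).re + (v.re ^ 2 + v.im ^ 2) * s
  have hw1 : (w₁ : GaussField) ∈ gaussIntegers := by
    have e1 := ratCast_two_mul_re v z
    have e2 := ratCast_norm_sq v
    have : (w₁ : GaussField) = -(k : GaussField) * (p * w) + y * (p * (s * w - star z * z)) +
        y * k * (star (p * z) * (p * z)) := by
      simp only [w₁]
      rw [Rat.cast_add, Rat.cast_sub, e1, Rat.cast_mul (_ + _), e2]
      simp only [v, star_mul', star_intCast, star_natCast]
      linear_combination (-(w * y) + y ^ 2 * p * z * star z) * hs' +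
        (y * p * z * star z - w) * h'
    rw [this]
    exact add_mem (add_mem (mul_mem (neg_mem (hO _)) hw) (mul_mem (hO _) hd))
      (mul_mem (mul_mem (hO _) (hO _)) (mul_mem (star_mem_gaussIntegers hz) hz))
  have K0 : ParamsMem (gaussIntegersAway p) 0 0 s 0 :=
    ⟨zero_mem _, zero_mem _, H.2.2.1, by simp [zero_mem]⟩
  have K1 : ParamsMem gaussIntegers v 0 0 0 := ⟨hv, zero_mem _, by simp [zero_mem], by simp [zero_mem]⟩
  have K2 : ParamsMem gaussIntegers 0 (z - v * s) 0 w₁ :=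
    ⟨zero_mem _, hz1, by simp [zero_mem], hw1⟩
  have mem {u z : GaussField} {s w : ℚ} (K : ParamsMem gaussIntegers u z s w) :
      uni (p := p) K.away ∈ parabolicModular p :=
    ⟨(uni_mem_modularGroup_iff _).2 K, (hasDiag_uni _).1.mem_parabolicGroup⟩
  have e : uni (p := p) K1.away * uni H = uni (p := p) K2.away * uni K0 * uni (p := p) K1.away := by
    refine simGroup_ext fun i j => ?_
    simp only [simGroup_val_mul, uni_val, uniMatrix_mul]
    simp [w₁]
  refine Linked.trans ⟨(uni (p := p) K1.away)⁻¹ * uni (p := p) K2.away,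
    mul_mem (inv_mem (mem K1)) (mem K2), uni (p := p) K1.away, mem K1, ?_⟩
    (linked_uni_symmetric K0 hs hx)
  rw [mul_assoc _ _ (uni K0), mul_assoc, ← e]
  group

end Membership

/-! ### Necessary conditions on exponents and parameters; invariants of double cosets -/

section Classification

variable {p : ℕ} [Fact p.Prime]

/-- `p g` is integral and has rank at most one modulo `p`. -/
def NearRankOne (g : simGroup p) : Prop :=
  (∀ i j, p * g.1 i j ∈ gaussIntegers) ∧
    ∀ i j k l, p * (g.1 i j * g.1 k l - g.1 i l * g.1 k j) ∈ gaussIntegers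

/-- Since `tor p ![0, 1, 0]` is diag(p⁻¹, 1, p, 1), g is p⁻¹ times a column times a row plus an
integral matrix. In 2×2 minors the p⁻² terms cancel. -/
theorem nearRankOne_of_linked {g : simGroup p} (h : Linked (modularGroup p) g (tor p ![0, 1, 0])) :
    NearRankOne g := by
  obtain ⟨γ, hγ, δ, hδ, rfl⟩ := h
  have hp := natCast_mem gaussIntegers p
  have hP := natCast_p_ne_zero (p := p)
  obtain ⟨n, hn, e⟩ : ∃ n : Fin 4 → Fin 4 → GaussField, (∀ i j, n i j ∈ gaussIntegers) ∧
      ∀ i j, (γ * tor p ![0, 1, 0] * δ).1 i j = (p : GaussField)⁻¹ * (γ.1 i 0 * δ.1 0 j) + n i j := by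
    refine ⟨fun i j => γ.1 i 1 * δ.1 1 j + γ.1 i 2 * (p * δ.1 2 j) + γ.1 i 3 * δ.1 3 j,
      fun i j => add_mem (add_mem (mul_mem (hγ.1 i 1) (hδ.1 1 j))
        (mul_mem (hγ.1 i 2) (mul_mem hp (hδ.1 2 j)))) (mul_mem (hγ.1 i 3) (hδ.1 3 j)),
      fun i j => ?_⟩
    rw [simGroup_val_mul, Matrix.mul_apply, Fin.sum_univ_four]
    simp only [mul_tor_apply]
    simp [torusExp, pzpow_zero, pzpow_one, pzpow_neg_one]
    ring
  refine ⟨fun i j => ?_, fun i j k l => ?_⟩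
  · rw [e, mul_add, mul_inv_cancel_left₀ hP]
    exact add_mem (mul_mem (hγ.1 i 0) (hδ.1 0 j)) (mul_mem hp (hn i j))
  · have : (p : GaussField) * ((γ * tor p ![0, 1, 0] * δ).1 i j * (γ * tor p ![0, 1, 0] * δ).1 k l -
        (γ * tor p ![0, 1, 0] * δ).1 i l * (γ * tor p ![0, 1, 0] * δ).1 k j) =
        γ.1 i 0 * δ.1 0 j * n k l + γ.1 k 0 * δ.1 0 l * n i j -
        γ.1 i 0 * δ.1 0 l * n k j - γ.1 k 0 * δ.1 0 j * n i l +
        p * (n i j * n k l - n i l * n k j) := by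
      simp only [e]
      field_simp
      ring
    rw [this]
    have m (i j k l) : γ.1 i 0 * δ.1 0 j * n k l ∈ gaussIntegers :=
      mul_mem (mul_mem (hγ.1 i 0) (hδ.1 0 j)) (hn k l)
    exact add_mem (sub_mem (sub_mem (add_mem (m _ _ _ _) (m _ _ _ _)) (m _ _ _ _)) (m _ _ _ _))
      (mul_mem hp (sub_mem (mul_mem (hn _ _) (hn _ _)) (mul_mem (hn _ _) (hn _ _))))

/-- By triangularity products of two diagonal entries are minors. Four of them together give |e₁| +
|e₂| ≤ 1. -/
theorem NearRankOne.exponents {e₁ e₂ : ℤ} {u z : GaussField} {s w : ℚ}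
    {H : ParamsMem (gaussIntegersAway p) u z s w} (h : NearRankOne (uni H * tor p ![0, e₁, e₂])) :
    (e₁ = 0 ∧ (e₂ = -1 ∨ e₂ = 0 ∨ e₂ = 1)) ∨ (e₂ = 0 ∧ (e₁ = -1 ∨ e₁ = 1)) := by
  have key {e : ℤ} (he : p * pzpow p e ∈ gaussIntegers) : 0 ≤ 1 + e := by
    rwa [← pzpow_one, ← pzpow_add, pzpow_mem_gaussIntegers_iff] at he
  have h1 := h.2 0 0 1 1
  have h2 := h.2 2 2 3 3
  have h3 := h.2 1 1 2 2
  have h4 := h.2 0 0 3 3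
  simp only [mul_tor_apply, uni_val] at h1 h2 h3 h4
  simp [uniMatrix, torusExp, ← pzpow_add] at h1 h2 h3 h4
  have := key h1
  have := key h2
  have := key h3
  have := key h4
  omega

theorem mem_gaussIntegers_of_eq {a b : GaussField} (h : a ∈ gaussIntegers) (e : a = b) :
    b ∈ gaussIntegers := e ▸ h

theorem NearRankOne.params_of_last_neg {u z : GaussField} {s w : ℚ}
    {H : ParamsMem (gaussIntegersAway p) u z s w} (hr : ParamsReduced u z s w)
    (h : NearRankOne (uni H * tor p ![0, 0, -1])) : u = 0 ∧ z = 0 ∧ s = 0 ∧ w = 0 := by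
  have c (x : GaussField) : p * (x * (p : GaussField)⁻¹) = x := by
    rw [mul_comm x, mul_inv_cancel_left₀ natCast_p_ne_zero]
  simp only [NearRankOne, mul_tor_apply, uni_val] at h
  have hu := h.2 1 0 3 3
  have hz := h.2 1 2 3 3
  have hs := h.2 0 2 3 3
  simp [uniMatrix, torusExp, pzpow_zero, pzpow_neg_one, c, star_mem_gaussIntegers_iff]
    at hu hz hs
  obtain rfl := gauss_eq_zero_of_reduced hr.1 hu
  obtain rfl := gauss_eq_zero_of_reduced hr.2.1 hz
  obtain rfl := rat_eq_zero_of_reduced hr.2.2.1 hs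
  have hw := h.1 1 3
  simp [uniMatrix, torusExp, pzpow_neg_one, c] at hw
  exact ⟨rfl, rfl, rfl, rat_eq_zero_of_reduced hr.2.2.2 hw⟩

theorem NearRankOne.params_of_last_pos {u z : GaussField} {s w : ℚ}
    {H : ParamsMem (gaussIntegersAway p) u z s w} (hr : ParamsReduced u z s w)
    (h : NearRankOne (uni H * tor p ![0, 0, 1])) :
    s = 0 ∧ p * u ∈ gaussIntegers ∧ p * z ∈ gaussIntegers ∧
      ((p ^ 2 : ℕ) : GaussField) * w ∈ gaussIntegers := by
  have hP := natCast_p_ne_zero (p := p)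
  simp only [NearRankOne, mul_tor_apply, uni_val] at h
  have hs := h.2 0 2 1 1
  simp [uniMatrix, torusExp, pzpow_zero, pzpow_neg_one] at hs
  have hs := mem_gaussIntegers_of_eq hs (b := s) (by field_simp)
  obtain rfl := rat_eq_zero_of_reduced hr.2.2.1 hs
  have hu := h.2 2 3 1 1
  have hz := h.2 0 3 1 1
  have hw := h.1 1 3
  simp [uniMatrix, torusExp, pzpow_one, pzpow_neg_one, hP] at hu hz hw
  have hu := mem_gaussIntegers_of_eq hu (b := p * u) (by field_simp)
  have hz := mem_gaussIntegers_of_eq hz (b := p * z) (by field_simp)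
  refine ⟨rfl, hu, hz, ?_⟩
  refine mem_gaussIntegers_of_eq (sub_mem hw (mul_mem (star_mem_gaussIntegers hz) hu)) ?_
  push_cast
  simp
  ring

theorem NearRankOne.params_of_first_neg {u z : GaussField} {s w : ℚ}
    {H : ParamsMem (gaussIntegersAway p) u z s w} (hr : ParamsReduced u z s w)
    (h : NearRankOne (uni H * tor p ![0, -1, 0])) :
    z = 0 ∧ s = 0 ∧ w = 0 ∧ p * u ∈ gaussIntegers := by
  have hP := natCast_p_ne_zero (p := p)
  simp only [NearRankOne, mul_tor_apply, uni_val] at h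
  have hz := h.1 1 2
  have hs := h.1 0 2
  have hu := h.1 2 3
  have hw := h.2 1 2 2 3
  simp [uniMatrix, torusExp, pzpow_zero, pzpow_neg_one] at hu hz hs hw
  have hz := mem_gaussIntegers_of_eq hz (b := star z) (by field_simp)
  have hs := mem_gaussIntegers_of_eq hs (b := s) (by field_simp)
  have hw := mem_gaussIntegers_of_eq (neg_mem hw) (b := w) (by field_simp; ring)
  exact ⟨gauss_eq_zero_of_reduced hr.2.1 (star_mem_gaussIntegers_iff.1 hz),
    rat_eq_zero_of_reduced hr.2.2.1 hs, rat_eq_zero_of_reduced hr.2.2.2 hw, hu⟩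

theorem NearRankOne.params_of_first_pos {u z : GaussField} {s w : ℚ}
    {H : ParamsMem (gaussIntegersAway p) u z s w} (hr : ParamsReduced u z s w)
    (h : NearRankOne (uni H * tor p ![0, 1, 0])) :
    u = 0 ∧ w = 0 ∧ ((p ^ 2 : ℕ) : GaussField) * s ∈ gaussIntegers ∧ p * z ∈ gaussIntegers := by
  have hP := natCast_p_ne_zero (p := p)
  simp only [NearRankOne, mul_tor_apply, uni_val] at h
  have hu := h.1 1 0
  simp [uniMatrix, torusExp, pzpow_neg_one] at hu
  have hu := mem_gaussIntegers_of_eq hu (b := star u) (by field_simp)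
  obtain rfl := gauss_eq_zero_of_reduced hr.1 (star_mem_gaussIntegers_iff.1 hu)
  have hz := h.1 0 3
  have hs := h.1 0 2
  have hw := h.2 0 0 1 3
  simp [uniMatrix, torusExp, pzpow_zero, pzpow_one, pzpow_neg_one, hP] at hz hs hw
  refine ⟨rfl, rat_eq_zero_of_reduced hr.2.2.2 hw, ?_, hz⟩
  exact mem_gaussIntegers_of_eq hs (by push_cast; ring)

/-- Here inertness decides the shape of the classification: the numerator of x has norm divisible by
p, so it is divisible by p by `inert_dvd`. -/
theorem eq_zero_of_norm (hp : Prime (p : GaussianInt)) {x : GaussField}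
    (hx : (0 ≤ x.re ∧ x.re < 1) ∧ 0 ≤ x.im ∧ x.im < 1) (h : p * x ∈ gaussIntegers)
    (hn : p * (star x * x) ∈ gaussIntegers) : x = 0 := by
  have hp0 := cast_p_ne_zero p
  obtain ⟨a, b, hab⟩ := h
  have ha : (p : ℚ) * x.re = a := by simpa using congrArg QuadraticAlgebra.re hab
  have hb : (p : ℚ) * x.im = b := by simpa using congrArg QuadraticAlgebra.im hab
  obtain ⟨k, hk⟩ := (mem_gaussIntegers_iff.1 hn).1
  simp at hk
  obtain ⟨⟨a', rfl⟩, b', rfl⟩ := inert_dvd hp (a := a) (b := b) ⟨k, by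
    have : (a : ℚ) ^ 2 + b ^ 2 = p * k := by
      rw [← ha, ← hb, ← hk]; ring
    exact_mod_cast this⟩
  refine gauss_eq_zero_of_reduced hx (mem_gaussIntegers_iff.2 ⟨⟨a', ?_⟩, b', ?_⟩)
  · push_cast at ha
    exact mul_left_cancel₀ hp0 ha
  · push_cast at hb
    exact mul_left_cancel₀ hp0 hb

/-- The minor on rows 1, 2 and columns 0, 3 is -ūu, so u = 0 by inertness. The final condition is
the minor on rows 0, 1 and columns 2, 3, the determinant of (s, z; z̄, w). -/
theorem NearRankOne.params_of_zero (hp : Prime (p : GaussianInt)) {u z : GaussField} {s w : ℚ}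
    {H : ParamsMem (gaussIntegersAway p) u z s w} (hr : ParamsReduced u z s w)
    (h : NearRankOne (uni H * tor p ![0, 0, 0])) :
    u = 0 ∧ p * z ∈ gaussIntegers ∧ (p : GaussField) * s ∈ gaussIntegers ∧
      (p : GaussField) * w ∈ gaussIntegers ∧
      (p : GaussField) * (s * w - star z * z) ∈ gaussIntegers := by
  simp only [NearRankOne, mul_tor_apply, uni_val] at h
  have hu := h.1 2 3
  have hn := h.2 1 0 2 3
  simp [uniMatrix, torusExp, pzpow_zero] at hu hn
  obtain rfl := eq_zero_of_norm hp hr.1 hu hn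
  have hz := h.1 0 3
  have hs := h.1 0 2
  have hw := h.1 1 3
  have hd := h.2 0 2 1 3
  simp [uniMatrix, torusExp, pzpow_zero] at hz hs hw hd
  exact ⟨rfl, hz, hs, hw, by rwa [mul_comm (star z)]⟩

theorem exponents_of_integral {e₁ e₂ : ℤ} {u z : GaussField} {s w : ℚ}
    {H : ParamsMem (gaussIntegersAway p) u z s w}
    (h : ∀ i j, (uni H * tor p ![1, e₁, e₂]).1 i j ∈ gaussIntegers) :
    (e₁ = 0 ∨ e₁ = 1) ∧ (e₂ = 0 ∨ e₂ = 1) := by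
  have h1 := h 0 0
  have h2 := h 1 1
  have h3 := h 2 2
  have h4 := h 3 3
  simp only [mul_tor_apply, uni_val] at h1 h2 h3 h4
  simp [uniMatrix, torusExp, pzpow_mem_gaussIntegers_iff] at h1 h2 h3 h4
  omega

theorem params_of_integral_zero_zero {u z : GaussField} {s w : ℚ}
    {H : ParamsMem (gaussIntegersAway p) u z s w} (hr : ParamsReduced u z s w)
    (h : ∀ i j, (uni H * tor p ![1, 0, 0]).1 i j ∈ gaussIntegers) :
    u = 0 ∧ z = 0 ∧ s = 0 ∧ w = 0 := by
  simp only [mul_tor_apply, uni_val] at h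
  have hu := h 2 3
  have hz := h 1 2
  have hs := h 0 2
  simp [uniMatrix, torusExp, pzpow_zero, star_mem_gaussIntegers_iff] at hu hz hs
  obtain rfl := gauss_eq_zero_of_reduced hr.1 hu
  obtain rfl := gauss_eq_zero_of_reduced hr.2.1 hz
  obtain rfl := rat_eq_zero_of_reduced hr.2.2.1 hs
  have hw := h 1 3
  simp [uniMatrix, torusExp, pzpow_zero] at hw
  exact ⟨rfl, rfl, rfl, rat_eq_zero_of_reduced hr.2.2.2 hw⟩

theorem params_of_integral_one_zero {u z : GaussField} {s w : ℚ}
    {H : ParamsMem (gaussIntegersAway p) u z s w} (hr : ParamsReduced u z s w)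
    (h : ∀ i j, (uni H * tor p ![1, 1, 0]).1 i j ∈ gaussIntegers) :
    u = 0 ∧ z = 0 ∧ w = 0 ∧ (p : GaussField) * s ∈ gaussIntegers := by
  simp only [mul_tor_apply, uni_val] at h
  have hu := h 2 3
  simp [uniMatrix, torusExp, pzpow_zero] at hu
  obtain rfl := gauss_eq_zero_of_reduced hr.1 hu
  have hz := h 0 3
  have hs := h 0 2
  have hw := h 1 3
  simp [uniMatrix, torusExp, pzpow_zero, pzpow_one] at hz hs hw
  exact ⟨rfl, gauss_eq_zero_of_reduced hr.2.1 hz, rat_eq_zero_of_reduced hr.2.2.2 hw,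
    by rwa [mul_comm]⟩

theorem params_of_integral_zero_one {u z : GaussField} {s w : ℚ}
    {H : ParamsMem (gaussIntegersAway p) u z s w} (hr : ParamsReduced u z s w)
    (h : ∀ i j, (uni H * tor p ![1, 0, 1]).1 i j ∈ gaussIntegers) :
    z = 0 ∧ s = 0 ∧ p * u ∈ gaussIntegers ∧ (p : GaussField) * w ∈ gaussIntegers := by
  simp only [mul_tor_apply, uni_val] at h
  have hz := h 1 2
  have hs := h 0 2
  simp [uniMatrix, torusExp, pzpow_zero, star_mem_gaussIntegers_iff] at hz hs
  obtain rfl := gauss_eq_zero_of_reduced hr.2.1 hz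
  obtain rfl := rat_eq_zero_of_reduced hr.2.2.1 hs
  have hu := h 2 3
  have hw := h 1 3
  simp [uniMatrix, torusExp, pzpow_one] at hu hw
  exact ⟨rfl, rfl, by rwa [mul_comm], by rwa [mul_comm]⟩

theorem params_of_integral_one_one {u z : GaussField} {s w : ℚ}
    {H : ParamsMem (gaussIntegersAway p) u z s w} (hr : ParamsReduced u z s w)
    (h : ∀ i j, (uni H * tor p ![1, 1, 1]).1 i j ∈ gaussIntegers) :
    u = 0 ∧ p * z ∈ gaussIntegers ∧ (p : GaussField) * s ∈ gaussIntegers ∧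
      (p : GaussField) * w ∈ gaussIntegers := by
  simp only [mul_tor_apply, uni_val] at h
  have hu := h 1 0
  simp [uniMatrix, torusExp, pzpow_zero, star_mem_gaussIntegers_iff] at hu
  obtain rfl := gauss_eq_zero_of_reduced hr.1 hu
  have hz := h 0 3
  have hs := h 0 2
  have hw := h 1 3
  simp [uniMatrix, torusExp, pzpow_one] at hz hs hw
  exact ⟨rfl, by rwa [mul_comm], by rwa [mul_comm], by rwa [mul_comm]⟩

theorem integral_of_linked {g : simGroup p} {m : Fin 3 → ℤ} (hm : ∀ i, 0 ≤ torusExp m i)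
    (h : Linked (modularGroup p) g (tor p m)) (i j : Fin 4) : g.1 i j ∈ gaussIntegers := by
  obtain ⟨γ, hγ, δ, hδ, rfl⟩ := h
  refine entry_mul (fun i j => ?_) hδ.1 i j
  rw [mul_tor_apply]
  exact mul_mem (hγ.1 i j) (pzpow_mem_gaussIntegers_iff.2 (hm j))

theorem HasDiag.similitude {g : simGroup p} {m : Fin 3 → ℤ} (h : HasDiag g m) :
    g.1.valᴴ * matJ * g.1.val = pzpow p (m 0) • matJ := by
  obtain ⟨d, hd⟩ := exists_similitude g
  obtain ⟨⟨a1, a2, a3, a4, a5, a6⟩, hi⟩ := h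
  have := row_relation g hd 2 0
  have h2 := hi 2
  have h0 := hi 0
  simp [torusExp] at h0 h2
  simp [a1, a2, a3, h0, h2, matJ, star_pzpow, ← pzpow_add] at this
  rw [hd, pzpow_injective this]

/-- The exponent m 0 is that of the similitude factor, on which Γ₂ has no effect. -/
theorem HasDiag.eq_zero_of_linked {g h : simGroup p} {m m' : Fin 3 → ℤ} (hg : HasDiag g m)
    (hh : HasDiag h m') (H : Linked (modularGroup p) g h) : m 0 = m' 0 := by
  obtain ⟨γ, hγ, δ, hδ, rfl⟩ := H
  refine similitude_unique hg.similitude ?_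
  have := hh.similitude
  rw [simGroup_val_mul, simGroup_val_mul, Matrix.conjTranspose_mul, Matrix.conjTranspose_mul]
  calc _ = δ.1.valᴴ * (h.1.valᴴ * (γ.1.valᴴ * matJ * γ.1.val) * h.1.val) * δ.1.val := by
        simp only [Matrix.mul_assoc]
    _ = _ := by rw [hγ.2, this, Matrix.mul_smul, Matrix.smul_mul, hδ.2]

/-- On the parabolic subgroup the (3,3) entry is multiplicative, and Γ_{1,1} contributes integral
factors. This invariant separates T₋ from T₊, and Λ₋, Λ₊ from each other and from τ, ν. -/
theorem HasDiag.eq_two_of_linked {g h : simGroup p} {m m' : Fin 3 → ℤ} (hg : HasDiag g m)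
    (hh : HasDiag h m') (H : Linked (parabolicModular p) g h) : m 2 = m' 2 := by
  have key : ∀ {g h : simGroup p} {m m' : Fin 3 → ℤ}, HasDiag g m → HasDiag h m' →
      Linked (parabolicModular p) g h → m' 2 ≤ m 2 := by
    intro g h m m' hg hh H
    obtain ⟨γ, ⟨hγ, b1, b2, b3⟩, δ, ⟨hδ, c1, c2, c3⟩, e⟩ := H
    obtain ⟨-, -, -, a4, a5, a6⟩ := hh.1
    have h1 := congrArg (fun x : simGroup p => x.1.val 3 3) e
    have g3 := hg.2 3
    have h3 := hh.2 3
    simp [Matrix.mul_apply, Fin.sum_univ_four, b1, b2, b3, a4, a5, a6, g3, h3,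
      torusExp] at h1
    have h2 : pzpow p (m 2 - m' 2) = γ.1 3 3 * δ.1 3 3 := by
      apply mul_left_cancel₀ (pzpow_ne_zero (p := p) (m' 2))
      rw [← pzpow_add, add_sub_cancel, h1]
      ring
    have h4 := mul_mem (hγ.1 3 3) (hδ.1 3 3)
    rw [← h2, pzpow_mem_gaussIntegers_iff] at h4
    linarith
  exact le_antisymm (key hh hg H.symm) (key hg hh H)

/-- In γ·uni·δ the parameter w can reach the entry (0,0) only through δ₃₀, which vanishes; so that
entry is integral and cannot be p⁻¹. This separates ν from τ, which share the last exponent. -/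
theorem not_linked_uni_corner {w : ℚ} (H : ParamsMem (gaussIntegersAway p) 0 0 0 w) :
    ¬ Linked (parabolicModular p) (uni H) (tor p ![0, 1, 0]) := by
  intro h
  obtain ⟨γ, ⟨hγ, -⟩, δ, ⟨hδ, c1, c2, c3⟩, e⟩ := h.symm
  have h1 := congrArg (fun x : simGroup p => x.1.val 0 0) e
  simp [Matrix.mul_apply, Fin.sum_univ_four, tor_apply, uni_val, uniMatrix, c1,
    torusExp] at h1
  have h2 := add_mem (add_mem (mul_mem (hγ.1 0 0) (hδ.1 0 0)) (mul_mem (hγ.1 0 1) (hδ.1 1 0)))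
    (mul_mem (hγ.1 0 2) (hδ.1 2 0))
  rw [← h1, pzpow_mem_gaussIntegers_iff] at h2
  norm_num at h2

theorem not_linked_one : ¬ Linked (modularGroup p) 1 (tor p ![0, 1, 0]) := by
  intro h
  obtain ⟨γ, hγ, δ, hδ, e⟩ := h.symm
  rw [mul_one] at e
  have h1 : (tor p ![0, 1, 0]).1 0 0 ∈ gaussIntegers := by
    rw [e]
    exact (mul_mem hγ hδ).1 0 0
  rw [show (tor p ![0, 1, 0]).1 0 0 = pzpow p (-1) by simp [tor_apply, torusExp],
    pzpow_mem_gaussIntegers_iff] at h1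
  norm_num at h1

end Classification

/-! ### Double cosets listed by reduced representatives -/

section ReducedRepresentatives

variable {p : ℕ}

theorem UnitFrac.mul_mem {n : ℕ} (x : UnitFrac n) :
    (n : GaussField) * (x.1 : GaussField) ∈ gaussIntegers := by
  have := ratCast_mem_gaussIntegers_iff.2 x.2.2
  push_cast at this
  exact this

theorem UnitFrac.mem_away (x : UnitFrac p) : (x.1 : GaussField) ∈ gaussIntegersAway p :=
  ⟨1, by rw [pow_one]; exact x.mul_mem⟩

theorem UnitFrac.mem_away_sq (x : UnitFrac (p ^ 2)) : (x.1 : GaussField) ∈ gaussIntegersAway p :=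
  ⟨2, by have := x.mul_mem; push_cast at this; exact this⟩

theorem GaussUnitFrac.mem_away (x : GaussUnitFrac p) : x.1 ∈ gaussIntegersAway p :=
  ⟨1, by rw [pow_one]; exact x.2.2⟩

theorem exists_unitFrac {n : ℕ} {x : ℚ} (hx : 0 ≤ x ∧ x < 1)
    (h : (n : GaussField) * (x : GaussField) ∈ gaussIntegers) : ∃ y : UnitFrac n, y.1 = x := by
  refine ⟨⟨x, hx, ratCast_mem_gaussIntegers_iff.1 ?_⟩, rfl⟩
  push_cast
  exact h

theorem ratCast_zero_mem (R : Subring GaussField) : ((0 : ℚ) : GaussField) ∈ R := by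
  rw [Rat.cast_zero]; exact zero_mem _

theorem reduced_gauss_zero :
    (0 ≤ (0 : GaussField).re ∧ (0 : GaussField).re < 1) ∧
      0 ≤ (0 : GaussField).im ∧ (0 : GaussField).im < 1 := by simp

theorem reduced_rat_zero : (0 : ℚ) ≤ 0 ∧ (0 : ℚ) < 1 := by norm_num

variable [Fact p.Prime]

/-- The data of a reduced coset representative. -/
@[ext]
structure ReducedRep (p : ℕ) where
  m : Fin 3 → ℤ
  u : GaussField
  z : GaussField
  s : ℚ
  w : ℚ
  mem : ParamsMem (gaussIntegersAway p) u z s w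
  isReduced : ParamsReduced u z s w

/-- The element of `S_p^{1,1}` given by reduced parameters. -/
def ReducedRep.elem (r : ReducedRep p) : parabolicGroup p :=
  ⟨uni r.mem * tor p r.m, ((hasDiag_uni _).mul (hasDiag_tor _)).1.mem_parabolicGroup⟩

theorem ReducedRep.coe_elem (r : ReducedRep p) :
    (r.elem : simGroup p) = uni r.mem * tor p r.m := rfl

theorem ReducedRep.hasDiag (r : ReducedRep p) : HasDiag (r.elem : simGroup p) r.m := by
  have := (hasDiag_uni r.mem).mul (hasDiag_tor r.m)
  rwa [zero_add] at this

theorem exists_reducedRep (hp : Prime (p : GaussianInt)) (g : simGroup p) :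
    ∃ r : ReducedRep p, coset (modularGroup p) g = coset (modularGroup p) r.elem := by
  obtain ⟨m, u, z, s, w, H, hr, e⟩ := exists_reduced hp g
  exact ⟨⟨m, u, z, s, w, H, hr⟩, e⟩

theorem ReducedRep.eq_of_coset_eq {r r' : ReducedRep p}
    (h : coset (modularGroup p) (r.elem : simGroup p) = coset (modularGroup p) r'.elem) :
    r = r' := by
  obtain ⟨h1, h2, h3, h4, h5⟩ := reduced_unique r.isReduced r'.isReduced h
  exact ReducedRep.ext h1 h2 h3 h4 h5

theorem ReducedRep.coset_eq_iff {r r' : ReducedRep p} :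
    coset (modularGroup p) (r.elem : simGroup p) = coset (modularGroup p) r'.elem ↔ r = r' :=
  ⟨ReducedRep.eq_of_coset_eq, fun h => by rw [h]⟩

open HeckeAlgebra

theorem isSumOf_parabolic (hp : Prime (p : GaussianInt)) {ι : Type*} [Fintype ι]
    {f : ι → ReducedRep p} (hf : Function.Injective f) {h : parabolicGroup p}
    (hl : ∀ i, Linked (parabolicModular p) ((f i).elem : simGroup p) h)
    (hs : ∀ r : ReducedRep p, Linked (parabolicModular p) (r.elem : simGroup p) h → ∃ i, f i = r) :
    IsSumOf (doubleCoset (parabolicModularGroup p) h) fun i => (f i).elem := by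
  refine isSumOf_doubleCoset (fun i j hij => hf (ReducedRep.eq_of_coset_eq ?_)) (fun i => ?_)
    fun g hg => ?_
  · exact congrArg (cosetInclusion (modularGroup p) (parabolicGroup p)) hij
  · rw [coset_mem_cosetsIn_iff_linked, linked_subgroupOf_iff]
    exact hl i
  · obtain ⟨r, hr⟩ := exists_reducedRep hp (g : simGroup p)
    have e : coset (parabolicModularGroup p) g = coset (parabolicModularGroup p) r.elem :=
      cosetInclusion_injective _ _ hr
    rw [e, coset_mem_cosetsIn_iff_linked, linked_subgroupOf_iff] at hg
    obtain ⟨i, rfl⟩ := hs r hg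
    exact ⟨i, e⟩

theorem isSumOf_modular (hp : Prime (p : GaussianInt)) {ι : Type*} [Fintype ι]
    {f : ι → ReducedRep p} (hf : Function.Injective f) {h : simGroup p}
    (hl : ∀ i, Linked (modularGroup p) ((f i).elem : simGroup p) h)
    (hs : ∀ r : ReducedRep p, Linked (modularGroup p) (r.elem : simGroup p) h → ∃ i, f i = r) :
    IsSumOf (doubleCoset (modularGroup p) h) fun i => ((f i).elem : simGroup p) := by
  refine isSumOf_doubleCoset (fun i j hij => hf (ReducedRep.eq_of_coset_eq hij)) (fun i => ?_)
    fun g hg => ?_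
  · rw [coset_mem_cosetsIn_iff_linked]
    exact hl i
  · obtain ⟨r, hr⟩ := exists_reducedRep hp g
    rw [hr, coset_mem_cosetsIn_iff_linked] at hg
    obtain ⟨i, rfl⟩ := hs r hg
    exact ⟨i, hr⟩

/-- For invertible `p s`, the determinant condition determines the last entry. -/
theorem exists_det_entry {s : ℚ} {z : GaussField} {x : ℤ} (hs : p * s = x) (hx : ¬ (p : ℤ) ∣ x)
    (hz : p * z ∈ gaussIntegers) : ∃ w : UnitFrac p,
      (p : GaussField) * (s * w.1 - star z * z) ∈ gaussIntegers := by
  obtain ⟨y, k, h⟩ := exists_inverse_mod hx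
  obtain ⟨n, hn⟩ : ∃ n : ℤ, (p : ℚ) ^ 2 * (z.re ^ 2 + z.im ^ 2) = n := by
    have h1 := mul_mem (star_mem_gaussIntegers hz) hz
    obtain ⟨n, hn⟩ := (mem_gaussIntegers_iff.1 h1).1
    refine ⟨n, hn ▸ ?_⟩
    simp
    ring
  have hp0 := cast_p_ne_zero p
  have h' : (x : ℚ) * y = 1 + p * k := by exact_mod_cast h
  -- The condition reads x·(pw) ≡ n modulo p with n = p²|z|², so pw must be yn modulo p, where y
  -- inverts x.
  refine ⟨⟨Int.fract ((y : ℚ) * n / p), ⟨Int.fract_nonneg _, Int.fract_lt_one _⟩,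
    y * n - p * ⌊(y : ℚ) * n / p⌋, ?_⟩, ?_⟩
  · rw [Int.fract]
    push_cast
    field_simp
  · rw [← ratCast_norm_sq]
    have e : (p : ℚ) * (s * Int.fract ((y : ℚ) * n / p) - (z.re ^ 2 + z.im ^ 2)) =
        ((k * n - x * ⌊(y : ℚ) * n / p⌋ : ℤ) : ℚ) := by
      rw [Int.fract]
      push_cast
      apply mul_left_cancel₀ hp0
      have e2 : (p : ℚ) * (y * n / p) = y * n := by field_simp
      linear_combination (p * (y * n / p - ⌊(y : ℚ) * n / p⌋)) * hs + x * e2 - hn + n * h'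
    have := ratCast_mem_gaussIntegers_iff.2 ⟨_, e⟩
    push_cast at this ⊢
    exact this

theorem det_entry_unique {s : ℚ} {z : GaussField} {x : ℤ} (hs : p * s = x) (hx : ¬ (p : ℤ) ∣ x)
    {w w' : UnitFrac p} (hw : (p : GaussField) * (s * w.1 - star z * z) ∈ gaussIntegers)
    (hw' : (p : GaussField) * (s * w'.1 - star z * z) ∈ gaussIntegers) : w = w' := by
  refine Subtype.ext (eq_of_reduced w.2.1 w'.2.1 ?_)
  obtain ⟨y, k, h⟩ := exists_inverse_mod hx
  obtain ⟨a, ha⟩ := w.2.2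
  obtain ⟨b, hb⟩ := w'.2.2
  have h1 := sub_mem hw hw'
  have e : (p : GaussField) * (s * w.1 - star z * z) - p * (s * w'.1 - star z * z) =
      ((p * s * (w.1 - w'.1) : ℚ) : GaussField) := by push_cast; ring
  rw [e] at h1
  obtain ⟨c, hc⟩ := ratCast_mem_gaussIntegers_iff.1 h1
  have h' : (x : ℚ) * y = 1 + p * k := by exact_mod_cast h
  refine ⟨y * c - k * (a - b), ?_⟩
  push_cast
  linear_combination y * hc - (w.1 - w'.1) * h' - k * ha + k * hb - y * (w.1 - w'.1) * hs

theorem UnitFrac.exists_not_dvd {s : UnitFrac p} (hs : s.1 ≠ 0) :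
    ∃ x : ℤ, p * s.1 = x ∧ ¬ (p : ℤ) ∣ x := by
  obtain ⟨x, hx⟩ := s.2.2
  refine ⟨x, hx, ?_⟩
  rintro ⟨k, rfl⟩
  refine hs (eq_of_reduced s.2.1 reduced_rat_zero ⟨k, ?_⟩)
  push_cast at hx
  rw [sub_zero]
  exact mul_left_cancel₀ (cast_p_ne_zero p) hx

end ReducedRepresentatives

/-! ### Explicit families of representatives -/

section Families

variable {p : ℕ}

/-- Representatives for `T₋`. -/
def repMinus : Unit ⊕ UnitFrac p → ReducedRep p
  | .inl _ => ⟨![1, 0, 0], 0, 0, 0, 0,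
      ⟨zero_mem _, zero_mem _, ratCast_zero_mem _, ratCast_zero_mem _⟩,
      ⟨reduced_gauss_zero, reduced_gauss_zero, reduced_rat_zero, reduced_rat_zero⟩⟩
  | .inr s => ⟨![1, 1, 0], 0, 0, s.1, 0,
      ⟨zero_mem _, zero_mem _, s.mem_away, ratCast_zero_mem _⟩,
      ⟨reduced_gauss_zero, reduced_gauss_zero, s.2.1, reduced_rat_zero⟩⟩

/-- Representatives for `T₊`. -/
def repPlus : (GaussUnitFrac p × UnitFrac p) ⊕ (UnitFrac p × GaussUnitFrac p × UnitFrac p) →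
    ReducedRep p
  | .inl (u, w) => ⟨![1, 0, 1], u.1, 0, 0, w.1,
      ⟨u.mem_away, zero_mem _, ratCast_zero_mem _, w.mem_away⟩,
      ⟨u.2.1, reduced_gauss_zero, reduced_rat_zero, w.2.1⟩⟩
  | .inr (s, z, w) => ⟨![1, 1, 1], 0, z.1, s.1, w.1,
      ⟨zero_mem _, z.mem_away, s.mem_away, w.mem_away⟩,
      ⟨reduced_gauss_zero, z.2.1, s.2.1, w.2.1⟩⟩

/-- The representative for `Δ⁻¹ Λ₋`. -/
def repLambdaMinus (_ : Unit) : ReducedRep p :=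
  ⟨![0, 0, -1], 0, 0, 0, 0, ⟨zero_mem _, zero_mem _, ratCast_zero_mem _, ratCast_zero_mem _⟩,
    ⟨reduced_gauss_zero, reduced_gauss_zero, reduced_rat_zero, reduced_rat_zero⟩⟩

/-- Representatives for `Δ⁻¹ Λ₊`. -/
def repLambdaPlus : GaussUnitFrac p × GaussUnitFrac p × UnitFrac (p ^ 2) → ReducedRep p
  | (u, z, w) => ⟨![0, 0, 1], u.1, z.1, 0, w.1,
      ⟨u.mem_away, z.mem_away, ratCast_zero_mem _, w.mem_away_sq⟩,
      ⟨u.2.1, z.2.1, reduced_rat_zero, w.2.1⟩⟩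

/-- Representatives for `∇ʳ`. -/
def repNabla (w : UnitFrac p) : ReducedRep p :=
  ⟨![0, 0, 0], 0, 0, 0, w.1, ⟨zero_mem _, zero_mem _, ratCast_zero_mem _, w.mem_away⟩,
    ⟨reduced_gauss_zero, reduced_gauss_zero, reduced_rat_zero, w.2.1⟩⟩


theorem repMinus_injective : Function.Injective (repMinus (p := p)) := by
  rintro (_ | s) (_ | s') h <;>
    rw [ReducedRep.ext_iff] at h <;> simp [repMinus] at h
  rw [Subtype.ext h]

theorem repPlus_injective : Function.Injective (repPlus (p := p)) := by
  rintro (⟨u, w⟩ | ⟨s, z, w⟩) (⟨u', w'⟩ | ⟨s', z', w'⟩) h <;>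
    rw [ReducedRep.ext_iff] at h <;> simp [repPlus] at h
  · rw [Subtype.ext h.1, Subtype.ext h.2]
  · rw [Subtype.ext h.1, Subtype.ext h.2.1, Subtype.ext h.2.2]

theorem repLambdaPlus_injective : Function.Injective (repLambdaPlus (p := p)) := by
  rintro ⟨u, z, w⟩ ⟨u', z', w'⟩ h
  rw [ReducedRep.ext_iff] at h
  simp [repLambdaPlus] at h
  rw [Subtype.ext h.1, Subtype.ext h.2.1, Subtype.ext h.2.2]

theorem repNabla_injective : Function.Injective (repNabla (p := p)) := by
  intro w w' h
  rw [ReducedRep.ext_iff] at h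
  simp [repNabla] at h
  exact Subtype.ext h

variable [Fact p.Prime]

theorem exists_det_unitFrac (s : {s : UnitFrac p // s.1 ≠ 0}) (z : GaussUnitFrac p) :
    ∃ w : UnitFrac p, (p : GaussField) * (s.1.1 * w.1 - star z.1 * z.1) ∈ gaussIntegers :=
  let ⟨_, hx, hd⟩ := UnitFrac.exists_not_dvd s.2
  exists_det_entry hx hd z.2.2

/-- Representatives for `T^{J,r}`. -/
def repTau : (GaussUnitFrac p ⊕ UnitFrac (p ^ 2) × GaussUnitFrac p) ⊕
    ({s : UnitFrac p // s.1 ≠ 0} × GaussUnitFrac p) → ReducedRep p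
  | .inl (.inl u) => ⟨![0, -1, 0], u.1, 0, 0, 0,
      ⟨u.mem_away, zero_mem _, ratCast_zero_mem _, ratCast_zero_mem _⟩,
      ⟨u.2.1, reduced_gauss_zero, reduced_rat_zero, reduced_rat_zero⟩⟩
  | .inl (.inr (s, z)) => ⟨![0, 1, 0], 0, z.1, s.1, 0,
      ⟨zero_mem _, z.mem_away, s.mem_away_sq, ratCast_zero_mem _⟩,
      ⟨reduced_gauss_zero, z.2.1, s.2.1, reduced_rat_zero⟩⟩
  | .inr (s, z) => ⟨![0, 0, 0], 0, z.1, s.1.1, (exists_det_unitFrac s z).choose.1,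
      ⟨zero_mem _, z.mem_away, s.1.mem_away, UnitFrac.mem_away _⟩,
      ⟨reduced_gauss_zero, z.2.1, s.1.2.1, (exists_det_unitFrac s z).choose.2.1⟩⟩

theorem repTau_injective : Function.Injective (repTau (p := p)) := by
  rintro ((u | ⟨s, z⟩) | ⟨s, z⟩) ((u' | ⟨s', z'⟩) | ⟨s', z'⟩) h <;>
    rw [ReducedRep.ext_iff] at h <;> simp [repTau] at h
  · rw [Subtype.ext h]
  · rw [Subtype.ext h.1, Subtype.ext h.2]
  · rw [Subtype.ext h.1, Subtype.ext (Subtype.ext h.2.1)]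

/-- Elements of this double coset are integral with multiplier p, so e₁ and e₂ are 0 or 1. The value
of e₂ decides between the two families. -/
theorem exists_repMinus {r : ReducedRep p} (h : Linked (modularGroup p) (r.elem : simGroup p)
    (tor p ![1, 1, 1])) : (∃ i, repMinus i = r) ∨ ∃ i, repPlus i = r := by
  have h0 := r.hasDiag.eq_zero_of_linked (hasDiag_tor _) h
  have hint := integral_of_linked (m := ![1, 1, 1]) (fun i => by
    fin_cases i <;> simp [torusExp]) h
  obtain ⟨m, u, z, s, w, H, hr⟩ := r
  obtain ⟨e₁, e₂, rfl⟩ : ∃ e₁ e₂, m = ![1, e₁, e₂] := ⟨m 1, m 2, by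
    ext i; fin_cases i <;> simp_all⟩
  clear h h0
  obtain ⟨rfl | rfl, rfl | rfl⟩ := exponents_of_integral hint
  · obtain ⟨rfl, rfl, rfl, rfl⟩ := params_of_integral_zero_zero hr hint
    exact .inl ⟨.inl (), rfl⟩
  · obtain ⟨rfl, rfl, hu, hw⟩ := params_of_integral_zero_one hr hint
    obtain ⟨w, rfl⟩ := exists_unitFrac hr.2.2.2 hw
    exact .inr ⟨.inl (⟨u, hr.1, hu⟩, w), rfl⟩
  · obtain ⟨rfl, rfl, rfl, hs⟩ := params_of_integral_one_zero hr hint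
    obtain ⟨s, rfl⟩ := exists_unitFrac hr.2.2.1 hs
    exact .inl ⟨.inr s, rfl⟩
  · obtain ⟨rfl, hz, hs, hw⟩ := params_of_integral_one_one hr hint
    obtain ⟨s, rfl⟩ := exists_unitFrac hr.2.2.1 hs
    obtain ⟨w, rfl⟩ := exists_unitFrac hr.2.2.2 hw
    exact .inr ⟨.inr (s, ⟨z, hr.2.1, hz⟩, w), rfl⟩

/-- A last exponent ±1 gives Λ±, a first exponent ±1 gives τ. With trivial exponents a Hermitian
matrix (s, z; z̄, w) with denominator p and rank at most one remains: for s ≠ 0 it is determined by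
s and z and belongs to τ, while s = 0 forces z = 0 by inertness and leaves ν. -/
theorem exists_rep_of_nearRankOne (hp : Prime (p : GaussianInt)) {r : ReducedRep p}
    (h0 : r.m 0 = 0) (h : NearRankOne (r.elem : simGroup p)) :
    (∃ i, repLambdaMinus i = r) ∨ (∃ i, repLambdaPlus i = r) ∨ (∃ i, repTau i = r) ∨
      ∃ i, repNabla i = r := by
  obtain ⟨m, u, z, s, w, H, hr⟩ := r
  obtain ⟨e₁, e₂, rfl⟩ : ∃ e₁ e₂, m = ![0, e₁, e₂] := ⟨m 1, m 2, by
    ext i; fin_cases i <;> simp_all⟩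
  clear h0
  obtain ⟨rfl, rfl | rfl | rfl⟩ | ⟨rfl, rfl | rfl⟩ := h.exponents
  · obtain ⟨rfl, rfl, rfl, rfl⟩ := h.params_of_last_neg hr
    exact .inl ⟨(), rfl⟩
  · obtain ⟨rfl, hz, hs, hw, hd⟩ := h.params_of_zero hp hr
    obtain ⟨s, rfl⟩ := exists_unitFrac hr.2.2.1 hs
    obtain ⟨w, rfl⟩ := exists_unitFrac hr.2.2.2 hw
    by_cases hs0 : s.1 = 0
    · have : z = 0 := eq_zero_of_norm hp hr.2.1 hz (by
        rw [hs0] at hd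
        simpa using hd)
      subst this
      exact .inr (.inr (.inr ⟨w, ReducedRep.ext rfl rfl rfl hs0.symm rfl⟩))
    · obtain ⟨x, hx, hdvd⟩ := UnitFrac.exists_not_dvd hs0
      refine .inr (.inr (.inl ⟨.inr (⟨s, hs0⟩, ⟨z, hr.2.1, hz⟩), ReducedRep.ext rfl rfl rfl rfl ?_⟩))
      exact congrArg Subtype.val (det_entry_unique hx hdvd
        (exists_det_unitFrac ⟨s, hs0⟩ ⟨z, hr.2.1, hz⟩).choose_spec hd)
  · obtain ⟨rfl, hu, hz, hw⟩ := h.params_of_last_pos hr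
    obtain ⟨w, rfl⟩ := exists_unitFrac hr.2.2.2 hw
    exact .inr (.inl ⟨(⟨u, hr.1, hu⟩, ⟨z, hr.2.1, hz⟩, w), rfl⟩)
  · obtain ⟨rfl, rfl, rfl, hu⟩ := h.params_of_first_neg hr
    exact .inr (.inr (.inl ⟨.inl (.inl ⟨u, hr.1, hu⟩), rfl⟩))
  · obtain ⟨rfl, rfl, hs, hz⟩ := h.params_of_first_pos hr
    obtain ⟨s, rfl⟩ := exists_unitFrac hr.2.2.1 hs
    exact .inr (.inr (.inl ⟨.inl (.inr (s, ⟨z, hr.2.1, hz⟩)), rfl⟩))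

theorem linked_repMinus (i : Unit ⊕ UnitFrac p) :
    Linked (parabolicModular p) ((repMinus i).elem : simGroup p) (tor p ![1, 1, 0]) := by
  obtain _ | s := i
  · refine (linked_uni_mul_tor _ ?_ ?_ ?_ ?_).trans ?_
    any_goals simp [repMinus, zero_mem]
    simpa using linked_tor_swap_zero_two (p := p) 1 0 0
  · refine linked_uni_mul_tor _ ?_ ?_ ?_ ?_ <;> simp [repMinus, zero_mem]
    simpa [pzpow_one] using s.mul_mem

theorem linked_repPlus
    (i : (GaussUnitFrac p × UnitFrac p) ⊕ (UnitFrac p × GaussUnitFrac p × UnitFrac p)) :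
    Linked (parabolicModular p) ((repPlus i).elem : simGroup p) (tor p ![1, 1, 1]) := by
  obtain ⟨u, w⟩ | ⟨s, z, w⟩ := i
  · refine (linked_uni_mul_tor _ ?_ ?_ ?_ ?_).trans ?_
    any_goals simp [repPlus, zero_mem]
    · simpa [pzpow_one] using u.2.2
    · simpa [pzpow_one] using w.mul_mem
    · simpa using linked_tor_swap_zero_two (p := p) 1 0 1
  · refine linked_uni_mul_tor _ ?_ ?_ ?_ ?_ <;> simp [repPlus, zero_mem]
    · simpa [pzpow_one] using z.2.2
    · simpa [pzpow_one] using s.mul_mem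
    · simpa [pzpow_one] using w.mul_mem

theorem linked_repLambdaMinus (i : Unit) :
    Linked (parabolicModular p) ((repLambdaMinus (p := p) i).elem : simGroup p) (tor p ![0, 0, -1]) := by
  refine linked_uni_mul_tor _ ?_ ?_ ?_ ?_ <;> simp [repLambdaMinus, zero_mem]

theorem linked_repLambdaPlus (i : GaussUnitFrac p × GaussUnitFrac p × UnitFrac (p ^ 2)) :
    Linked (parabolicModular p) ((repLambdaPlus i).elem : simGroup p) (tor p ![0, 0, 1]) := by
  obtain ⟨u, z, w⟩ := i
  refine linked_uni_mul_tor _ ?_ ?_ ?_ ?_ <;> simp [repLambdaPlus, zero_mem]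
  · simpa [pzpow_one] using u.2.2
  · simpa [pzpow_one] using z.2.2
  · have := w.mul_mem
    rwa [Nat.cast_pow, ← pzpow_natCast] at this

theorem linked_repTau (i : (GaussUnitFrac p ⊕ UnitFrac (p ^ 2) × GaussUnitFrac p) ⊕
    ({s : UnitFrac p // s.1 ≠ 0} × GaussUnitFrac p)) :
    Linked (parabolicModular p) ((repTau i).elem : simGroup p) (tor p ![0, 1, 0]) := by
  obtain (u | ⟨s, z⟩) | ⟨s, z⟩ := i
  · refine (linked_uni_mul_tor _ ?_ ?_ ?_ ?_).trans ?_
    any_goals simp [repTau, zero_mem]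
    · simpa [pzpow_one] using u.2.2
    · simpa using linked_tor_swap_zero_two (p := p) 0 (-1) 0
  · refine linked_uni_mul_tor _ ?_ ?_ ?_ ?_ <;> simp [repTau, zero_mem]
    · simpa [pzpow_one] using z.2.2
    · have := s.mul_mem
      rwa [Nat.cast_pow, ← pzpow_natCast] at this
  · obtain ⟨x, hx, hd⟩ := UnitFrac.exists_not_dvd s.2
    have e : tor p ![0, 0, 0] = 1 := by
      rw [← tor_zero]; congr 1; ext i; fin_cases i <;> rfl
    have hw := (exists_det_unitFrac s z).choose_spec
    rw [ReducedRep.coe_elem]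
    simp only [repTau, e, mul_one]
    exact linked_uni_of_det _ hx hd z.2.2 (UnitFrac.mul_mem _) hw

/-- Within Γ₂ the Levi swap carries the corner parameter to the position of s, so the nontrivial
cosets of ν do belong to the Γ₂-double coset of diag(p⁻¹, 1, p, 1). -/
theorem linked_repNabla {w : UnitFrac p} (hw : w.1 ≠ 0) :
    Linked (modularGroup p) ((repNabla w).elem : simGroup p) (tor p ![0, 1, 0]) := by
  obtain ⟨x, hx, hd⟩ := UnitFrac.exists_not_dvd hw
  have e : tor p ![0, 0, 0] = 1 := by
    rw [← tor_zero]; congr 1; ext i; fin_cases i <;> rfl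
  have K : ParamsMem (gaussIntegersAway p) 0 0 w.1 0 :=
    ⟨zero_mem _, zero_mem _, w.mem_away, ratCast_zero_mem _⟩
  rw [ReducedRep.coe_elem]
  simp only [repNabla, e, mul_one]
  exact (linked_uni_levi _ K).trans ((linked_uni_symmetric K hx hd).mono inf_le_left)

end Families

/-! ### Coset expansions of the operators -/

section Expansions

open HeckeAlgebra

variable {p : ℕ}

theorem repMinus_last (i : Unit ⊕ UnitFrac p) : (repMinus i).m 2 = 0 := by
  obtain _ | _ := i <;> rfl

theorem repPlus_last (i : (GaussUnitFrac p × UnitFrac p) ⊕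
    (UnitFrac p × GaussUnitFrac p × UnitFrac p)) : (repPlus i).m 2 = 1 := by
  obtain _ | _ := i <;> rfl

variable [Fact p.Prime]

theorem linked_last_neg : Linked (modularGroup p) (tor p ![0, 0, -1]) (tor p ![0, 1, 0]) := by
  refine (linked_tor_levi 0 0 (-1)).trans ?_
  simpa using (linked_tor_swap_zero_two (p := p) 0 (-1) 0).mono inf_le_left

theorem linked_last_pos : Linked (modularGroup p) (tor p ![0, 0, 1]) (tor p ![0, 1, 0]) :=
  linked_tor_levi 0 0 1

theorem linked_one_one_zero : Linked (modularGroup p) (tor p ![1, 1, 0]) (tor p ![1, 1, 1]) := by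
  simpa using linked_tor_swap_one_three (p := p) 1 1 0

theorem repTau_last (i : (GaussUnitFrac p ⊕ UnitFrac (p ^ 2) × GaussUnitFrac p) ⊕
    ({s : UnitFrac p // s.1 ≠ 0} × GaussUnitFrac p)) : (repTau i).m 2 = 0 := by
  obtain (_ | _) | _ := i <;> rfl

/-- The list for the Γ₂-double coset is cut down by the invariant last exponent, which is 0 on
`repMinus` and 1 on `repPlus`. The expansions of the other parabolic operators are obtained in the
same manner. -/
theorem isSumOf_TMinus (hp : Prime (p : GaussianInt)) :
    IsSumOf (TMinus p) fun i => (repMinus i).elem := by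
  refine isSumOf_parabolic hp repMinus_injective linked_repMinus fun r h => ?_
  have h2 := r.hasDiag.eq_two_of_linked (hasDiag_tor ![1, 1, 0]) h
  obtain ⟨i, hi⟩ | ⟨i, rfl⟩ := exists_repMinus ((h.mono inf_le_left).trans linked_one_one_zero)
  · exact ⟨i, hi⟩
  · rw [repPlus_last] at h2
    simp at h2

theorem isSumOf_TPlus (hp : Prime (p : GaussianInt)) :
    IsSumOf (TPlus p) fun i => (repPlus i).elem := by
  refine isSumOf_parabolic hp repPlus_injective linked_repPlus fun r h => ?_
  have h2 := r.hasDiag.eq_two_of_linked (hasDiag_tor ![1, 1, 1]) h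
  obtain ⟨i, rfl⟩ | ⟨i, hi⟩ := exists_repMinus (h.mono inf_le_left)
  · rw [repMinus_last] at h2
    simp at h2
  · exact ⟨i, hi⟩

theorem exists_rep_of_linked (hp : Prime (p : GaussianInt)) {r : ReducedRep p}
    (h : Linked (modularGroup p) (r.elem : simGroup p) (tor p ![0, 1, 0])) :
    (∃ i, repLambdaMinus i = r) ∨ (∃ i, repLambdaPlus i = r) ∨ (∃ i, repTau i = r) ∨
      ∃ i, repNabla i = r :=
  exists_rep_of_nearRankOne hp (r.hasDiag.eq_zero_of_linked (hasDiag_tor _) h)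
    (nearRankOne_of_linked h)

theorem isSumOf_lambdaMinus (hp : Prime (p : GaussianInt)) :
    IsSumOf (doubleCoset (parabolicModularGroup p) (torus11 p 0 0 (-1)))
      fun i => (repLambdaMinus i).elem := by
  refine isSumOf_parabolic hp (fun _ _ _ => rfl) linked_repLambdaMinus fun r h => ?_
  have h2 := r.hasDiag.eq_two_of_linked (hasDiag_tor ![0, 0, -1]) h
  obtain ⟨i, hi⟩ | ⟨i, rfl⟩ | ⟨i, rfl⟩ | ⟨i, rfl⟩ :=
    exists_rep_of_linked hp ((h.mono inf_le_left).trans linked_last_neg)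
  · exact ⟨i, hi⟩
  · simp [repLambdaPlus] at h2
  · simp [repTau_last] at h2
  · simp [repNabla] at h2

theorem isSumOf_lambdaPlus (hp : Prime (p : GaussianInt)) :
    IsSumOf (doubleCoset (parabolicModularGroup p) (torus11 p 0 0 1))
      fun i => (repLambdaPlus i).elem := by
  refine isSumOf_parabolic hp repLambdaPlus_injective linked_repLambdaPlus fun r h => ?_
  have h2 := r.hasDiag.eq_two_of_linked (hasDiag_tor ![0, 0, 1]) h
  obtain ⟨i, rfl⟩ | ⟨i, hi⟩ | ⟨i, rfl⟩ | ⟨i, rfl⟩ :=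
    exists_rep_of_linked hp ((h.mono inf_le_left).trans linked_last_pos)
  · simp [repLambdaMinus] at h2
  · exact ⟨i, hi⟩
  · simp [repTau_last] at h2
  · simp [repNabla] at h2

theorem tor_zero_vec : tor p ![0, 0, 0] = 1 := by
  rw [← tor_zero]; congr 1; ext i; fin_cases i <;> rfl

theorem isSumOf_tau (hp : Prime (p : GaussianInt)) :
    IsSumOf (doubleCoset (parabolicModularGroup p) (torus11 p 0 1 0))
      fun i => (repTau i).elem := by
  refine isSumOf_parabolic hp repTau_injective linked_repTau fun r h => ?_
  have h2 := r.hasDiag.eq_two_of_linked (hasDiag_tor ![0, 1, 0]) h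
  obtain ⟨i, rfl⟩ | ⟨i, rfl⟩ | ⟨i, hi⟩ | ⟨i, rfl⟩ :=
    exists_rep_of_linked hp (h.mono inf_le_left)
  · simp [repLambdaMinus] at h2
  · simp [repLambdaPlus] at h2
  · exact ⟨i, hi⟩
  · change Linked _ ((repNabla i).elem : simGroup p) (tor p ![0, 1, 0]) at h
    rw [ReducedRep.coe_elem] at h
    simp only [repNabla, tor_zero_vec, mul_one] at h
    exact (not_linked_uni_corner _ h).elim

/-- The double coset of `diag(1, 1, p, p)`. -/
def modularT (p : ℕ) [Fact p.Prime] : Hecke2 p := doubleCoset (modularGroup p) (tor p ![1, 1, 1])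

/-- The double coset of `diag(p⁻¹, 1, p, 1)`, plus one. -/
def modularTJ (p : ℕ) [Fact p.Prime] : Hecke2 p :=
  doubleCoset (modularGroup p) (tor p ![0, 1, 0]) + 1

theorem isSumOf_modularT (hp : Prime (p : GaussianInt)) : IsSumOf (modularT p)
    fun i => ((Sum.elim (repMinus (p := p)) repPlus i).elem : simGroup p) := by
  refine isSumOf_modular hp (repMinus_injective.sumElim repPlus_injective fun i j h => ?_) ?_ ?_
  · have := congrArg (fun r : ReducedRep p => r.m 2) h
    simp [repMinus_last, repPlus_last] at this
  · rintro (i | i)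
    · exact ((linked_repMinus i).mono inf_le_left).trans linked_one_one_zero
    · exact (linked_repPlus i).mono inf_le_left
  · intro r h
    obtain ⟨i, rfl⟩ | ⟨i, rfl⟩ := exists_repMinus h
    · exact ⟨.inl i, rfl⟩
    · exact ⟨.inr i, rfl⟩

/-- Representatives for `modularTJ`. -/
def repTJ := Sum.elim (repLambdaMinus (p := p))
  (Sum.elim repLambdaPlus (Sum.elim repTau repNabla))

theorem repTJ_injective : Function.Injective (repTJ (p := p)) := by
  have m {r r' : ReducedRep p} (h : r = r') : r.m 2 = r'.m 2 := by rw [h]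
  refine Function.Injective.sumElim (fun _ _ _ => rfl)
    (repLambdaPlus_injective.sumElim (repTau_injective.sumElim repNabla_injective ?_) ?_) ?_
  · rintro i w h
    have h1 := linked_repTau i
    rw [h, ReducedRep.coe_elem] at h1
    simp only [repNabla, tor_zero_vec, mul_one] at h1
    exact not_linked_uni_corner _ h1
  · rintro i (j | j) h
    · simpa [repLambdaPlus, repTau_last] using m h
    · simpa [repLambdaPlus, repNabla] using m h
  · rintro i (j | j | j) h
    · have : (-1 : ℤ) = 1 := m h
      norm_num at this
    · simpa [repLambdaMinus, repTau_last] using m h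
    · simpa [repLambdaMinus, repNabla] using m h

theorem repNabla_of_zero {w : UnitFrac p} (hw : w.1 = 0) :
    ((repNabla w).elem : simGroup p) = 1 := by
  rw [ReducedRep.coe_elem]
  simp only [repNabla, tor_zero_vec, mul_one]
  refine simGroup_ext fun i j => ?_
  rw [uni_val, simGroup_val_one, hw]
  fin_cases i <;> fin_cases j <;> simp [uniMatrix]

/-- The condition of rank at most one also admits rank zero. This is the identity coset, represented
by `repNabla` at w = 0, and it explains the summand 1 in `modularTJ`. -/
theorem isSumOf_modularTJ (hp : Prime (p : GaussianInt)) :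
    IsSumOf (modularTJ p) fun i => ((repTJ (p := p) i).elem : simGroup p) := by
  classical
  refine isSumOf_of_coeff (fun i j h => repTJ_injective (ReducedRep.eq_of_coset_eq h)) fun g => ?_
  obtain ⟨r, hr⟩ := exists_reducedRep hp g
  have e1 : coeff (1 : Hecke2 p) g = if coset (modularGroup p) g = coset (modularGroup p) 1
      then 1 else 0 := by
    change Finsupp.single (coset (modularGroup p) 1) (1 : ℚ) _ = _
    rw [Finsupp.single_apply]
    exact if_congr eq_comm rfl rfl
  have hn : Linked (modularGroup p) (r.elem : simGroup p) (tor p ![0, 1, 0]) →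
      coset (modularGroup p) (r.elem : simGroup p) ≠ coset (modularGroup p) 1 := fun h1 h2 =>
    not_linked_one ((Linked.of_coset_eq h2.symm).trans h1)
  have hex : (∃ i, coset (modularGroup p) g =
      coset (modularGroup p) ((repTJ (p := p) i).elem : simGroup p)) ↔
      Linked (modularGroup p) (r.elem : simGroup p) (tor p ![0, 1, 0]) ∨
        coset (modularGroup p) (r.elem : simGroup p) = coset (modularGroup p) 1 := by
    rw [hr]
    simp only [ReducedRep.coset_eq_iff]
    constructor
    · rintro ⟨i | i | i | i, rfl⟩
      · exact .inl (((linked_repLambdaMinus i).mono inf_le_left).trans linked_last_neg)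
      · exact .inl (((linked_repLambdaPlus i).mono inf_le_left).trans linked_last_pos)
      · exact .inl ((linked_repTau i).mono inf_le_left)
      · by_cases h0 : i.1 = 0
        · exact .inr (congrArg _ (repNabla_of_zero h0))
        · exact .inl (linked_repNabla h0)
    · rintro (h | h)
      · obtain ⟨i, rfl⟩ | ⟨i, rfl⟩ | ⟨i, rfl⟩ | ⟨i, rfl⟩ := exists_rep_of_linked hp h
        exacts [⟨.inl i, rfl⟩, ⟨.inr (.inl i), rfl⟩, ⟨.inr (.inr (.inl i)), rfl⟩,
          ⟨.inr (.inr (.inr i)), rfl⟩]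
      · obtain ⟨w, hw⟩ := exists_unitFrac (n := p) reduced_rat_zero (by simp [zero_mem])
        refine ⟨.inr (.inr (.inr w)), ReducedRep.eq_of_coset_eq ?_⟩
        rw [h]
        exact congrArg _ (repNabla_of_zero hw).symm
  rw [modularTJ, HeckeAlgebra.coeff_add, coeff_doubleCoset, e1, hr, coset_mem_cosetsIn_iff_linked]
  rw [hr] at hex
  simp only [hex]
  by_cases h1 : Linked (modularGroup p) (r.elem : simGroup p) (tor p ![0, 1, 0])
  · simp [h1, hn h1]
  · simp [h1]

/-- For γ in Γ_{1,1} the entries (1,1) and (3,3) are Gaussian integers with γ₁₁ times the conjugate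
of γ₃₃ equal to 1; so both have norm one and they coincide. -/
theorem uni_corner_comm {w : ℚ} (H : ParamsMem (gaussIntegersAway p) 0 0 0 w) {γ : simGroup p}
    (hγ : γ ∈ parabolicModular p) : uni H * γ = γ * uni H := by
  obtain ⟨⟨hO, hs⟩, h0, h1, h2⟩ := hγ
  have hs' : γ.1.valᴴ * matJ * γ.1.val = pzpow p 0 • matJ := by rw [hs, pzpow_zero, one_smul]
  have hu := last_diag_ne_zero h0 h1 h2
  have r0 := row_relation γ hs' 0 3
  have r1 := row_relation γ hs' 1 3
  have r2 := row_relation γ hs' 2 3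
  simp [h0, h1, h2, matJ, pzpow_zero, hu] at r0 r1 r2
  obtain ⟨a, b, e⟩ := hO 3 3
  obtain ⟨c, d, f⟩ := hO 1 1
  have hn : star (γ.1 3 3) * γ.1 3 3 = 1 := by
    have h3 := congrArg (fun x : GaussField => x.re ^ 2 + x.im ^ 2) r1
    rw [e, f] at h3
    simp [QuadraticAlgebra.re_one, QuadraticAlgebra.im_one] at h3
    have h4 : (a ^ 2 + b ^ 2) * (c ^ 2 + d ^ 2) = 1 := by
      have : ((a : ℚ) ^ 2 + b ^ 2) * (c ^ 2 + d ^ 2) = 1 := by linear_combination h3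
      exact_mod_cast this
    have h5 := Int.eq_one_of_mul_eq_one_right (by positivity) h4
    rw [← ratCast_norm_sq, e]
    have h6 : (a : ℚ) ^ 2 + b ^ 2 = 1 := by exact_mod_cast h5
    exact (congrArg (Rat.cast (K := GaussField)) h6).trans Rat.cast_one
  have e1 : γ.1 1 1 = γ.1 3 3 := by
    linear_combination γ.1 3 3 * r1 - γ.1 1 1 * hn
  refine simGroup_ext fun i j => ?_
  rw [simGroup_val_mul, simGroup_val_mul, uni_val, Matrix.mul_apply, Matrix.mul_apply,
    Fin.sum_univ_four, Fin.sum_univ_four]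
  fin_cases i <;> fin_cases j <;> simp [uniMatrix, h0, h1, h2, r0, r2, e1]
  ring

/-- The reduced operator `∇ʳ`, as a sum over reduced representatives. -/
def nablaReduced (p : ℕ) [Fact p.Prime] : Hecke11 p :=
  ∑ w : UnitFrac p, doubleCoset (parabolicModularGroup p) (repNabla w).elem

theorem coe_elem_repNabla (w : UnitFrac p) :
    ((repNabla w).elem : simGroup p) = uni (repNabla w).mem := by
  rw [ReducedRep.coe_elem]
  simp only [repNabla, tor_zero_vec, mul_one]

theorem repNabla_comm (w : UnitFrac p) {γ : parabolicGroup p} (hγ : γ ∈ parabolicModularGroup p) :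
    (repNabla w).elem * γ = γ * (repNabla w).elem := by
  refine Subtype.ext ?_
  rw [Subgroup.coe_mul, Subgroup.coe_mul, coe_elem_repNabla]
  exact uni_corner_comm _ ⟨hγ, γ.2⟩

theorem repNabla_normal (w : UnitFrac p) {γ : parabolicGroup p}
    (hγ : γ ∈ parabolicModularGroup p) :
    (repNabla w).elem * γ * (repNabla w).elem⁻¹ ∈ parabolicModularGroup p := by
  rw [repNabla_comm w hγ]
  simpa using hγ

theorem isSumOf_nablaReduced : IsSumOf (nablaReduced p) fun i => (repNabla i).elem := by
  rw [IsSumOf, nablaReduced, map_sum]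
  refine Finset.sum_congr rfl fun w _ => Finsupp.ext fun c => ?_
  classical
  rw [toSum_doubleCoset, Finsupp.single_apply]
  refine if_congr ?_ rfl rfl
  rw [cosetsIn_of_normal fun γ => repNabla_normal w]
  exact eq_comm

end Expansions

/-! ### Products of coset expansions -/

section SumOfProducts

variable {G : Type*} [Group G] {Γ : Subgroup G}

namespace HeckeAlgebra

variable {ι κ : Type*} [Fintype ι] [Fintype κ]

theorem IsSumOf.mul {v w : HeckeAlgebra Γ} {e : ι → G} {f : κ → G} (hv : IsSumOf v e)
    (hw : IsSumOf w f) : IsSumOf (v * w) fun i : ι × κ => e i.1 * f i.2 := by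
  rw [IsSumOf, toSum_mul, hw, map_sum, Fintype.sum_prod_type_right]
  refine Finset.sum_congr rfl fun j _ => ?_
  rw [mulLeft_single, one_smul, hv, map_sum]
  exact Finset.sum_congr rfl fun i _ => rightMul_single _ _ _

theorem isSumOf_central [IsHeckePair Γ] {z : G} (hz : ∀ g, z * g = g * z) :
    IsSumOf (doubleCoset Γ z) fun _ : Unit => z := by
  rw [IsSumOf, doubleCoset_central Γ hz]
  simp

/-- A double coset consisting of one coset satisfies Γgγ = Γg. Thus the enumeration of Λ₋ alone
shows that its torus element conjugates Γ_{1,1} into itself. -/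
theorem IsSumOf.normal [IsHeckePair Γ] {g : G} {e : Unit → G} (h : IsSumOf (doubleCoset Γ g) e)
    {γ : G} (hγ : γ ∈ Γ) : g * γ * g⁻¹ ∈ Γ := by
  classical
  have key (x : G) (hx : coset Γ x ∈ cosetsIn Γ g) : coset Γ x = coset Γ (e ()) := by
    have h1 := toSum_doubleCoset (Γ := Γ) g (coset Γ x)
    rw [if_pos hx, h, Finset.univ_unique, Finset.sum_singleton, Finsupp.single_apply] at h1
    by_contra hne
    rw [if_neg (fun h2 => hne h2.symm)] at h1
    exact zero_ne_one h1
  have h1 := (key g (coset_mem_cosetsIn_self g)).trans (key (g * γ) ⟨γ, hγ, rfl⟩).symm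
  exact coset_eq_iff.1 h1

end HeckeAlgebra

end SumOfProducts

/-! ### Degrees and relations between Λ₋, Λ₊, T₋, T₊, τ and ν -/

section Relations

open HeckeAlgebra

variable {p : ℕ}

theorem UnitFrac.symmetric_mem (s : UnitFrac p) : ParamsMem (gaussIntegersAway p) 0 0 s.1 0 :=
  ⟨zero_mem _, zero_mem _, s.mem_away, ratCast_zero_mem _⟩

variable [Fact p.Prime]

theorem torus11_mul (d e f d' e' f' : ℤ) :
    torus11 p d e f * torus11 p d' e' f' = torus11 p (d + d') (e + e') (f + f') := by
  refine Subtype.ext ?_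
  change tor p ![d, e, f] * tor p ![d', e', f'] = tor p ![d + d', e + e', f + f']
  rw [← tor_add]
  congr 1
  simp

theorem torus11_zero : torus11 p 0 0 0 = 1 := Subtype.ext tor_zero_vec

theorem torus11_inv (d e f : ℤ) : (torus11 p d e f)⁻¹ = torus11 p (-d) (-e) (-f) :=
  inv_eq_of_mul_eq_one_right (by rw [torus11_mul]; simp [torus11_zero])

theorem doubleCoset_congr_of_linked {g h : parabolicGroup p}
    (H : Linked (parabolicModular p) (g : simGroup p) h) :
    doubleCoset (parabolicModularGroup p) g = doubleCoset (parabolicModularGroup p) h :=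
  doubleCoset_congr (coset_mem_cosetsIn_iff_linked.2 (linked_subgroupOf_iff.2 H))

theorem delta_inv_mul (g : parabolicGroup p) :
    ((Delta p)⁻¹ : (Hecke11 p)ˣ) * doubleCoset (parabolicModularGroup p) g =
      doubleCoset (parabolicModularGroup p) (torus11 p (-2) (-1) (-1) * g) :=
  doubleCoset_central_mul_doubleCoset (torus11_central p (-1)) g

theorem delta_inv_comm (v : Hecke11 p) :
    ((Delta p)⁻¹ : (Hecke11 p)ˣ) * v = v * ((Delta p)⁻¹ : (Hecke11 p)ˣ) :=
  doubleCoset_central_comm (torus11_central p (-1)) v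

/-- The double coset of a diagonal matrix. -/
abbrev torusCoset (p : ℕ) [Fact p.Prime] (d e f : ℤ) : Hecke11 p :=
  doubleCoset (parabolicModularGroup p) (torus11 p d e f)

theorem delta_inv_mul_torusCoset (d e f : ℤ) :
    ((Delta p)⁻¹ : (Hecke11 p)ˣ) * torusCoset p d e f = torusCoset p (d - 2) (e - 1) (f - 1) := by
  rw [delta_inv_mul, torus11_mul]
  congr 2 <;> ring

theorem card_ne_zero_unitFrac : Fintype.card {s : UnitFrac p // s.1 ≠ 0} = p - 1 := by
  classical
  have h := Fintype.card_subtype_compl fun s : UnitFrac p => s.1 = 0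
  rw [card_unitFrac] at h
  rw [h]
  congr 1
  refine Fintype.card_eq_one_iff.2 ⟨⟨⟨0, reduced_rat_zero, 0, by simp⟩, rfl⟩, fun y => ?_⟩
  exact Subtype.ext (Subtype.ext y.2)

theorem deg_TMinus (hp : Prime (p : GaussianInt)) : deg (TMinus p) = p + 1 := by
  rw [(isSumOf_TMinus hp).deg_eq, Nat.card_eq_fintype_card]
  simp [card_unitFrac]
  ring

theorem deg_TPlus (hp : Prime (p : GaussianInt)) : deg (TPlus p) = p ^ 3 * (p + 1) := by
  rw [(isSumOf_TPlus hp).deg_eq, Nat.card_eq_fintype_card]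
  simp [card_unitFrac, card_gaussUnitFrac]
  ring

theorem deg_lambdaMinus (hp : Prime (p : GaussianInt)) : deg (torusCoset p 0 0 (-1)) = 1 := by
  rw [(isSumOf_lambdaMinus hp).deg_eq]
  simp

theorem deg_lambdaPlus (hp : Prime (p : GaussianInt)) : deg (torusCoset p 0 0 1) = p ^ 6 := by
  rw [(isSumOf_lambdaPlus hp).deg_eq, Nat.card_eq_fintype_card]
  simp [card_unitFrac, card_gaussUnitFrac]
  ring

theorem deg_tau (hp : Prime (p : GaussianInt)) : deg (torusCoset p 0 1 0) = p ^ 3 * (p + 1) := by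
  rw [(isSumOf_tau hp).deg_eq, Nat.card_eq_fintype_card]
  have : 1 ≤ p := (Fact.out : p.Prime).one_le
  simp only [Fintype.card_sum, Fintype.card_prod, card_unitFrac, card_gaussUnitFrac,
    card_ne_zero_unitFrac]
  push_cast [Nat.cast_sub this]
  ring

theorem lambdaMinus_normal (hp : Prime (p : GaussianInt)) {γ : parabolicGroup p}
    (hγ : γ ∈ parabolicModularGroup p) :
    torus11 p 0 0 (-1) * γ * (torus11 p 0 0 (-1))⁻¹ ∈ parabolicModularGroup p :=
  (isSumOf_lambdaMinus hp).normal hγ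

/-- As diag(1, p, 1, p⁻¹) conjugates Γ_{1,1} into itself, the product stays in one double coset; the
left factor has degree one. -/
theorem lambdaMinus_mul (hp : Prime (p : GaussianInt)) (g : parabolicGroup p) :
    torusCoset p 0 0 (-1) * doubleCoset (parabolicModularGroup p) g =
      (deg (doubleCoset (parabolicModularGroup p) g) /
        deg (doubleCoset (parabolicModularGroup p) (torus11 p 0 0 (-1) * g))) •
        doubleCoset (parabolicModularGroup p) (torus11 p 0 0 (-1) * g) := by
  rw [doubleCoset_mul_of_normal_left (fun γ => lambdaMinus_normal hp), deg_lambdaMinus hp, one_mul]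

theorem mul_lambdaPlus (hp : Prime (p : GaussianInt)) (g : parabolicGroup p) :
    doubleCoset (parabolicModularGroup p) g * torusCoset p 0 0 1 =
      (deg (doubleCoset (parabolicModularGroup p) g) * p ^ 6 /
        deg (doubleCoset (parabolicModularGroup p) (g * torus11 p 0 0 1))) •
        doubleCoset (parabolicModularGroup p) (g * torus11 p 0 0 1) := by
  have e : (torus11 p 0 0 1)⁻¹ = torus11 p 0 0 (-1) := by rw [torus11_inv]; simp
  rw [doubleCoset_mul_of_normal_right (fun γ hγ => ?_), deg_lambdaPlus hp]
  have := lambdaMinus_normal hp hγ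
  rwa [e, ← inv_inv (torus11 p 0 0 1), e]

theorem lambdaMinus_mul_lambdaPlus (hp : Prime (p : GaussianInt)) :
    torusCoset p 0 0 (-1) * torusCoset p 0 0 1 = (p : ℚ) ^ 6 • 1 := by
  rw [lambdaMinus_mul hp, torus11_mul, deg_lambdaPlus hp]
  simp only [add_zero, neg_add_cancel, torus11_zero, doubleCoset_one, deg_one, div_one]

theorem lambdaMinus_mul_TPlus (hp : Prime (p : GaussianInt)) :
    torusCoset p 0 0 (-1) * TPlus p = (p : ℚ) ^ 3 • TMinus p := by
  have hp1 : (p : ℚ) + 1 ≠ 0 := by positivity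
  have e : torus11 p 0 0 (-1) * torus11 p 1 1 1 = torus11 p 1 1 0 := by rw [torus11_mul]; norm_num
  have := lambdaMinus_mul hp (torus11 p 1 1 1)
  rw [e] at this
  refine this.trans ?_
  change (deg (TPlus p) / deg (TMinus p)) • TMinus p = _
  rw [deg_TPlus hp, deg_TMinus hp, mul_div_cancel_right₀ _ hp1]

theorem TMinus_mul_lambdaPlus (hp : Prime (p : GaussianInt)) :
    TMinus p * torusCoset p 0 0 1 = (p : ℚ) ^ 3 • TPlus p := by
  have hp0 := cast_p_ne_zero p
  have hp1 : (p : ℚ) + 1 ≠ 0 := by positivity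
  have e : torus11 p 1 1 0 * torus11 p 0 0 1 = torus11 p 1 1 1 := by rw [torus11_mul]; norm_num
  have := mul_lambdaPlus hp (torus11 p 1 1 0)
  rw [e] at this
  refine this.trans ?_
  change (deg (TMinus p) * _ / deg (TPlus p)) • TPlus p = _
  rw [deg_TPlus hp, deg_TMinus hp]
  congr 1
  field_simp

theorem lambdaMinus_mul_tau (hp : Prime (p : GaussianInt)) :
    torusCoset p 0 0 (-1) * torusCoset p 0 1 0 =
      (p ^ 3 * (p + 1) / deg (torusCoset p 0 1 (-1))) • torusCoset p 0 1 (-1) := by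
  rw [lambdaMinus_mul hp, torus11_mul, deg_tau hp]
  norm_num

/-- Both multiplications land in a single double coset, and the degree of the intermediate one
cancels, so it is never computed. -/
theorem lambdaMinus_mul_tau_mul_lambdaPlus (hp : Prime (p : GaussianInt)) :
    torusCoset p 0 0 (-1) * torusCoset p 0 1 0 * torusCoset p 0 0 1 =
      (p : ℚ) ^ 6 • torusCoset p 0 1 0 := by
  have hp0 := cast_p_ne_zero p
  have hp1 : (p : ℚ) + 1 ≠ 0 := by positivity
  have hM := deg_doubleCoset_ne_zero (Γ := parabolicModularGroup p) (torus11 p 0 1 (-1))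
  have e : torus11 p 0 1 (-1) * torus11 p 0 0 1 = torus11 p 0 1 0 := by rw [torus11_mul]; norm_num
  rw [lambdaMinus_mul_tau hp, smul_mul_assoc, mul_lambdaPlus hp, e, deg_tau hp, smul_smul]
  congr 1
  field_simp

/-- Conjugation by diag(1, p, 1, p⁻¹) multiplies the corner entry by p², which makes it integral. So
Λ₋ from the left and Λ₊ from the right absorb each of the p cosets of ν; this is the factor p in aν
= pa and νb = pb. -/
theorem torus_mul_repNabla (w : UnitFrac p) : ∃ γ ∈ parabolicModularGroup p,
    torus11 p 0 0 (-1) * (repNabla w).elem = γ * torus11 p 0 0 (-1) ∧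
      (repNabla w).elem * torus11 p 0 0 1 = torus11 p 0 0 1 * γ := by
  have K : ParamsMem gaussIntegers 0 0 0 ((p : ℚ) ^ 2 * w.1) := by
    refine ⟨zero_mem _, zero_mem _, ratCast_zero_mem _, ?_⟩
    have := mul_mem (natCast_mem gaussIntegers p) w.mul_mem
    push_cast
    convert this using 1
    ring
  have hP := natCast_p_ne_zero (p := p)
  refine ⟨⟨uni (p := p) K.away, (hasDiag_uni _).1.mem_parabolicGroup⟩,
    (uni_mem_modularGroup_iff K.away).2 K, Subtype.ext ?_, Subtype.ext ?_⟩
  · change tor p ![0, 0, -1] * ((repNabla w).elem : simGroup p) = uni K.away * tor p ![0, 0, -1]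
    rw [coe_elem_repNabla]
    refine simGroup_ext fun i j => ?_
    rw [tor_mul_apply, mul_tor_apply, uni_val, uni_val]
    fin_cases i <;> fin_cases j <;>
      simp [uniMatrix, repNabla, torusExp, pzpow_one, pzpow_neg_one]
    field_simp
  · change ((repNabla w).elem : simGroup p) * tor p ![0, 0, 1] = tor p ![0, 0, 1] * uni K.away
    rw [coe_elem_repNabla]
    refine simGroup_ext fun i j => ?_
    rw [tor_mul_apply, mul_tor_apply, uni_val, uni_val]
    fin_cases i <;> fin_cases j <;>
      simp [uniMatrix, repNabla, torusExp, pzpow_one, pzpow_neg_one]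
    field_simp

theorem deg_repNabla (w : UnitFrac p) :
    deg (doubleCoset (parabolicModularGroup p) (repNabla w).elem) = 1 :=
  deg_doubleCoset_of_normal fun _ => repNabla_normal w

theorem lambdaMinus_mul_nabla (hp : Prime (p : GaussianInt)) :
    torusCoset p 0 0 (-1) * nablaReduced p = (p : ℚ) • torusCoset p 0 0 (-1) := by
  rw [nablaReduced, Finset.mul_sum, Finset.sum_congr rfl (g := fun _ => torusCoset p 0 0 (-1)),
    Finset.sum_const, Finset.card_univ, card_unitFrac, ← Nat.cast_smul_eq_nsmul ℚ]
  intro w _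
  obtain ⟨γ, hγ, e, -⟩ := torus_mul_repNabla w
  have e1 : doubleCoset (parabolicModularGroup p) (torus11 p 0 0 (-1) * (repNabla w).elem) =
      torusCoset p 0 0 (-1) :=
    doubleCoset_congr (coset_mem_cosetsIn_iff_linked.2 ⟨γ, hγ, 1, one_mem _, by rw [e, mul_one]⟩)
  rw [lambdaMinus_mul hp, e1, deg_lambdaMinus hp, deg_repNabla, div_one, one_smul]

theorem nabla_mul_lambdaPlus (hp : Prime (p : GaussianInt)) :
    nablaReduced p * torusCoset p 0 0 1 = (p : ℚ) • torusCoset p 0 0 1 := by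
  have hp0 := cast_p_ne_zero p
  rw [nablaReduced, Finset.sum_mul, Finset.sum_congr rfl (g := fun _ => torusCoset p 0 0 1),
    Finset.sum_const, Finset.card_univ, card_unitFrac, ← Nat.cast_smul_eq_nsmul ℚ]
  intro w _
  obtain ⟨γ, hγ, -, e⟩ := torus_mul_repNabla w
  have e1 : doubleCoset (parabolicModularGroup p) ((repNabla w).elem * torus11 p 0 0 1) =
      torusCoset p 0 0 1 :=
    doubleCoset_congr (coset_mem_cosetsIn_iff_linked.2 ⟨1, one_mem _, γ, hγ, by rw [e, one_mul]⟩)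
  rw [mul_lambdaPlus hp, e1, deg_lambdaPlus hp, deg_repNabla, one_mul,
    div_self (pow_ne_zero _ hp0), one_smul]

theorem tor_mul_uni_symmetric {s s' : ℚ} (H : ParamsMem (gaussIntegersAway p) 0 0 s 0)
    (H' : ParamsMem (gaussIntegersAway p) 0 0 s' 0) {m : Fin 3 → ℤ}
    (h : (s' : GaussField) = pzpow p (m 0 - 2 * m 1) * s) :
    tor p m * uni H = uni H' * tor p m := by
  have e : pzpow p (m 0 - m 1) = pzpow p (m 0 - 2 * m 1) * pzpow p (m 1) := by
    rw [← pzpow_add]; congr 1; ring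
  refine simGroup_ext fun i j => ?_
  rw [tor_mul_apply, mul_tor_apply, uni_val, uni_val]
  fin_cases i <;> fin_cases j <;> simp [uniMatrix, torusExp]
  rw [h]
  linear_combination (s : GaussField) * e

theorem uni_symmetric_mul {s s' : ℚ} (H : ParamsMem (gaussIntegersAway p) 0 0 s 0)
    (H' : ParamsMem (gaussIntegersAway p) 0 0 s' 0)
    (K : ParamsMem (gaussIntegersAway p) 0 0 (s + s') 0) : uni H * uni H' = uni K := by
  refine simGroup_ext fun i j => ?_
  rw [simGroup_val_mul, uni_val, uni_val, uni_val, uniMatrix_mul]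
  simp

/-- The products of two representatives of `T₋`, reduced by the central element. -/
def minusProduct (ij : (Unit ⊕ UnitFrac p) × (Unit ⊕ UnitFrac p)) : parabolicGroup p :=
  (repMinus ij.1).elem * (repMinus ij.2).elem * torus11 p (-2) (-1) (-1)

theorem coe_repMinus_inl :
    ((repMinus (p := p) (.inl ())).elem : simGroup p) = tor p ![1, 0, 0] := by
  rw [ReducedRep.coe_elem]
  refine simGroup_ext fun i j => ?_
  rw [mul_tor_apply, tor_apply, uni_val]
  fin_cases i <;> fin_cases j <;> simp [repMinus, uniMatrix, torusExp]

theorem coe_repMinus_inr (s : UnitFrac p) :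
    ((repMinus (p := p) (.inr s)).elem : simGroup p) = uni s.symmetric_mem * tor p ![1, 1, 0] := rfl

theorem tor_mul_tor_vec (d e f d' e' f' : ℤ) :
    tor p ![d, e, f] * tor p ![d', e', f'] = tor p ![d + d', e + e', f + f'] := by
  rw [← tor_add]; simp

theorem linked_minusProduct_inl_inl :
    Linked (parabolicModular p) (minusProduct (p := p) (.inl (), .inl ()) : simGroup p)
      (tor p ![0, 1, -1]) := by
  change Linked _ (((repMinus (p := p) (.inl ())).elem : simGroup p) *
    ((repMinus (p := p) (.inl ())).elem : simGroup p) * tor p ![-2, -1, -1]) _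
  rw [coe_repMinus_inl, tor_mul_tor_vec, tor_mul_tor_vec]
  simpa using linked_tor_swap_zero_two (p := p) 0 (-1) (-1)

theorem coset_minusProduct_inl_inr (t : UnitFrac p) :
    coset (parabolicModularGroup p) (minusProduct (.inl (), .inr t)) =
      coset (parabolicModularGroup p) (torus11 p 0 0 (-1)) := by
  have K : ParamsMem gaussIntegers 0 0 (p * t.1) 0 :=
    ⟨zero_mem _, zero_mem _, by push_cast; exact t.mul_mem, ratCast_zero_mem _⟩
  have e : minusProduct (.inl (), .inr t) =
      ⟨uni (p := p) K.away, (hasDiag_uni _).1.mem_parabolicGroup⟩ * torus11 p 0 0 (-1) := by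
    refine Subtype.ext ?_
    change ((repMinus (p := p) (.inl ())).elem : simGroup p) *
      ((repMinus (p := p) (.inr t)).elem : simGroup p) * tor p ![-2, -1, -1] =
      uni (p := p) K.away * tor p ![0, 0, -1]
    rw [coe_repMinus_inl, coe_repMinus_inr, ← mul_assoc, tor_mul_uni_symmetric _ K.away, mul_assoc,
      mul_assoc, tor_mul_tor_vec, tor_mul_tor_vec]
    · norm_num
    · simp [pzpow_one]
  rw [e]
  exact coset_mul_left (Γ := parabolicModularGroup p) ((uni_mem_modularGroup_iff K.away).2 K) _

theorem coe_minusProduct_inr_inl (s : UnitFrac p) :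
    (minusProduct (.inr s, .inl ()) : simGroup p) = uni s.symmetric_mem * tor p ![0, 0, -1] := by
  change ((repMinus (p := p) (.inr s)).elem : simGroup p) *
      ((repMinus (p := p) (.inl ())).elem : simGroup p) * tor p ![-2, -1, -1] = _
  rw [coe_repMinus_inl, coe_repMinus_inr, mul_assoc, mul_assoc, tor_mul_tor_vec, tor_mul_tor_vec]
  norm_num

theorem minusProduct_zero_inl {s : UnitFrac p} (hs : s.1 = 0) :
    minusProduct (.inr s, .inl ()) = torus11 p 0 0 (-1) := by
  refine Subtype.ext ?_
  rw [coe_minusProduct_inr_inl]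
  change _ = tor p ![0, 0, -1]
  refine simGroup_ext fun i j => ?_
  rw [mul_tor_apply, tor_apply, uni_val, hs]
  fin_cases i <;> fin_cases j <;> simp [uniMatrix, torusExp]

theorem linked_minusProduct_inr_inl (hp : Prime (p : GaussianInt)) {s : UnitFrac p}
    (hs : s.1 ≠ 0) :
    Linked (parabolicModular p) (minusProduct (.inr s, .inl ()) : simGroup p)
      (tor p ![0, 1, -1]) := by
  obtain ⟨x, hx, hd⟩ := UnitFrac.exists_not_dvd hs
  obtain ⟨γ, hγ, δ, hδ, e⟩ := linked_uni_symmetric s.symmetric_mem hx hd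
  have hn := lambdaMinus_normal hp (γ := ⟨γ, hγ.2⟩) hγ.1
  refine ⟨tor p ![0, 0, -1] * γ * (tor p ![0, 0, -1])⁻¹, ⟨hn,
    (torus11 p 0 0 (-1) * (⟨γ, hγ.2⟩ : parabolicGroup p) * (torus11 p 0 0 (-1))⁻¹).2⟩, δ, hδ, ?_⟩
  have e2 : tor p ![0, 1, -1] = tor p ![0, 0, -1] * tor p ![0, 1, 0] := by
    rw [tor_mul_tor_vec]; norm_num
  rw [coe_minusProduct_inr_inl, ← tor_mul_uni_symmetric s.symmetric_mem, e, e2]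
  · group
  · simp [pzpow_zero]

theorem linked_minusProduct_inr_inr (s t : UnitFrac p) :
    Linked (parabolicModular p) (minusProduct (.inr s, .inr t) : simGroup p)
      (tor p ![0, 1, -1]) := by
  have K : ParamsMem (gaussIntegersAway p) 0 0 ((p : ℚ)⁻¹ * t.1) 0 := by
    refine ⟨zero_mem _, zero_mem _, ?_, ratCast_zero_mem _⟩
    have := mul_mem (pzpow_mem_away (p := p) (-1)) t.mem_away
    rw [pzpow_neg_one] at this
    push_cast
    exact this
  have K' : ParamsMem (gaussIntegersAway p) 0 0 (s.1 + (p : ℚ)⁻¹ * t.1) 0 := by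
    refine ⟨zero_mem _, zero_mem _, ?_, ratCast_zero_mem _⟩
    rw [Rat.cast_add]
    exact add_mem s.mem_away K.2.2.1
  have hP := natCast_p_ne_zero (p := p)
  have e : (minusProduct (.inr s, .inr t) : simGroup p) = uni K' * tor p ![0, 1, -1] := by
    change ((repMinus (p := p) (.inr s)).elem : simGroup p) *
        ((repMinus (p := p) (.inr t)).elem : simGroup p) * tor p ![-2, -1, -1] = _
    rw [coe_repMinus_inr, coe_repMinus_inr, ← uni_symmetric_mul s.symmetric_mem K K',
      mul_assoc (uni s.symmetric_mem), ← mul_assoc (tor p ![1, 1, 0]),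
      tor_mul_uni_symmetric t.symmetric_mem K, mul_assoc, mul_assoc, mul_assoc,
      tor_mul_tor_vec, tor_mul_tor_vec, mul_assoc]
    · norm_num
    · norm_num [pzpow_neg_one]
  rw [e]
  refine linked_uni_mul_tor _ ?_ ?_ ?_ ?_ <;> simp [zero_mem]
  have e2 : pzpow p 2 * ((s.1 : GaussField) + (p : GaussField)⁻¹ * t.1) =
      p * (p * s.1) + p * t.1 := by
    rw [show (2 : ℤ) = 1 + 1 by rfl, pzpow_add, pzpow_one]
    field_simp
  rw [e2]
  exact add_mem (mul_mem (natCast_mem _ p) s.mul_mem) t.mul_mem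

theorem isSumOf_minusProduct (hp : Prime (p : GaussianInt)) :
    IsSumOf ((((Delta p)⁻¹ : (Hecke11 p)ˣ) : Hecke11 p) * TMinus p * TMinus p)
      (minusProduct (p := p)) := by
  rw [mul_assoc, delta_inv_comm]
  have h := ((isSumOf_TMinus hp).mul (isSumOf_TMinus hp)).mul
    (isSumOf_central (Γ := parabolicModularGroup p) (torus11_central p (-1)))
  have h2 : IsSumOf (TMinus p * TMinus p * (((Delta p)⁻¹ : (Hecke11 p)ˣ) : Hecke11 p)) _ := h
  rw [IsSumOf, h2, Fintype.sum_prod_type]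
  refine Finset.sum_congr rfl fun i _ => ?_
  rw [Finset.univ_unique, Finset.sum_singleton]
  rfl

/-- Of the (p+1)² products of representatives, p + 1 give the coset of Δ⁻¹Λ₋: those of type (inl,
inr t), and (inr 0, inl). The other p(p+1) lie in the double coset of `torus11 p 0 1 (-1)`, which
also carries Δ⁻¹Λ₋·τ with degree p³(p+1). The ratio of degrees is p⁻². -/
theorem delta_inv_mul_TMinus_mul_TMinus (hp : Prime (p : GaussianInt)) :
    ((Delta p)⁻¹ : (Hecke11 p)ˣ) * TMinus p * TMinus p =
      ((p : ℚ) ^ (-2 : ℤ)) • (torusCoset p 0 0 (-1) * torusCoset p 0 1 0) +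
        ((p : ℚ) + 1) • torusCoset p 0 0 (-1) := by
  classical
  set V := (((Delta p)⁻¹ : (Hecke11 p)ˣ) : Hecke11 p) * TMinus p * TMinus p -
    ((p : ℚ) + 1) • torusCoset p 0 0 (-1) with hV
  obtain ⟨s₀, hs₀⟩ := exists_unitFrac (n := p) reduced_rat_zero (by simp [zero_mem])
  have htm : toSum (torusCoset p 0 0 (-1)) =
      Finsupp.single (coset (parabolicModularGroup p) (torus11 p 0 0 (-1))) 1 := by
    refine Finsupp.ext fun c => ?_
    rw [toSum_doubleCoset, Finsupp.single_apply]
    refine if_congr ?_ rfl rfl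
    rw [cosetsIn_of_normal fun γ => lambdaMinus_normal hp]
    exact eq_comm
  have hsum : toSum V =
      Finsupp.single (coset (parabolicModularGroup p) (minusProduct (.inl (), .inl ()))) 1 +
      ∑ s ∈ Finset.univ.erase s₀,
        Finsupp.single (coset (parabolicModularGroup p) (minusProduct (.inr s, .inl ()))) 1 +
      ∑ s : UnitFrac p, ∑ t : UnitFrac p,
        Finsupp.single (coset (parabolicModularGroup p) (minusProduct (.inr s, .inr t))) 1 := by
    rw [hV, map_sub, map_smul, htm, isSumOf_minusProduct hp, Fintype.sum_prod_type,
      Fintype.sum_sum_type, Finset.univ_unique, Finset.sum_singleton, Fintype.sum_sum_type,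
      Finset.univ_unique, Finset.sum_singleton]
    simp only [Fintype.sum_sum_type, Finset.univ_unique, Finset.sum_singleton, PUnit.default_eq_unit,
      coset_minusProduct_inl_inr, Finset.sum_const, Finset.card_univ, card_unitFrac,
      Finset.sum_add_distrib]
    rw [← Finset.add_sum_erase _ (fun s => Finsupp.single (coset (parabolicModularGroup p)
      (minusProduct (.inr s, .inl ()))) (1 : ℚ)) (Finset.mem_univ s₀), minusProduct_zero_inl hs₀,
      add_smul, one_smul, ← Nat.cast_smul_eq_nsmul ℚ]
    abel
  have hsupp : ∀ g, coeff V g ≠ 0 →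
      coset (parabolicModularGroup p) g ∈ cosetsIn (parabolicModularGroup p) (torus11 p 0 1 (-1)) := by
    intro g hg
    by_contra hne
    have key (x : parabolicGroup p)
        (hx : Linked (parabolicModular p) (x : simGroup p) (tor p ![0, 1, -1])) :
        Finsupp.single (coset (parabolicModularGroup p) x) (1 : ℚ)
          (coset (parabolicModularGroup p) g) = 0 := by
      refine Finsupp.single_eq_of_ne fun h => hne ?_
      rw [h]
      exact coset_mem_cosetsIn_iff_linked.2 (linked_subgroupOf_iff.2 hx)
    refine hg ?_
    change toSum V _ = 0
    rw [hsum, Finsupp.add_apply, Finsupp.add_apply, key _ linked_minusProduct_inl_inl,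
      Finsupp.finsetSum_apply, Finsupp.finsetSum_apply, Finset.sum_eq_zero, Finset.sum_eq_zero]
    · simp
    · intro s _
      rw [Finsupp.finsetSum_apply]
      exact Finset.sum_eq_zero fun t _ => key _ (linked_minusProduct_inr_inr s t)
    · intro s hs
      refine key _ (linked_minusProduct_inr_inl hp fun h0 => ?_)
      exact Finset.ne_of_mem_erase hs (Subtype.ext (h0.trans hs₀.symm))
  have hdeg : deg V = p * (p + 1) := by
    have hz : deg (((Delta p)⁻¹ : (Hecke11 p)ˣ) : Hecke11 p) = 1 :=
      deg_doubleCoset_of_normal (Γ := parabolicModularGroup p)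
        (g := torus11 p (2 * (-1)) (-1) (-1)) fun γ hγ => by
          rw [torus11_central]; simpa using hγ
    rw [hV, map_sub, map_smul, deg_mul, deg_mul, deg_TMinus hp, deg_lambdaMinus hp, hz, smul_eq_mul]
    ring
  have hp0 := cast_p_ne_zero p
  have hVM := eq_smul_doubleCoset hsupp
  rw [hdeg] at hVM
  have hLV : (((Delta p)⁻¹ : (Hecke11 p)ˣ) : Hecke11 p) * TMinus p * TMinus p =
      V + ((p : ℚ) + 1) • torusCoset p 0 0 (-1) := by rw [hV, sub_add_cancel]
  rw [hLV, hVM, lambdaMinus_mul_tau hp, smul_smul, zpow_neg]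
  congr 2
  have e : (p : ℚ) ^ (2 : ℤ) = (p : ℚ) ^ 2 := rfl
  rw [e]
  field_simp

end Relations

/-! ### The mirror relation for T₊ and the images under ε -/

section AdjointRelation

open HeckeAlgebra

variable {p : ℕ} [Fact p.Prime]

theorem adj_torusCoset (d e f : ℤ) : adj (torusCoset p d e f) = torusCoset p (-d) (-e) (-f) := by
  rw [adj_doubleCoset, torus11_inv]

theorem torusCoset_swap (d e f : ℤ) : torusCoset p d e f = torusCoset p d (d - e) f :=
  doubleCoset_congr_of_linked (linked_tor_swap_zero_two d e f)

/-- Apply the anti-involution to the relation for T₋². It sends T₋ to Δ⁻¹T₊ and Δ⁻¹ to Δ, fixes τ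
and exchanges Δ⁻¹Λ₋ and Δ⁻¹Λ₊; one power of Δ cancels. -/
theorem delta_inv_mul_TPlus_mul_TPlus (hp : Prime (p : GaussianInt)) :
    (((Delta p)⁻¹ : (Hecke11 p)ˣ) : Hecke11 p) * TPlus p * TPlus p =
      ((p : ℚ) ^ (-2 : ℤ)) • (torusCoset p 0 1 0 * torusCoset p 0 0 1) +
        ((p : ℚ) + 1) • torusCoset p 0 0 1 := by
  have h := congrArg adj (delta_inv_mul_TMinus_mul_TMinus hp)
  rw [adj_add, adj_smul, adj_smul, adj_mul, adj_mul, adj_mul] at h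
  have hT : adj (TMinus p) = (((Delta p)⁻¹ : (Hecke11 p)ˣ) : Hecke11 p) * TPlus p := by
    have e1 : adj (TMinus p) = torusCoset p (-1) (-1) (-0) := adj_torusCoset 1 1 0
    have e2 := delta_inv_mul_torusCoset (p := p) 1 1 1
    rw [e1, torusCoset_swap]
    exact e2.symm
  have hz : adj (((Delta p)⁻¹ : (Hecke11 p)ˣ) : Hecke11 p) = ((Delta p : (Hecke11 p)ˣ) : Hecke11 p) :=
    adj_torusCoset (2 * (-1)) (-1) (-1)
  have e1 := torusCoset_swap (p := p) 0 (-1) 0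
  rw [hT, hz, adj_torusCoset, adj_torusCoset] at h
  norm_num at h e1
  rw [e1] at h
  have h3 : (((Delta p)⁻¹ : (Hecke11 p)ˣ) : Hecke11 p) * TPlus p *
      ((((Delta p)⁻¹ : (Hecke11 p)ˣ) : Hecke11 p) * TPlus p * ((Delta p : (Hecke11 p)ˣ) : Hecke11 p)) =
      (((Delta p)⁻¹ : (Hecke11 p)ˣ) : Hecke11 p) * TPlus p * TPlus p := by
    rw [delta_inv_comm (TPlus p), mul_assoc (TPlus p) _ (Delta p : Hecke11 p), Units.inv_mul, mul_one]
  rw [← h3, h]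
  norm_num

theorem reduced_lambdaMinus : (((Delta p)⁻¹ : (Hecke11 p)ˣ) : Hecke11 p) * LambdaMinus p =
    torusCoset p 0 0 (-1) :=
  delta_inv_mul_torusCoset 2 1 0

theorem reduced_lambdaPlus : (((Delta p)⁻¹ : (Hecke11 p)ˣ) : Hecke11 p) * LambdaPlus p =
    torusCoset p 0 0 1 :=
  delta_inv_mul_torusCoset 2 1 2

theorem reduced_TJ : reduced p (TJ p) = torusCoset p 0 1 0 := delta_inv_mul_torusCoset 2 2 1

theorem reduced_nabla : reduced p (Nabla p) = nablaReduced p := by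
  have hP := natCast_p_ne_zero (p := p)
  rw [reduced, Nabla, Finset.mul_sum, nablaReduced, Finset.sum_range,
    ← Equiv.sum_comp (unitFracEquiv p)]
  refine Finset.sum_congr rfl fun i _ => ?_
  rw [delta_inv_mul]
  congr 1
  refine Subtype.ext ?_
  rw [coe_elem_repNabla]
  change tor p ![-2, -1, -1] * nablaMatrix p _ = _
  refine simGroup_ext fun k l => ?_
  rw [tor_mul_apply, uni_val]
  fin_cases k <;> fin_cases l <;>
    simp [nablaMatrix, simOfMatrix, uniMatrix, repNabla, torusExp, pzpow_neg_one, unitFracEquiv_val,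
      hP]
  field_simp

theorem parabolicEmbedding_modularT (hp : Prime (p : GaussianInt)) :
    parabolicEmbedding p (modularT p) = TPlus p + TMinus p := by
  rw [add_comm]
  have h := (isSumOf_modularT hp).heckeEmbedding
    (e := fun i => (Sum.elim (repMinus (p := p)) repPlus i).elem)
  refine h.eq (?_ : IsSumOf _ _)
  convert (isSumOf_TMinus hp).add (isSumOf_TPlus hp) using 2 with i
  rcases i with i | i <;> rfl

theorem parabolicEmbedding_modularTJ (hp : Prime (p : GaussianInt)) :
    parabolicEmbedding p (modularTJ p) = torusCoset p 0 0 (-1) +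
      (torusCoset p 0 0 1 + (torusCoset p 0 1 0 + nablaReduced p)) := by
  have h := (isSumOf_modularTJ hp).heckeEmbedding (e := fun i => (repTJ (p := p) i).elem)
  refine h.eq (?_ : IsSumOf _ _)
  convert (isSumOf_lambdaMinus hp).add ((isSumOf_lambdaPlus hp).add
    ((isSumOf_tau hp).add isSumOf_nablaReduced)) using 2 with i
  rcases i with i | i | i | i <;> rfl

theorem tor_central (g : simGroup p) : tor p ![-2, -1, -1] * g = g * tor p ![-2, -1, -1] := by
  refine simGroup_ext fun i j => ?_
  rw [tor_mul_apply, mul_tor_apply, mul_comm]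
  congr 2
  fin_cases i <;> fin_cases j <;> rfl

/-- The double coset of `p⁻¹`. -/
def modularCentral (p : ℕ) [Fact p.Prime] : Hecke2 p :=
  doubleCoset (modularGroup p) (tor p ![-2, -1, -1])

theorem parabolicEmbedding_modularCentral :
    parabolicEmbedding p (modularCentral p) = (((Delta p)⁻¹ : (Hecke11 p)ˣ) : Hecke11 p) := by
  have h := (isSumOf_central (Γ := modularGroup p) (tor_central (p := p))).heckeEmbedding
    (e := fun _ : Unit => torus11 p (-2) (-1) (-1))
  exact h.eq (isSumOf_central (Γ := parabolicModularGroup p) (torus11_central p (-1)))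

end AdjointRelation

/-! ### Satake images of the generators -/

section SatakeImages

open HeckeAlgebra

variable {p : ℕ}

/-- The scalar `c` in the ring of Laurent polynomials. -/
abbrev laurentC (c : ℚ) : LaurentRing := algebraMap ℚ LaurentRing c

theorem satakeMonomial_eq_of {m : Fin 3 → ℤ} {i : Fin 3} {c : ℚ} {k : ℤ} (hm : m = Pi.single i k)
    (hc : (((p : ℚ) ^ 2) ^ (-1 : ℤ)) ^ (m 1) * (((p : ℚ) ^ 2) ^ (-2 : ℤ)) ^ (m 2) = c) :
    satakeMonomial p m = laurentC c * AddMonoidAlgebra.single (Pi.single i k) 1 := by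
  rw [satakeMonomial, hc, laurentC, ← Algebra.smul_def, AddMonoidAlgebra.smul_single, hm]
  simp

variable [Fact p.Prime]

theorem HeckeAlgebra.IsSumOf.satake_eq {ι : Type*} [Fintype ι] {v : Hecke2 p} {r : ι → ReducedRep p}
    (h : IsSumOf v fun i => ((r i).elem : simGroup p)) :
    satake p v = ∑ i, satakeMonomial p (r i).m := by
  rw [satake_apply, h, map_sum]
  refine Finset.sum_congr rfl fun i _ => ?_
  rw [satakeSum_single, one_smul, (r i).hasDiag.satakeCoset_eq]

theorem laurentX_mul_inv (i : Fin 3) : laurentX i * laurentXInv i = 1 := by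
  rw [laurentX, laurentXInv, AddMonoidAlgebra.single_mul_single, ← Pi.single_add]
  simp [AddMonoidAlgebra.one_def]

theorem satakeMonomial_vec (a b c : ℤ) : satakeMonomial p ![a, b, c] =
    satakeMonomial p ![a, 0, 0] * satakeMonomial p ![0, b, 0] * satakeMonomial p ![0, 0, c] := by
  rw [← satakeMonomial_add, ← satakeMonomial_add]
  simp

theorem satakeMonomial_values :
    satakeMonomial p ![0, 0, 0] = 1 ∧
    satakeMonomial p ![1, 0, 0] = laurentX 0 ∧
    satakeMonomial p ![-2, 0, 0] = laurentXInv 0 * laurentXInv 0 ∧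
    satakeMonomial p ![0, 1, 0] = laurentC (p : ℚ)⁻¹ ^ 2 * laurentX 1 ∧
    satakeMonomial p ![0, -1, 0] = laurentC p ^ 2 * laurentXInv 1 ∧
    satakeMonomial p ![0, 0, 1] = laurentC (p : ℚ)⁻¹ ^ 4 * laurentX 2 ∧
    satakeMonomial p ![0, 0, -1] = laurentC p ^ 4 * laurentXInv 2 := by
  have hp0 := cast_p_ne_zero p
  refine ⟨?_, ?_, ?_, ?_, ?_, ?_, ?_⟩
  · rw [← satakeMonomial_zero (p := p)]
    congr 1
    ext i; fin_cases i <;> rfl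
  · rw [satakeMonomial_eq_of (i := 0) (k := 1) (c := 1), laurentC, map_one, one_mul]
    · rfl
    · ext i; fin_cases i <;> rfl
    · simp
  · rw [satakeMonomial_eq_of (i := 0) (k := -2) (c := 1), laurentC, map_one, one_mul, laurentXInv,
      AddMonoidAlgebra.single_mul_single, ← Pi.single_add]
    · norm_num
    · ext i; fin_cases i <;> rfl
    · simp
  · rw [satakeMonomial_eq_of (i := 1) (k := 1) (c := (p : ℚ)⁻¹ ^ 2), laurentC, map_pow]
    · rfl
    · ext i; fin_cases i <;> rfl
    · simp
  · rw [satakeMonomial_eq_of (i := 1) (k := -1) (c := (p : ℚ) ^ 2), laurentC, map_pow]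
    · rfl
    · ext i; fin_cases i <;> rfl
    · simp
  · rw [satakeMonomial_eq_of (i := 2) (k := 1) (c := (p : ℚ)⁻¹ ^ 4), laurentC, map_pow]
    · rfl
    · ext i; fin_cases i <;> rfl
    · simp [zpow_neg]
      norm_cast
      ring
  · rw [satakeMonomial_eq_of (i := 2) (k := -1) (c := (p : ℚ) ^ 4), laurentC, map_pow]
    · rfl
    · ext i; fin_cases i <;> rfl
    · simp [zpow_neg]
      norm_cast
      ring

/-- `p⁻¹ xᵢ + p xᵢ⁻¹`. -/
def satakeRoot (p : ℕ) (i : Fin 3) : LaurentRing :=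
  laurentC (p : ℚ)⁻¹ * laurentX i + laurentC p * laurentXInv i

theorem laurentC_mul_inv : laurentC (p : ℚ) * laurentC (p : ℚ)⁻¹ = 1 := by
  rw [← map_mul, mul_inv_cancel₀ (cast_p_ne_zero p), map_one]

theorem laurentC_natCast (n : ℕ) : laurentC (n : ℚ) = n := map_natCast _ n

/-- The exponents (1,0,0), (1,1,0), (1,0,1), (1,1,1) occur 1, p, p³ and p⁴ times; with the
normalising powers of p the sum becomes a product. -/
theorem satake_modularT (hp : Prime (p : GaussianInt)) : satake p (modularT p) =
    laurentX 0 * (1 + laurentC (p : ℚ)⁻¹ * laurentX 1) * (1 + laurentC (p : ℚ)⁻¹ * laurentX 2) := by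
  obtain ⟨v0, v1, v2, v3, v4, v5, v6⟩ := satakeMonomial_values (p := p)
  have hPQ := laurentC_mul_inv (p := p)
  rw [(isSumOf_modularT hp).satake_eq]
  have e1 (x) : (repPlus (p := p) (.inl x)).m = ![1, 0, 1] := rfl
  have e2 (x) : (repPlus (p := p) (.inr x)).m = ![1, 1, 1] := rfl
  simp only [Fintype.sum_sum_type, Sum.elim_inl, Sum.elim_inr, repMinus, e1, e2, Finset.sum_const,
    Finset.card_univ, card_unitFrac, card_gaussUnitFrac, Fintype.card_prod, Fintype.card_unit,
    nsmul_eq_mul]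
  rw [satakeMonomial_vec 1 1 0, satakeMonomial_vec 1 0 1, satakeMonomial_vec 1 1 1, v0, v1, v3, v5]
  push_cast
  rw [← laurentC_natCast p]
  generalize laurentC (p : ℚ) = P at *
  generalize laurentC (p : ℚ)⁻¹ = Q at *
  have h2 : P * Q ^ 2 = Q := by linear_combination Q * hPQ
  have h3 : P ^ 3 * Q ^ 4 = Q := by
    rw [show P ^ 3 * Q ^ 4 = (P * Q) ^ 3 * Q by ring, hPQ, one_pow, one_mul]
  have h4 : P ^ 4 * Q ^ 6 = Q ^ 2 := by
    rw [show P ^ 4 * Q ^ 6 = (P * Q) ^ 4 * Q ^ 2 by ring, hPQ, one_pow, one_mul]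
  linear_combination laurentX 0 * laurentX 1 * h2 + laurentX 0 * laurentX 2 * h3 +
    laurentX 0 * laurentX 1 * laurentX 2 * h4

/-- The constant term counts cosets with trivial exponents: p from ν and p²(p - 1) from τ. The four
nontrivial exponents contribute p²xᵢ and p⁴xᵢ⁻¹. -/
theorem satake_modularTJ (hp : Prime (p : GaussianInt)) : satake p (modularTJ p) =
    laurentC p ^ 3 * (satakeRoot p 1 + satakeRoot p 2) +
      laurentC p * (laurentC p ^ 2 - laurentC p + 1) := by
  obtain ⟨v0, v1, v2, v3, v4, v5, v6⟩ := satakeMonomial_values (p := p)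
  have hPQ := laurentC_mul_inv (p := p)
  rw [(isSumOf_modularTJ hp).satake_eq]
  have h1 : 1 ≤ p := (Fact.out : p.Prime).one_le
  have e1 (x) : (repTau (p := p) (.inl (.inr x))).m = ![0, 1, 0] := rfl
  have e2 (x) : (repTau (p := p) (.inr x)).m = ![0, 0, 0] := rfl
  have e3 (x) : (repTau (p := p) (.inl (.inl x))).m = ![0, -1, 0] := rfl
  have e4 (x) : (repLambdaPlus (p := p) x).m = ![0, 0, 1] := rfl
  simp only [repTJ, Fintype.sum_sum_type, Sum.elim_inl, Sum.elim_inr, repLambdaMinus, repNabla, e1,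
    e2, e3, e4, Finset.sum_const, Finset.card_univ, card_unitFrac, card_gaussUnitFrac,
    card_ne_zero_unitFrac, Fintype.card_prod, Fintype.card_unit, nsmul_eq_mul]
  rw [v0, v3, v4, v5, v6, satakeRoot, satakeRoot]
  push_cast [Nat.cast_sub h1]
  rw [← laurentC_natCast p]
  generalize laurentC (p : ℚ) = P at *
  generalize laurentC (p : ℚ)⁻¹ = Q at *
  have h2 : P ^ 3 * Q = P ^ 2 := by linear_combination P ^ 2 * hPQ
  have h3 : P ^ 6 * Q ^ 4 = P ^ 2 := by
    rw [show P ^ 6 * Q ^ 4 = (P * Q) ^ 4 * P ^ 2 by ring, hPQ, one_pow, one_mul]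
  have h4 : P ^ 4 * Q ^ 2 = P ^ 2 := by
    rw [show P ^ 4 * Q ^ 2 = (P * Q) ^ 2 * P ^ 2 by ring, hPQ, one_pow, one_mul]
  linear_combination laurentX 1 * (h4 - h2) + laurentX 2 * (h3 - h2)

theorem satake_modularCentral : satake p (modularCentral p) = laurentXInv 0 * laurentXInv 0 *
    (laurentC p ^ 2 * laurentXInv 1) * (laurentC p ^ 4 * laurentXInv 2) := by
  obtain ⟨v0, v1, v2, v3, v4, v5, v6⟩ := satakeMonomial_values (p := p)
  rw [satake_apply, modularCentral, doubleCoset_central _ tor_central, satakeSum_single, one_smul,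
    (hasDiag_tor _).satakeCoset_eq, satakeMonomial_vec, v2, v4, v6]

/-- Rests on p·xᵢ⁻¹(1 + p⁻¹xᵢ)² = rᵢ + 2 for each i; the powers of x₀ cancel against the central
element. This is how r₁r₂ becomes accessible inside H_p². -/
theorem satake_central_mul_square (hp : Prime (p : GaussianInt)) :
    satake p (modularCentral p * (modularT p * modularT p)) =
      laurentC p ^ 4 * (satakeRoot p 1 + 2) * (satakeRoot p 2 + 2) := by
  rw [satake_mul hp, satake_mul hp, satake_modularT hp, satake_modularCentral, satakeRoot,
    satakeRoot]
  have hPQ := laurentC_mul_inv (p := p)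
  have h0 := laurentX_mul_inv 0
  have h1 := laurentX_mul_inv 1
  have h2 := laurentX_mul_inv 2
  generalize laurentC (p : ℚ) = P at *
  generalize laurentC (p : ℚ)⁻¹ = Q at *
  generalize laurentX 0 = x at *
  generalize laurentX 1 = y at *
  generalize laurentX 2 = w at *
  generalize laurentXInv 0 = x' at *
  generalize laurentXInv 1 = y' at *
  generalize laurentXInv 2 = w' at *
  have key {y y' : LaurentRing} (h : y * y' = 1) :
      P * y' * (1 + Q * y) ^ 2 = Q * y + P * y' + 2 := by
    linear_combination (2 * y * y' + Q * y ^ 2 * y') * hPQ + (2 + Q * y) * h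
  have e1 := key h1
  have e2 := key h2
  calc _ = (x * x') ^ 2 * P ^ 4 * (P * y' * (1 + Q * y) ^ 2) * (P * w' * (1 + Q * w) ^ 2) := by ring
    _ = _ := by rw [h0, e1, e2]; ring

/-- The linear coefficient of the standard polynomial, up to sign. -/
def standardCoeff (p : ℕ) [Fact p.Prime] : Hecke2 p :=
  ((p : ℚ) ^ (-3 : ℤ)) • (modularTJ p - ((p : ℚ) * ((p : ℚ) ^ 2 - p + 1)) • 1)

/-- The standard polynomial. -/
def standardPolynomial (p : ℕ) [Fact p.Prime] : (Hecke2 p)[X] :=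
  1 - C (standardCoeff p) * X +
    C (((p : ℚ) ^ (-4 : ℤ)) • (modularCentral p * (modularT p * modularT p)) -
      (2 : ℚ) • standardCoeff p - (2 : ℚ) • 1) * X ^ 2 -
    C (standardCoeff p) * X ^ 3 + X ^ 4

theorem satake_standardCoeff (hp : Prime (p : GaussianInt)) :
    satake p (standardCoeff p) = satakeRoot p 1 + satakeRoot p 2 := by
  have hPQ := laurentC_mul_inv (p := p)
  have e3 : (p : ℚ) ^ (-3 : ℤ) = (p : ℚ)⁻¹ ^ 3 := by rw [zpow_neg, inv_pow]; rfl
  rw [standardCoeff, map_smul, map_sub, map_smul, satake_modularTJ hp, satake_one,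
    Algebra.smul_def, Algebra.smul_def, e3]
  simp only [map_mul, map_add, map_sub, map_pow, map_one, mul_one]
  have h : laurentC (p : ℚ)⁻¹ ^ 3 * laurentC (p : ℚ) ^ 3 = 1 := by
    rw [← mul_pow, mul_comm, hPQ, one_pow]
  linear_combination (satakeRoot p 1 + satakeRoot p 2) * h

end SatakeImages

/-! ### Existence and uniqueness of the standard polynomial -/

section StandardPolynomial

variable {A B : Type*} [Ring A] [Ring B] [Module ℚ A] [Module ℚ B]

theorem coeff_mapCoeffs (f : A →ₗ[ℚ] B) (P : A[X]) (n : ℕ) :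
    (mapCoeffs f P).coeff n = f (P.coeff n) := by
  rw [mapCoeffs, finsetSum_coeff]
  simp only [coeff_monomial]
  rw [Finset.sum_ite_eq' P.support n fun k => f (P.coeff k)]
  split_ifs with h
  · rfl
  · rw [notMem_support_iff.1 h, map_zero]

theorem mapCoeffs_quartic {f : A →ₗ[ℚ] B} (hf : f 1 = 1) (a b : A) :
    mapCoeffs f (1 - C a * X + C b * X ^ 2 - C a * X ^ 3 + X ^ 4) =
      1 - C (f a) * X + C (f b) * X ^ 2 - C (f a) * X ^ 3 + X ^ 4 := by
  ext n
  rw [coeff_mapCoeffs]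
  simp only [coeff_add, coeff_sub, coeff_C_mul, coeff_X_pow, coeff_X, coeff_one, map_add, map_sub]
  split_ifs <;> simp [hf]

variable {p : ℕ} [Fact p.Prime]

/-- After the substitution the coefficients p⁻¹xᵢ and p·xᵢ⁻¹ are inverse to each other, so each pair
of factors is 1 - rᵢX + X². The middle coefficient r₁r₂ + 2 equals (r₁+2)(r₂+2) - 2(r₁+r₂) - 2. -/
theorem isStandardPolynomial_standardPolynomial (hp : Prime (p : GaussianInt)) :
    IsStandardPolynomial p (standardPolynomial p) := by
  have hp0 := cast_p_ne_zero p
  have hPQ := laurentC_mul_inv (p := p)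
  have e3 : (p : ℚ) ^ (-3 : ℤ) = (p : ℚ)⁻¹ ^ 3 := by rw [zpow_neg, inv_pow]; rfl
  have e4 : (p : ℚ) ^ (-4 : ℤ) = (p : ℚ)⁻¹ ^ 4 := by rw [zpow_neg, inv_pow]; rfl
  have hb : satake p (((p : ℚ) ^ (-4 : ℤ)) • (modularCentral p * (modularT p * modularT p)) -
      (2 : ℚ) • standardCoeff p - (2 : ℚ) • 1) = satakeRoot p 1 * satakeRoot p 2 + 2 := by
    have h : laurentC (p : ℚ)⁻¹ ^ 4 * laurentC (p : ℚ) ^ 4 = 1 := by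
      rw [← mul_pow, mul_comm, hPQ, one_pow]
    rw [map_sub, map_sub, map_smul, map_smul, map_smul, satake_central_mul_square hp,
      satake_standardCoeff hp, satake_one, Algebra.smul_def, Algebra.smul_def, Algebra.smul_def,
      e4, map_pow]
    simp only [map_ofNat]
    linear_combination (satakeRoot p 1 + 2) * (satakeRoot p 2 + 2) * h
  rw [IsStandardPolynomial, standardPolynomial, mapCoeffs_quartic satake_one, hb,
    satake_standardCoeff hp]
  have c2 : laurentC ((p : ℚ) ^ 2) * laurentC ((p : ℚ) ^ (-3 : ℤ)) = laurentC (p : ℚ)⁻¹ := by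
    rw [← map_mul, e3]; congr 1; field_simp
  have c4 : laurentC ((p : ℚ) ^ 4) * laurentC ((p : ℚ) ^ (-3 : ℤ)) = laurentC (p : ℚ) := by
    rw [← map_mul, e3]; congr 1; field_simp
  have key (i : Fin 3) : ((1 - C (((p : ℚ) ^ 2) • laurentX i) * X) *
      (1 - C (((p : ℚ) ^ 4) • laurentXInv i) * X)).comp
        (C (algebraMap ℚ LaurentRing ((p : ℚ) ^ (-3 : ℤ))) * X) =
      1 - C (satakeRoot p i) * X + X ^ 2 := by
    have h1 := laurentX_mul_inv i
    have d2 : C (((p : ℚ) ^ 2) • laurentX i) * C (laurentC ((p : ℚ) ^ (-3 : ℤ))) =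
        C (laurentC (p : ℚ)⁻¹ * laurentX i) := by
      rw [← C_mul, ← c2, Algebra.smul_def]; congr 1; ring
    have d4 : C (((p : ℚ) ^ 4) • laurentXInv i) * C (laurentC ((p : ℚ) ^ (-3 : ℤ))) =
        C (laurentC (p : ℚ) * laurentXInv i) := by
      rw [← C_mul, ← c4, Algebra.smul_def]; congr 1; ring
    have d : C (laurentC (p : ℚ)⁻¹ * laurentX i) * C (laurentC (p : ℚ) * laurentXInv i) =
        (1 : LaurentRing[X]) := by
      rw [← C_mul, ← C_1]
      congr 1
      linear_combination laurentX i * laurentXInv i * hPQ + h1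
    rw [satakeRoot, C_add]
    simp only [mul_comp, sub_comp, one_comp, C_comp, X_comp, ← mul_assoc, d2, d4]
    linear_combination X ^ 2 * d
  have e := congrArg₂ (· * ·) (key 1) (key 2)
  simp only [← mul_comp] at e
  rw [satakeStandard, e, C_add, C_add, C_mul]
  simp only [map_ofNat]
  ring

theorem IsStandardPolynomial.eq (hp : Prime (p : GaussianInt)) {D : (Hecke2 p)[X]}
    (hD : IsStandardPolynomial p D) : D = standardPolynomial p := by
  have h := hD.trans (isStandardPolynomial_standardPolynomial hp).symm
  ext n
  apply satake_injective hp
  rw [← coeff_mapCoeffs, ← coeff_mapCoeffs, h]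

theorem parabolicEmbedding_one : parabolicEmbedding p 1 = 1 := HeckeAlgebra.heckeEmbedding_one

theorem parabolicEmbedding_mul (v w : Hecke2 p) : parabolicEmbedding p (v * w) =
    parabolicEmbedding p v * parabolicEmbedding p w :=
  HeckeAlgebra.heckeEmbedding_mul exists_mul_mem_parabolicGroup v w

end StandardPolynomial

/-! ### Assembly of the factorization -/

section Factorization

variable {p : ℕ} [Fact p.Prime]

/-- The image under ε is the quartic on the right-hand side of `factorization_of_relations`. The
goals left over are its relations, with the factor p⁻³ absorbed into a and b. -/
theorem mapCoeffs_standardPolynomial (hp : Prime (p : GaussianInt)) :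
    mapCoeffs (parabolicEmbedding p) (standardPolynomial p) =
      (1 - C (((p : ℚ) ^ (-3 : ℤ)) • (((Delta p)⁻¹ : (Hecke11 p)ˣ) * LambdaMinus p)) * X) *
        middleFactor p *
        (1 - C (((p : ℚ) ^ (-3 : ℤ)) • (((Delta p)⁻¹ : (Hecke11 p)ˣ) * LambdaPlus p)) * X) := by
  have hp0 := cast_p_ne_zero p
  have e3 : (p : ℚ) ^ (-3 : ℤ) = ((p : ℚ) ^ 3)⁻¹ := by rw [zpow_neg]; rfl
  have e2 : (p : ℚ) ^ (-2 : ℤ) = ((p : ℚ) ^ 2)⁻¹ := by rw [zpow_neg]; rfl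
  rw [reduced_lambdaMinus, reduced_lambdaPlus]
  have hs : parabolicEmbedding p (standardCoeff p) =
      ((p : ℚ) ^ (-3 : ℤ)) • torusCoset p 0 0 (-1) + S₁ p +
        ((p : ℚ) ^ (-3 : ℤ)) • torusCoset p 0 0 1 := by
    rw [standardCoeff, map_smul, map_sub, map_smul, parabolicEmbedding_modularTJ hp,
      parabolicEmbedding_one, S₁, reduced_TJ, reduced_nabla]
    module
  have hb : parabolicEmbedding p
      (((p : ℚ) ^ (-4 : ℤ)) • (modularCentral p * (modularT p * modularT p)) -
        (2 : ℚ) • standardCoeff p - (2 : ℚ) • 1) =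
      ((p : ℚ) ^ (-4 : ℤ)) • ((((Delta p)⁻¹ : (Hecke11 p)ˣ) : Hecke11 p) *
        ((TPlus p + TMinus p) * (TPlus p + TMinus p))) -
      (2 : ℚ) • (((p : ℚ) ^ (-3 : ℤ)) • torusCoset p 0 0 (-1) + S₁ p +
        ((p : ℚ) ^ (-3 : ℤ)) • torusCoset p 0 0 1) - (2 : ℚ) • 1 := by
    rw [map_sub, map_sub, map_smul, map_smul, map_smul, parabolicEmbedding_mul,
      parabolicEmbedding_mul, parabolicEmbedding_modularCentral, parabolicEmbedding_modularT hp,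
      parabolicEmbedding_one, hs]
  rw [standardPolynomial, mapCoeffs_quartic parabolicEmbedding_one, hb, hs, middleFactor]
  refine (factorization_of_relations hp0 (τ := torusCoset p 0 1 0) (ν := nablaReduced p)
    delta_inv_comm ?_ ?_ ?_ ?_ ?_ ?_ ?_ ?_ ?_ ?_ ?_).symm
  · rw [smul_mul_smul_comm, lambdaMinus_mul_lambdaPlus hp, smul_smul, e3]
    match_scalars
    field_simp
  · rw [smul_mul_assoc, lambdaMinus_mul_nabla hp, smul_comm]
  · rw [mul_smul_comm, nabla_mul_lambdaPlus hp, smul_comm]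
  · rw [smul_mul_assoc, lambdaMinus_mul_TPlus hp, smul_smul, e3, inv_mul_cancel₀ (pow_ne_zero _ hp0),
      one_smul]
  · rw [mul_smul_comm, TMinus_mul_lambdaPlus hp, smul_smul, e3, inv_mul_cancel₀ (pow_ne_zero _ hp0),
      one_smul]
  · rw [delta_inv_mul_TMinus_mul_TMinus hp, smul_mul_assoc, e2, e3]
    match_scalars <;> field_simp
  · rw [delta_inv_mul_TPlus_mul_TPlus hp, mul_smul_comm, e2, e3]
    match_scalars <;> field_simp
  · rw [smul_mul_assoc, smul_mul_smul_comm, lambdaMinus_mul_tau_mul_lambdaPlus hp, smul_smul, e3]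
    match_scalars
    field_simp
  · rw [S₁, reduced_TJ, reduced_nabla]
  · rw [S₂, reduced_TJ, reduced_nabla]
  · rw [S₃, reduced_nabla]

end Factorization

end

theorem mainTheorem6 (p : ℕ) [Fact p.Prime] (hp : Prime (p : GaussianInt)) :
    (∃! D : (Hecke2 p)[X], IsStandardPolynomial p D) ∧
    ∀ D : (Hecke2 p)[X], IsStandardPolynomial p D →
      mapCoeffs (parabolicEmbedding p) D =
        (1 - C (((p : ℚ) ^ (-3 : ℤ)) • (((Delta p)⁻¹ : (Hecke11 p)ˣ) * LambdaMinus p)) * X) *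
          middleFactor p *
          (1 - C (((p : ℚ) ^ (-3 : ℤ)) • (((Delta p)⁻¹ : (Hecke11 p)ˣ) * LambdaPlus p)) * X) := by
  refine ⟨⟨standardPolynomial p, isStandardPolynomial_standardPolynomial hp, fun D hD => hD.eq hp⟩,
    fun D hD => ?_⟩
  rw [hD.eq hp]
  exact mapCoeffs_standardPolynomial hp
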